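/- Let $k$ be a field of characteristic $0$ (for instance $k=\mathbb{R}$). Let $M=\mathrm{Spec}\,\mathcal{O}_M$ be an affine algebraic supervariety that is smooth (of finite type, with the infinitesimal lifting property for square-zero surjections of commutative superalgebras) over $k$, and let $\pi:C=\mathrm{Spec}\,\mathcal{O}_C\to M$ be a smooth morphism of affine supervarieties. (Ordinary varieties are the case where everything is even.) Let $\mathcal{D}\subset\mathrm{End}_k(\mathcal{O}_M)$ be the algebra of differential operators, generated by the functions and the vector fields on $M$; a commutative $\mathcal{D}$-algebra is a commutative algebra in the tensor category $(\mathrm{Mod}(\mathcal{D}),\otimes_{\mathcal{O}_M})$ of left $\mathcal{D}$-modules. Let $\mathcal{B}=\mathrm{Jet}(\mathcal{O}_C)$ be the free commutative $\mathcal{D}$-algebra generated by the $\mathcal{O}_M$-algebra $\mathcal{O}_C$, and $p:\mathrm{Jet}(C)=\mathrm{Spec}\,\mathcal{B}\to C$ the projection. Let $\mathcal{B}[\mathcal{D}]$ be the algebra generated by $\mathcal{B}$ and $\mathcal{D}$ with the two copies of $\mathcal{O}_M$ identified and $\partial b=\partial(b)+(-1)^{|\partial||b|}b\,\partial$ for vector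 fields $\partial$ on $M$ and $b\in\mathcal{B}$. Put $\mathcal{B}^r=\mathrm{Ber}_M\otimes_{\mathcal{O}_M}\mathcal{B}$; $\mathcal{B}^r[\mathcal{D}^{op}]$-modules are the same as right $\mathcal{B}[\mathcal{D}]$-modules. Let $d:\mathcal{B}\to\Omega^1_{\mathcal{B}}$ be the universal derivation of $\mathcal{B}$ with values in $\mathcal{B}[\mathcal{D}]$-modules, and let $$\Theta_{\mathcal{B}}=\mathcal{H}om_{\mathcal{B}[\mathcal{D}]}(\Omega^1_{\mathcal{B}},\mathcal{B}[\mathcal{D}]),\qquad \Theta_{C/M}=\mathcal{H}om_{\mathcal{O}_C}(\Omega^1_{C/M},\mathcal{O}_C).$$ 1. The map $p^*\Theta_{C/M}\otimes_{\mathcal{B}}\mathcal{B}[\mathcal{D}]\to\mathcal{H}om_{\mathcal{B}}(p^*\Omega^1_{C/M},\mathcal{B}[\mathcal{D}])$, $\theta\otimes b\otimes P\mapsto[\,p^*ds\mapsto p^*(\theta(ds))\,b\,P\,]$, is injective, and the restriction map $\Theta_{\mathcal{B}}\to\mathcal{H}om_{\mathcal{B}}(p^*\Omega^1_{C/M},\mathcal{B}[\mathcal{D}])$,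 $\theta\mapsto[\,p^*ds\mapsto\theta(d(p^*s))\,]$, factors through it. The resulting natural morphism of right $\mathcal{B}[\mathcal{D}]$-modules (that is, of $\mathcal{B}^r[\mathcal{D}^{op}]$-modules) $$\Theta_{\mathcal{B}}\to(p^*\Theta_{C/M})\otimes_{\mathcal{B}}\mathcal{B}[\mathcal{D}]$$ is an isomorphism, and it preserves parity. 2. The rank of $\Theta_{\mathcal{B}}$ over $\mathcal{B}[\mathcal{D}]$ equals the rank of $\Theta_{C/M}$ over $\mathcal{O}_C$, in the following sense. Let $q$ be any point of $\mathrm{Jet}(C)$. Then $\Theta_{C/M}$ is free of some rank $m|n$ over $\mathcal{O}_C$ near $p(q)$, and whenever it is free of rank $m|n$ near $p(q)$, the module $\Theta_{\mathcal{B}}$ is free of rank $m|n$ over $\mathcal{B}[\mathcal{D}]$ near $q$. If $\Theta_{\mathcal{B}}$ is also free of rank $m'|n'$ near $q$, then $m'+n'=m+n$; if moreover $\mathcal{O}_M$ is purely even, then $m'|n'=m|n$. -/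

import Mathlib

universe u

noncomputable section

namespace DGeom

open MulOpposite

/-! ## Superalgebras

The base field `k` has characteristic zero, so a `ℤ/2`-grading on a `k`-algebra is the same thing as
an involutive automorphism (the parity automorphism): even elements are the fixed ones, odd
elements those that change sign. -/

/-- A superalgebra over `k`: an algebra with its parity automorphism. -/
class Super (k A : Type u) [Field k] [Ring A] [Algebra k A] where
  aut : A →ₐ[k] A
  aut_aut : ∀ a, aut (aut a) = a

/-- The parity automorphism `a ↦ (-1)^|a| a`. -/
def parity (k A : Type u) [Field k] [Ring A] [Algebra k A] [Super k A] : A →ₐ[k] A := Super.aut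

theorem parity_parity (k : Type u) {A : Type u} [Field k] [Ring A] [Algebra k A] [Super k A]
    (a : A) : parity k A (parity k A a) = a := Super.aut_aut a

/-- The Koszul sign `(-1)^(i j)`. -/
def koszul (i j : ZMod 2) : ℤ := if i = 1 ∧ j = 1 then -1 else 1

section Basic

variable (k : Type u) [Field k] {A B : Type u}
variable [Ring A] [Algebra k A] [Super k A] [Ring B] [Algebra k B] [Super k B]

/-- The base field is a purely even superalgebra. -/
instance Super.base : Super k k where
  aut := AlgHom.id k k
  aut_aut _ := rfl

/-- `a` is homogeneous of parity `i`. -/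
def IsHom (i : ZMod 2) (a : A) : Prop := parity k A a = koszul i 1 • a

/-- `a ↦ (-1)^(i |a|) a`. -/
def twist (i : ZMod 2) (a : A) : A := if i = 1 then parity k A a else a

variable (A) in
/-- Commutativity in the super sense: `a b = (-1)^(|a| |b|) b a`. -/
def IsSuperComm : Prop :=
  ∀ (i j : ZMod 2) (a b : A), IsHom k i a → IsHom k j b → a * b = koszul i j • (b * a)

/-- Everything is even. -/
def IsPurelyEven (k A : Type u) [Field k] [Ring A] [Algebra k A] [Super k A] : Prop :=
  ∀ a : A, parity k A a = a

variable (A B) in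
/-- Morphisms of superalgebras: parity preserving algebra morphisms. -/
structure SuperHom extends A →ₐ[k] B where
  map_parity : ∀ a, toFun (parity k A a) = parity k B (toFun a)

variable (A) in
/-- The structure morphism of a superalgebra. -/
def SuperHom.scalars : SuperHom k k A where
  toAlgHom := Algebra.ofId k A
  map_parity c := ((parity k A).commutes c).symm

end Basic

/-- A morphism `R → S` of commutative superalgebras of finite type over a field is smooth: it is of
finite type (hence of finite presentation, `R` being noetherian) and has the infinitesimal lifting
property with respect to square-zero surjections of commutative superalgebras. -/
structure IsSmooth {k R S : Type u} [Field k] [Ring R] [Algebra k R] [Super k R]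
    [Ring S] [Algebra k S] [Super k S] (φ : SuperHom k R S) : Prop where
  finiteType : ∃ T : Finset S, Algebra.adjoin k (Set.range φ.toAlgHom ∪ (T : Set S)) = ⊤
  lifting : ∀ (A A' : Type u) [Ring A] [Algebra k A] [Super k A]
    [Ring A'] [Algebra k A'] [Super k A'],
    IsSuperComm k A → IsSuperComm k A' →
    ∀ π : SuperHom k A A', Function.Surjective π.toAlgHom →
    (∀ x y, π.toAlgHom x = 0 → π.toAlgHom y = 0 → x * y = 0) →
    ∀ (r : SuperHom k R A) (h : SuperHom k S A'),
      (∀ f, h.toAlgHom (φ.toAlgHom f) = π.toAlgHom (r.toAlgHom f)) →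
      ∃ l : SuperHom k S A, (∀ f, l.toAlgHom (φ.toAlgHom f) = r.toAlgHom f) ∧
        ∀ s, π.toAlgHom (l.toAlgHom s) = h.toAlgHom s

/-! ## Differential operators -/

section DiffOps

variable (k R : Type u) [Field k] [Ring R] [Algebra k R] [Super k R]

variable {R} in
/-- `δ` is a superderivation of `R` of parity `i`, i.e. a homogeneous vector field on `Spec R`. -/
structure IsSuperDer (i : ZMod 2) (δ : Module.End k R) : Prop where
  parity : ∀ a, parity k R (δ a) = koszul i 1 • δ (parity k R a)
  leibniz : ∀ a b, δ (a * b) = δ a * b + twist k i a * δ b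

/-- The algebra `𝒟` of differential operators: the subalgebra of `End_k(𝒪)` generated by left
multiplications by functions and by vector fields. -/
def diffOps : Subalgebra k (Module.End k R) :=
  Algebra.adjoin k ({P | ∃ f : R, P = LinearMap.mulLeft k f} ∪ {P | ∃ i, IsSuperDer k i P})

variable {R} in
/-- A function, as a differential operator of order zero. -/
def mulOp (f : R) : diffOps k R :=
  ⟨LinearMap.mulLeft k f, Algebra.subset_adjoin (Or.inl ⟨f, rfl⟩)⟩

variable {k R} in
/-- A homogeneous vector field, as a differential operator. -/
def derOp {i : ZMod 2} {δ : Module.End k R} (h : IsSuperDer k i δ) : diffOps k R :=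
  ⟨δ, Algebra.subset_adjoin (Or.inr ⟨i, h⟩)⟩

/-- Conjugation by the parity automorphism: the parity of `End_k(𝒪)`. -/
def conjParity : Module.End k R →ₐ[k] Module.End k R where
  toFun P := (parity k R).toLinearMap ∘ₗ P ∘ₗ
    (parity k R).toLinearMap
  map_one' := by ext a; simp [parity_parity]
  map_mul' P Q := by ext a; simp [parity_parity]
  map_zero' := by ext a; simp
  map_add' P Q := by ext a; simp
  commutes' c := by ext a; simp [parity_parity, Algebra.algebraMap_eq_smul_one]

variable {k R} in
theorem conjParity_of_isSuperDer {i : ZMod 2} {δ : Module.End k R} (h : IsSuperDer k i δ) :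
    conjParity k R δ = koszul i 1 • δ := by
  ext a
  simp [conjParity, h.parity, parity_parity]

theorem conjParity_mem (P : Module.End k R) (hP : P ∈ diffOps k R) :
    conjParity k R P ∈ diffOps k R := by
  have : diffOps k R ≤ (diffOps k R).comap (conjParity k R) := by
    refine Algebra.adjoin_le ?_
    rintro P (⟨f, rfl⟩ | ⟨i, h⟩)
    · refine Algebra.subset_adjoin (Or.inl ⟨parity k R f, ?_⟩)
      ext a
      simp [conjParity, parity_parity]
    · show conjParity k R P ∈ diffOps k R
      rw [conjParity_of_isSuperDer h]
      exact zsmul_mem (Algebra.subset_adjoin (Or.inr ⟨i, h⟩) : P ∈ diffOps k R) _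
  exact this hP

instance diffOps.super : Super k (diffOps k R) where
  aut := ((conjParity k R).comp (diffOps k R).val).codRestrict (diffOps k R)
    fun P => conjParity_mem k R P P.2
  aut_aut P := by
    apply Subtype.ext
    ext a
    simp [conjParity, parity_parity]

theorem parity_mulOp (f : R) :
    parity k (diffOps k R) (mulOp k f) = mulOp k (parity k R f) := by
  apply Subtype.ext
  ext a
  show parity k R (f * parity k R a) = parity k R f * a
  rw [map_mul, parity_parity]

theorem isHom_derOp {i : ZMod 2} {δ : Module.End k R} (h : IsSuperDer k i δ) :
    IsHom k i (derOp h) :=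
  Subtype.ext ((conjParity_of_isSuperDer h).trans
    (map_zsmul (diffOps k R).val (koszul i 1) (derOp h)).symm)

end DiffOps

/-! ## `𝒟`-algebras -/

/-- A commutative `𝒟`-algebra over `𝒪 = R`: a commutative superalgebra `A` which is a left
`𝒟`-module such that the multiplication `A ⊗_𝒪 A → A` is `𝒟`-linear for the Leibniz action. The
unit map `𝒪 → A` is `f ↦ f · 1`. -/
class DAlgebra (k R A : Type u) [Field k] [Ring R] [Algebra k R] [Super k R]
    [Ring A] [Algebra k A] [Super k A] where
  comm : IsSuperComm k A
  act : diffOps k R →ₐ[k] Module.End k A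
  parity_act : ∀ P a, parity k A (act P a) = act (parity k (diffOps k R) P) (parity k A a)
  act_mulOp : ∀ (f : R) (a b : A), act (mulOp k f) (a * b) = act (mulOp k f) a * b
  act_derOp : ∀ {i : ZMod 2} {δ : Module.End k R} (h : IsSuperDer k i δ) (a b : A),
    act (derOp h) (a * b) = act (derOp h) a * b + twist k i a * act (derOp h) b

/-! ## The jet algebra -/

section Jet

variable {k R S : Type u} [Field k] [Ring R] [Algebra k R] [Super k R]
variable [Ring S] [Algebra k S] [Super k S]

variable (k R S) in
/-- Expressions in elements of `S` built with the operations of a `𝒟`-algebra. -/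
inductive Jet.Pre
  | of (s : S)
  | scalar (c : k)
  | add (a b : Jet.Pre)
  | mul (a b : Jet.Pre)
  | act (P : diffOps k R) (a : Jet.Pre)
  | par (a : Jet.Pre)

namespace Jet

/-- The smallest congruence on expressions such that the quotient is a commutative `𝒟`-algebra and
`S` maps to it by a morphism of commutative `𝒪`-superalgebras. -/
inductive Rel (φ : SuperHom k R S) : Pre k R S → Pre k R S → Prop
  | refl (a) : Rel φ a a
  | symm {a b} : Rel φ a b → Rel φ b a
  | trans {a b c} : Rel φ a b → Rel φ b c → Rel φ a c
  | add_congr {a b c d} : Rel φ a b → Rel φ c d → Rel φ (.add a c) (.add b d)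
  | mul_congr {a b c d} : Rel φ a b → Rel φ c d → Rel φ (.mul a c) (.mul b d)
  | act_congr (P) {a b} : Rel φ a b → Rel φ (.act P a) (.act P b)
  | par_congr {a b} : Rel φ a b → Rel φ (.par a) (.par b)
  -- `k`-algebra
  | add_assoc (a b c) : Rel φ (.add (.add a b) c) (.add a (.add b c))
  | add_comm (a b) : Rel φ (.add a b) (.add b a)
  | zero_add (a) : Rel φ (.add (.scalar 0) a) a
  | neg_add (a) : Rel φ (.add (.mul (.scalar (-1)) a) a) (.scalar 0)
  | mul_assoc (a b c) : Rel φ (.mul (.mul a b) c) (.mul a (.mul b c))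
  | one_mul (a) : Rel φ (.mul (.scalar 1) a) a
  | mul_one (a) : Rel φ (.mul a (.scalar 1)) a
  | mul_add (a b c) : Rel φ (.mul a (.add b c)) (.add (.mul a b) (.mul a c))
  | add_mul (a b c) : Rel φ (.mul (.add a b) c) (.add (.mul a c) (.mul b c))
  | scalar_add (c d) : Rel φ (.scalar (c + d)) (.add (.scalar c) (.scalar d))
  | scalar_mul (c d) : Rel φ (.scalar (c * d)) (.mul (.scalar c) (.scalar d))
  | scalar_comm (c a) : Rel φ (.mul (.scalar c) a) (.mul a (.scalar c))
  -- parity automorphism, commutativity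
  | par_par (a) : Rel φ (.par (.par a)) a
  | par_add (a b) : Rel φ (.par (.add a b)) (.add (.par a) (.par b))
  | par_mul (a b) : Rel φ (.par (.mul a b)) (.mul (.par a) (.par b))
  | par_scalar (c) : Rel φ (.par (.scalar c)) (.scalar c)
  | comm (i j : ZMod 2) {a b} : Rel φ (.par a) (.mul (.scalar (koszul i 1 : ℤ)) a) →
      Rel φ (.par b) (.mul (.scalar (koszul j 1 : ℤ)) b) →
      Rel φ (.mul a b) (.mul (.scalar (koszul i j : ℤ)) (.mul b a))
  -- left `𝒟`-module
  | act_add (P a b) : Rel φ (.act P (.add a b)) (.add (.act P a) (.act P b))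
  | add_act (P Q a) : Rel φ (.act (P + Q) a) (.add (.act P a) (.act Q a))
  | mul_act (P Q a) : Rel φ (.act (P * Q) a) (.act P (.act Q a))
  | scalar_act (c a) : Rel φ (.act (algebraMap k _ c) a) (.mul (.scalar c) a)
  | par_act (P a) : Rel φ (.par (.act P a)) (.act (parity k (diffOps k R) P) (.par a))
  -- compatibility of the multiplication with the action of functions and vector fields
  | mulOp_act (f a b) : Rel φ (.act (mulOp k f) (.mul a b)) (.mul (.act (mulOp k f) a) b)
  | derOp_act {i : ZMod 2} {δ : Module.End k R} (h : IsSuperDer k i δ) (a b) :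
      Rel φ (.act (derOp h) (.mul a b))
        (.add (.mul (.act (derOp h) a) b) (.mul (if i = 1 then .par a else a) (.act (derOp h) b)))
  -- `S` maps to the quotient by a morphism of `𝒪`-superalgebras
  | of_add (s t) : Rel φ (.of (s + t)) (.add (.of s) (.of t))
  | of_mul (s t) : Rel φ (.of (s * t)) (.mul (.of s) (.of t))
  | of_scalar (c) : Rel φ (.of (algebraMap k S c)) (.scalar c)
  | of_par (s) : Rel φ (.of (parity k S s)) (.par (.of s))
  | of_map (f) : Rel φ (.of (φ.toAlgHom f)) (.act (mulOp k f) (.scalar 1))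

def setoid (φ : SuperHom k R S) : Setoid (Pre k R S) where
  r := Rel φ
  iseqv := ⟨.refl, .symm, .trans⟩

end Jet

/-- The jet algebra `Jet(𝒪_C)`: the free commutative `𝒟_M`-algebra generated by the
`𝒪_M`-algebra `𝒪_C`, where `φ : 𝒪_M → 𝒪_C` is the structure morphism. -/
def Jet (φ : SuperHom k R S) : Type u := Quotient (Jet.setoid φ)

namespace Jet

variable (φ : SuperHom k R S)

/-- The class of an expression. -/
def mk (a : Pre k R S) : Jet φ := Quotient.mk (setoid φ) a

variable {φ} in
theorem sound {a b : Pre k R S} (h : Rel φ a b) : mk φ a = mk φ b := Quotient.sound h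

variable {φ} in
theorem exact {a b : Pre k R S} (h : mk φ a = mk φ b) : Rel φ a b := Quotient.exact h

variable {φ} in
theorem ind {p : Jet φ → Prop} (h : ∀ a, p (mk φ a)) : ∀ x, p x := Quotient.ind h

instance : Zero (Jet φ) := ⟨mk φ (.scalar 0)⟩
instance : One (Jet φ) := ⟨mk φ (.scalar 1)⟩
instance : Add (Jet φ) :=
  ⟨Quotient.map₂ .add fun _ _ h _ _ h' => Rel.add_congr h h'⟩
instance : Mul (Jet φ) :=
  ⟨Quotient.map₂ .mul fun _ _ h _ _ h' => Rel.mul_congr h h'⟩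
instance : Neg (Jet φ) := ⟨fun a => mk φ (.scalar (-1)) * a⟩

instance : Ring (Jet φ) where
  add_assoc := by
    refine ind fun a => ind fun b => ind fun c => sound (.add_assoc a b c)
  zero_add := ind fun a => sound (.zero_add a)
  add_zero := ind fun a => sound (.trans (.add_comm a _) (.zero_add a))
  add_comm := ind fun a => ind fun b => sound (.add_comm a b)
  left_distrib := ind fun a => ind fun b => ind fun c => sound (.mul_add a b c)
  right_distrib := ind fun a => ind fun b => ind fun c => sound (.add_mul a b c)
  zero_mul := ind fun a => sound <| by
    have h0 : Rel φ (.scalar 0) (.add (.scalar (-1)) (.scalar 1)) := by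
      simpa using Rel.scalar_add (φ := φ) (-1) 1
    exact ((Rel.mul_congr h0 (.refl a)).trans (.add_mul _ _ _)).trans
      ((Rel.add_congr (.refl _) (.one_mul a)).trans (.neg_add a))
  mul_zero := ind fun a => sound <| by
    have h0 : Rel φ (.scalar 0) (.add (.scalar (-1)) (.scalar 1)) := by
      simpa using Rel.scalar_add (φ := φ) (-1) 1
    exact (Rel.scalar_comm 0 a).symm.trans
      (((Rel.mul_congr h0 (.refl a)).trans (.add_mul _ _ _)).trans
      ((Rel.add_congr (.refl _) (.one_mul a)).trans (.neg_add a)))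
  mul_assoc := ind fun a => ind fun b => ind fun c => sound (.mul_assoc a b c)
  one_mul := ind fun a => sound (.one_mul a)
  mul_one := ind fun a => sound (.mul_one a)
  neg_add_cancel := ind fun a => sound (.neg_add a)
  nsmul := nsmulRec
  zsmul := zsmulRec

instance : Algebra k (Jet φ) :=
  RingHom.toAlgebra'
    { toFun := fun c => mk φ (.scalar c)
      map_one' := rfl
      map_zero' := rfl
      map_mul' := fun c d => sound (.scalar_mul c d)
      map_add' := fun c d => sound (.scalar_add c d) }
    fun c => ind fun a => sound (.scalar_comm c a)

instance : Super k (Jet φ) where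
  aut :=
    { toFun := Quotient.map .par fun _ _ h => Rel.par_congr h
      map_one' := sound (.par_scalar 1)
      map_zero' := sound (.par_scalar 0)
      map_mul' := ind fun a => ind fun b => sound (.par_mul a b)
      map_add' := ind fun a => ind fun b => sound (.par_add a b)
      commutes' := fun c => sound (.par_scalar c) }
  aut_aut := ind fun a => sound (.par_par a)

theorem scalar_mul_eq (n : ℤ) (x : Jet φ) : mk φ (.scalar (n : k)) * x = n • x := by
  have : mk φ (.scalar (n : k)) = (n : Jet φ) := map_intCast (algebraMap k (Jet φ)) n
  rw [this, zsmul_eq_mul]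

/-- The action of a differential operator. -/
def actEnd (P : diffOps k R) : Module.End k (Jet φ) where
  toFun := Quotient.map (.act P) fun _ _ h => Rel.act_congr P h
  map_add' := ind fun a => ind fun b => sound (.act_add P a b)
  map_smul' c := ind fun a => by
    refine (congrArg _ (Algebra.smul_def c (mk φ a))).trans (Eq.trans ?_
      (Algebra.smul_def c (mk φ (.act P a))).symm)
    refine sound ?_
    refine Rel.trans (.act_congr P (.symm (.scalar_act c a))) ?_
    refine Rel.trans (.symm (.mul_act P _ a)) ?_
    rw [← Algebra.commutes]
    exact Rel.trans (.mul_act _ P a) (.scalar_act c _)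

instance : DAlgebra k R (Jet φ) where
  comm i j := ind fun a => ind fun b => fun ha hb => by
    rw [← scalar_mul_eq]
    unfold IsHom at ha hb
    rw [← scalar_mul_eq] at ha hb
    exact sound (.comm i j (exact ha) (exact hb))
  act :=
    { toFun := actEnd φ
      map_one' := LinearMap.ext <| ind fun a => sound <| by
        have h := Rel.scalar_act (φ := φ) 1 a
        rw [map_one] at h
        exact h.trans (.one_mul a)
      map_zero' := LinearMap.ext <| ind fun a => by
        have h := sound (Rel.scalar_act (φ := φ) 0 a)
        rw [map_zero] at h
        exact h.trans (zero_mul (mk φ a))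
      map_mul' := fun P Q => LinearMap.ext <| ind fun a => sound (.mul_act P Q a)
      map_add' := fun P Q => LinearMap.ext <| ind fun a => sound (.add_act P Q a)
      commutes' := fun c => LinearMap.ext <| ind fun a => by
        refine (sound (Rel.scalar_act (φ := φ) c a)).trans ?_
        exact (Algebra.smul_def c (mk φ a)).symm }
  parity_act P := ind fun a => sound (.par_act P a)
  act_mulOp f := ind fun a => ind fun b => sound (.mulOp_act f a b)
  act_derOp {i δ} h := ind fun a => ind fun b => by
    refine (sound (Rel.derOp_act h a b)).trans ?_
    unfold twist
    split_ifs <;> rfl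

/-- The morphism `𝒪_C → Jet(𝒪_C)`, corresponding to the projection `p : Jet(C) → C`. -/
def of : SuperHom k S (Jet φ) where
  toFun s := mk φ (.of s)
  map_one' := by
    have h := Rel.of_scalar (φ := φ) 1
    rw [map_one] at h
    exact sound h
  map_zero' := by
    have h := Rel.of_scalar (φ := φ) 0
    rw [map_zero] at h
    exact sound h
  map_mul' s t := sound (.of_mul s t)
  map_add' s t := sound (.of_add s t)
  commutes' c := sound (.of_scalar c)
  map_parity s := sound (.of_par s)

end Jet

end Jet

/-! ## The algebra `A[𝒟]` -/

section AD

variable (k R A : Type u) [Field k] [Ring R] [Algebra k R] [Super k R]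
variable [Ring A] [Algebra k A] [Super k A] [DAlgebra k R A]

/-- The relations of `A[𝒟]`: those of `A`, those of `𝒟`, the two copies of `𝒪` are identified, and
`∂ a = ∂(a) + (-1)^(|∂| |a|) a ∂` for vector fields `∂`. -/
inductive AD.Rel : FreeAlgebra k (A ⊕ diffOps k R) → FreeAlgebra k (A ⊕ diffOps k R) → Prop
  | fun_add (a b : A) : AD.Rel (.ι k (.inl (a + b))) (.ι k (.inl a) + .ι k (.inl b))
  | fun_mul (a b : A) : AD.Rel (.ι k (.inl (a * b))) (.ι k (.inl a) * .ι k (.inl b))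
  | fun_scalar (c : k) : AD.Rel (.ι k (.inl (algebraMap k A c))) (algebraMap k _ c)
  | op_add (P Q : diffOps k R) : AD.Rel (.ι k (.inr (P + Q))) (.ι k (.inr P) + .ι k (.inr Q))
  | op_mul (P Q : diffOps k R) : AD.Rel (.ι k (.inr (P * Q))) (.ι k (.inr P) * .ι k (.inr Q))
  | op_scalar (c : k) : AD.Rel (.ι k (.inr (algebraMap k _ c))) (algebraMap k _ c)
  | unit (f : R) : AD.Rel (.ι k (.inr (mulOp k f)))
      (.ι k (.inl (DAlgebra.act (A := A) (mulOp k f) 1)))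
  | leibniz {i : ZMod 2} {δ : Module.End k R} (h : IsSuperDer k i δ) (a : A) :
      AD.Rel (.ι k (.inr (derOp h)) * .ι k (.inl a))
        (.ι k (.inl (DAlgebra.act (derOp h) a)) + .ι k (.inl (twist k i a)) * .ι k (.inr (derOp h)))

/-- The algebra `A[𝒟]`. Its left modules are the modules over the algebra `A` in the tensor category
of left `𝒟`-modules. Its right modules are the right `𝒟`-modules `N` with an action
`A ⊗_𝒪 N = A^r ⊗^! N → N` of the algebra `A^r = Ber_M ⊗_𝒪 A` of the tensor category
`(Mod(𝒟^op), ⊗^!)`, i.e. the `A^r[𝒟^op]`-modules. -/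
def AD : Type u := RingQuot (AD.Rel k R A)

namespace AD

instance : Ring (AD k R A) := inferInstanceAs (Ring (RingQuot (AD.Rel k R A)))
instance : Algebra k (AD k R A) := inferInstanceAs (Algebra k (RingQuot (AD.Rel k R A)))

/-- The class of an expression. -/
def mk : FreeAlgebra k (A ⊕ diffOps k R) →ₐ[k] AD k R A := RingQuot.mkAlgHom k (AD.Rel k R A)

variable {k R A} in
theorem mk_rel {x y : FreeAlgebra k (A ⊕ diffOps k R)} (h : AD.Rel k R A x y) :
    mk k R A x = mk k R A y := RingQuot.mkAlgHom_rel k h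

/-- A function, as an element of `A[𝒟]`. -/
def ofFun : A →ₐ[k] AD k R A where
  toFun a := mk k R A (.ι k (.inl a))
  map_one' := by
    have h := mk_rel (Rel.fun_scalar (R := R) (A := A) (1 : k))
    rwa [map_one, map_one, map_one] at h
  map_zero' := by
    have h := mk_rel (Rel.fun_scalar (R := R) (A := A) (0 : k))
    rwa [map_zero, map_zero, map_zero] at h
  map_mul' a b := by
    rw [mk_rel (Rel.fun_mul a b), map_mul]
  map_add' a b := by
    rw [mk_rel (Rel.fun_add a b), map_add]
  commutes' c := by
    rw [mk_rel (Rel.fun_scalar c), AlgHom.commutes]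

/-- A differential operator, as an element of `A[𝒟]`. -/
def ofOp : diffOps k R →ₐ[k] AD k R A where
  toFun P := mk k R A (.ι k (.inr P))
  map_one' := by
    have h := mk_rel (Rel.op_scalar (R := R) (A := A) (1 : k))
    rwa [map_one, map_one, map_one] at h
  map_zero' := by
    have h := mk_rel (Rel.op_scalar (R := R) (A := A) (0 : k))
    rwa [map_zero, map_zero, map_zero] at h
  map_mul' a b := by
    rw [mk_rel (Rel.op_mul a b), map_mul]
  map_add' a b := by
    rw [mk_rel (Rel.op_add a b), map_add]
  commutes' c := by
    rw [mk_rel (Rel.op_scalar c), AlgHom.commutes]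

theorem ofOp_mulOp (f : R) :
    ofOp k R A (mulOp k f) = ofFun k R A (DAlgebra.act (mulOp k f) 1) := mk_rel (Rel.unit f)

theorem ofOp_derOp_mul {i : ZMod 2} {δ : Module.End k R} (h : IsSuperDer k i δ) (a : A) :
    ofOp k R A (derOp h) * ofFun k R A a =
      ofFun k R A (DAlgebra.act (derOp h) a) + ofFun k R A (twist k i a) * ofOp k R A (derOp h) := by
  have := mk_rel (Rel.leibniz h a)
  rw [map_mul, map_add, map_mul] at this
  exact this

theorem parity_twist (i : ZMod 2) (a : A) :
    parity k A (twist k i a) = twist k i (parity k A a) := by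
  unfold twist; split_ifs <;> rfl

/-- The parity automorphism of `A[𝒟]`, on expressions. -/
def parityPre : FreeAlgebra k (A ⊕ diffOps k R) →ₐ[k] AD k R A :=
  FreeAlgebra.lift k (Sum.elim (fun a => ofFun k R A (parity k A a))
    fun P => ofOp k R A (parity k (diffOps k R) P))

theorem parityPre_rel {x y : FreeAlgebra k (A ⊕ diffOps k R)} (h : AD.Rel k R A x y) :
    parityPre k R A x = parityPre k R A y := by
  induction h with
  | fun_add a b => simp [parityPre]
  | fun_mul a b => simp [parityPre]
  | fun_scalar c => simp [parityPre]
  | op_add P Q => simp [parityPre]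
  | op_mul P Q => simp [parityPre]
  | op_scalar c => simp only [parityPre, FreeAlgebra.lift_ι_apply, Sum.elim_inr, AlgHom.commutes]
  | unit f =>
    simp only [parityPre, FreeAlgebra.lift_ι_apply, Sum.elim_inr, Sum.elim_inl,
      DAlgebra.parity_act, map_one, parity_mulOp, ofOp_mulOp]
  | leibniz h a =>
    have hp : parity k (diffOps k R) (derOp h) = _ := isHom_derOp k R h
    simp only [parityPre, FreeAlgebra.lift_ι_apply, Sum.elim_inr, Sum.elim_inl, map_mul, map_add,
      DAlgebra.parity_act, hp, map_zsmul, smul_mul_assoc, ofOp_derOp_mul, smul_add,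
      mul_smul_comm, parity_twist, LinearMap.smul_apply]

/-- The parity automorphism of `A[𝒟]`. -/
def parityHom : AD k R A →ₐ[k] AD k R A :=
  RingQuot.liftAlgHom k ⟨parityPre k R A, fun _ _ h => parityPre_rel k R A h⟩

theorem parityHom_mk (x : FreeAlgebra k (A ⊕ diffOps k R)) :
    parityHom k R A (mk k R A x) = parityPre k R A x :=
  RingQuot.liftAlgHom_mkAlgHom_apply k (parityPre k R A) (fun _ _ h => parityPre_rel k R A h) x

theorem parityHom_ofFun (a : A) :
    parityHom k R A (ofFun k R A a) = ofFun k R A (parity k A a) := by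
  refine (parityHom_mk k R A _).trans ?_
  simp [parityPre]

theorem parityHom_ofOp (P : diffOps k R) :
    parityHom k R A (ofOp k R A P) = ofOp k R A (parity k (diffOps k R) P) := by
  refine (parityHom_mk k R A _).trans ?_
  simp [parityPre]

variable {k R A} in
theorem hom_ext {B : Type u} [Ring B] [Algebra k B] {f g : AD k R A →ₐ[k] B}
    (h : ∀ a, f (ofFun k R A a) = g (ofFun k R A a))
    (h' : ∀ P, f (ofOp k R A P) = g (ofOp k R A P)) : f = g := by
  refine RingQuot.ringQuot_ext' k f g (FreeAlgebra.hom_ext (funext ?_))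
  rintro (a | P)
  · exact h a
  · exact h' P

instance : Super k (AD k R A) where
  aut := parityHom k R A
  aut_aut x := by
    suffices H : (parityHom k R A).comp (parityHom k R A) = AlgHom.id k (AD k R A) from
      DFunLike.congr_fun H x
    refine hom_ext (fun a => ?_) fun P => ?_
    · simp [parityHom_ofFun, parity_parity]
    · simp [parityHom_ofOp, parity_parity]

end AD

end AD

/-! ## Differential forms and vector fields -/

section Forms

variable (k R A : Type u) [Field k] [Ring R] [Algebra k R] [Super k R]
variable [Ring A] [Algebra k A] [Super k A] [DAlgebra k R A]

/-- The relations expressing that `a ↦ d a` is a `𝒟`-linear derivation with values in a left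
`A[𝒟]`-module. -/
inductive FormRel : (A →₀ AD k R A) → Prop
  | add (a b : A) :
      FormRel (Finsupp.single (a + b) 1 - Finsupp.single a 1 - Finsupp.single b 1)
  | act (P : diffOps k R) (a : A) :
      FormRel (Finsupp.single (DAlgebra.act P a) 1 - Finsupp.single a (AD.ofOp k R A P))
  | leibniz (i j : ZMod 2) (a b : A) (ha : IsHom k i a) (hb : IsHom k j b) :
      FormRel (Finsupp.single (a * b) 1 - Finsupp.single b (AD.ofFun k R A a) -
        koszul i j • Finsupp.single a (AD.ofFun k R A b))

/-- `Ω¹_A`: the target of the universal derivation of `A` with values in `A[𝒟]`-modules. -/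
abbrev Forms : Type u :=
  (A →₀ AD k R A) ⧸ Submodule.span (AD k R A) {x | FormRel k R A x}

variable {A} in
/-- The universal derivation `A → Ω¹_A`. -/
def Forms.d (a : A) : Forms k R A := Submodule.Quotient.mk (Finsupp.single a 1)

/-- The local vector fields `Θ_A = ℋom_{A[𝒟]}(Ω¹_A, A[𝒟])`, a right `A[𝒟]`-module. -/
abbrev LocalFields : Type u := Forms k R A →ₗ[AD k R A] AD k R A

variable {k R A} in
/-- `θ` is homogeneous of parity `i`. -/
def LocalFields.IsHomog (i : ZMod 2) (θ : LocalFields k R A) : Prop :=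
  ∀ a : A, parity k (AD k R A) (θ (Forms.d k R a)) =
    koszul i 1 • θ (Forms.d k R (parity k A a))

end Forms

section RelForms

variable {k R S : Type u} [Field k] [Ring R] [Algebra k R] [Super k R]
variable [Ring S] [Algebra k S] [Super k S] (φ : SuperHom k R S)

/-- The relations expressing that `s ↦ d s` is an `R`-linear derivation with values in a left
`S`-module. -/
inductive RelFormRel : (S →₀ S) → Prop
  | add (s t : S) :
      RelFormRel (Finsupp.single (s + t) 1 - Finsupp.single s 1 - Finsupp.single t 1)
  | base (f : R) : RelFormRel (Finsupp.single (φ.toAlgHom f) 1)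
  | leibniz (i j : ZMod 2) (s t : S) (hs : IsHom k i s) (ht : IsHom k j t) :
      RelFormRel (Finsupp.single (s * t) 1 - Finsupp.single t s - koszul i j • Finsupp.single s t)

/-- The relative differential forms `Ω¹_{C/M}`, a left `𝒪_C`-module. -/
abbrev RelForms : Type u := (S →₀ S) ⧸ Submodule.span S {x | RelFormRel φ x}

/-- The universal relative derivation `𝒪_C → Ω¹_{C/M}`. -/
def RelForms.d (s : S) : RelForms φ := Submodule.Quotient.mk (Finsupp.single s 1)

/-- The relative vector fields `Θ_{C/M} = ℋom_{𝒪_C}(Ω¹_{C/M}, 𝒪_C)`, a right `𝒪_C`-module. -/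
abbrev RelFields : Type u := RelForms φ →ₗ[S] S

variable {φ} in
/-- `θ` is homogeneous of parity `i`. -/
def RelFields.IsHomog (i : ZMod 2) (θ : RelFields φ) : Prop :=
  ∀ s : S, parity k S (θ (RelForms.d φ s)) = koszul i 1 • θ (RelForms.d φ (parity k S s))

end RelForms

/-! ## Extension of scalars of right modules -/

section Ext

open TensorProduct

variable {A C : Type u} [Ring A] [Ring C] (f : A →+* C)
variable (X : Type u) [AddCommGroup X] [Module Aᵐᵒᵖ X]

/-- `X ⊗_A C` for a right `A`-module `X` and a ring morphism `f : A → C`: a right `C`-module. (The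
underlying tensor product over `ℤ` is written with `C` on the left.) -/
abbrev RightExt : Type u :=
  (C ⊗[ℤ] X) ⧸ Submodule.span Cᵐᵒᵖ
    {z | ∃ (c : C) (a : A) (x : X), z = (f a * c) ⊗ₜ[ℤ] x - c ⊗ₜ[ℤ] (op a • x)}

variable {X} in
/-- The element `x ⊗ c` of `X ⊗_A C`. -/
def RightExt.tmul (x : X) (c : C) : RightExt f X := Submodule.Quotient.mk (c ⊗ₜ[ℤ] x)

variable {X} {N : Type u} [AddCommGroup N] [Module Cᵐᵒᵖ N]

/-- The morphism `x ⊗ c ↦ g(x) c` of right `C`-modules. -/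
def RightExt.lift (g : X →+ N) (hg : ∀ (a : A) (x : X), g (op a • x) = op (f a) • g x) :
    RightExt f X →ₗ[Cᵐᵒᵖ] N :=
  Submodule.liftQ _
    ({ toFun := TensorProduct.liftAddHom
          { toFun := fun c =>
              { toFun := fun x => op c • g x
                map_zero' := by simp
                map_add' := fun x y => by simp }
            map_zero' := by ext x; simp
            map_add' := fun c c' => by ext x; simp [add_smul] }
          (fun n c x => by
            show op (n • c) • g x = op c • g (n • x)
            rw [op_smul, smul_assoc, map_zsmul, smul_comm])
       map_add' := map_add _
       map_smul' := fun c z => by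
        induction z with
        | zero => simp
        | tmul c' x => simp [TensorProduct.smul_tmul', mul_smul]
        | add x y hx hy => simp only [smul_add, map_add, hx, hy] } :
      (C ⊗[ℤ] X) →ₗ[Cᵐᵒᵖ] N)
    (by
      rw [Submodule.span_le]
      rintro _ ⟨c, a, x, rfl⟩
      simp [hg, mul_smul])

theorem RightExt.lift_tmul (g : X →+ N) (hg : ∀ (a : A) (x : X), g (op a • x) = op (f a) • g x)
    (x : X) (c : C) : RightExt.lift f g hg (RightExt.tmul f x c) = op c • g x := by
  simp [RightExt.lift, RightExt.tmul]

end Ext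

/-! ## The natural map -/

section NaturalMap

variable {k R S : Type u} [Field k] [Ring R] [Algebra k R] [Super k R]
variable [Ring S] [Algebra k S] [Super k S] (φ : SuperHom k R S)

/-- `ℬ[𝒟]` for `ℬ = Jet(𝒪_C)`. -/
abbrev JetD : Type u := AD k R (Jet φ)

/-- `p^*Θ_{C/M} = Θ_{C/M} ⊗_{𝒪_C} ℬ`, a right `ℬ`-module. -/
abbrev PullbackFields : Type u := RightExt (Jet.of φ).toAlgHom.toRingHom (RelFields φ)

/-- `p^*Θ_{C/M} ⊗_ℬ ℬ[𝒟]`, a right `ℬ[𝒟]`-module. -/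
abbrev InducedFields : Type u :=
  RightExt (AD.ofFun k R (Jet φ)).toRingHom (PullbackFields φ)

/-- The homogeneous elements of parity `i` of `p^*Θ_{C/M} ⊗_ℬ ℬ[𝒟]`. -/
def InducedFields.homog (i : ZMod 2) : AddSubgroup (InducedFields φ) :=
  AddSubgroup.closure {z | ∃ (i₁ i₂ i₃ : ZMod 2) (θ : RelFields φ) (b : Jet φ) (P : JetD φ),
    i₁ + i₂ + i₃ = i ∧ θ.IsHomog i₁ ∧ IsHom k i₂ b ∧ IsHom k i₃ P ∧
    z = RightExt.tmul _ (RightExt.tmul _ θ b) P}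

/-- The values of an element of `p^*Θ_{C/M}` on the pullbacks of the forms `d s`:
`θ ⊗ b ↦ (s ↦ p^*(θ(d s)) b)`. -/
def PullbackFields.eval : PullbackFields φ →ₗ[(Jet φ)ᵐᵒᵖ] (S → Jet φ) :=
  RightExt.lift _
    { toFun := fun θ s => (Jet.of φ).toAlgHom (θ (RelForms.d φ s))
      map_zero' := by ext s; simp
      map_add' := fun θ θ' => by ext s; simp }
    (fun a θ => by ext s; simp)

/-- The pairing of `p^*Θ_{C/M} ⊗_ℬ ℬ[𝒟]` with `p^*Ω¹_{C/M}`, with values in `ℬ[𝒟]`, on the pullbacks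
of the forms `d s`: `θ ⊗ b ⊗ P ↦ (s ↦ p^*(θ(d s)) b P)`. As these forms generate `p^*Ω¹_{C/M}`, this
is the map `p^*Θ_{C/M} ⊗_ℬ ℬ[𝒟] → ℋom_ℬ(p^*Ω¹_{C/M}, ℬ[𝒟])`. -/
def InducedFields.eval : InducedFields φ →ₗ[(JetD φ)ᵐᵒᵖ] (S → JetD φ) :=
  RightExt.lift _
    { toFun := fun x s => AD.ofFun k R (Jet φ) (PullbackFields.eval φ x s)
      map_zero' := by ext s; simp
      map_add' := fun x y => by ext s; simp }
    (fun a x => by ext s; simp)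

theorem InducedFields.eval_tmul (θ : RelFields φ) (b : Jet φ) (P : JetD φ) (s : S) :
    InducedFields.eval φ (RightExt.tmul _ (RightExt.tmul _ θ b) P) s =
      AD.ofFun k R (Jet φ) ((Jet.of φ).toAlgHom (θ (RelForms.d φ s)) * b) * P := by
  have h : PullbackFields.eval φ (RightExt.tmul _ θ b) s =
      (Jet.of φ).toAlgHom (θ (RelForms.d φ s)) * b := by
    unfold PullbackFields.eval
    rw [RightExt.lift_tmul]
    rfl
  rw [← h]
  unfold InducedFields.eval
  rw [RightExt.lift_tmul]
  rfl

/-- The restriction of a local vector field `Ω¹_ℬ → ℬ[𝒟]` along the natural map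
`p^*Ω¹_{C/M} → Ω¹_ℬ`, on the pullbacks of the forms `d s`. -/
def LocalFields.restrict (θ : LocalFields k R (Jet φ)) (s : S) : JetD φ :=
  θ (Forms.d k R ((Jet.of φ).toAlgHom s))

end NaturalMap

/-! ## Rank -/

/-- Let `N` be a right `C`-module with a notion of homogeneous elements, and `f : A → C` a ring
morphism from a commutative superalgebra. This says that `N` is free of rank `m|n` in the
neighbourhood `D(g)` of the point `q` of `Spec A`, for some even `g ∉ q`: there are `m` even and `n`
odd elements of `N` which form a basis of the right module `N[g⁻¹]` over `C[g⁻¹]`. -/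
def FreeNear (k : Type u) {A C N : Type u} [Field k] [Ring A] [Algebra k A] [Super k A] [Ring C]
    (f : A →+* C) [AddCommGroup N] [Module Cᵐᵒᵖ N] (homog : ZMod 2 → N → Prop)
    (q : Ideal A) (m n : ℕ) : Prop :=
  ∃ g : A, IsHom k 0 g ∧ g ∉ q ∧ ∃ v : Fin m ⊕ Fin n → N,
    (∀ t, homog 0 (v (.inl t))) ∧ (∀ t, homog 1 (v (.inr t))) ∧
    (∀ x : N, ∃ (l : ℕ) (c : Fin m ⊕ Fin n → C), op (f g ^ l) • x = ∑ t, op (c t) • v t) ∧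
    (∀ c : Fin m ⊕ Fin n → C, ∑ t, op (c t) • v t = 0 → ∃ l : ℕ, ∀ t, c t * f g ^ l = 0)

end DGeom

end

open DGeom

set_option linter.unusedSectionVars false
set_option linter.unusedSimpArgs false

noncomputable section

namespace DGeom

open MulOpposite

/-! ## Homogeneous components -/

/-! Smoothness enters through one algebraic consequence. Let `x t` be the homogeneous components of
finitely many generators of 𝒪_C. Then S ⊕ S^ι → S ⊕ Ω¹_{C/M}, sending the t-th basis vector to d(x
t), is a surjection with square-zero kernel. Lifting s ↦ s + ds along it gives a derivation S → S^ι,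
that is, relative vector fields θ_t with ω = Σ θ_t(ω) d(x t) for every form ω
(`IsSmooth.exists_dualBasis`).

The isomorphism. A local vector field is a 𝒟-linear derivation ℬ → ℬ[𝒟]. A homogeneous derivation
𝒪_C → ℬ[𝒟] over 𝒪_M is the same as a morphism from 𝒪_C to the square-zero extension of ℬ by ℬ[𝒟],
with the parity of ℬ[𝒟] shifted if necessary. This extension is again a commutative 𝒟-algebra, so
the freeness of ℬ extends the morphism to ℬ (`exists_localField`); the extension is unique because
the forms d(p^*s) generate Ω¹_ℬ over ℬ[𝒟] (`LocalFields.ext_restrict`). Thus Θ_ℬ consists of the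
semilinear maps Ω¹_{C/M} → ℬ[𝒟], and the dual basis identifies these with p^*Θ_{C/M} ⊗ ℬ[𝒟]
(`DualBasis.toInduced_bijective`).

Existence of bases. A minimal subfamily of the θ_t generating Θ_{C/M} near a prime is a local basis,
by a determinant form of Nakayama's lemma for supercommutative rings
(`IsSuperComm.exists_mul_eq_zero`). It induces a local basis of Θ_ℬ because iterated commutators
with an even function g kill every element of ℬ[𝒟]: powers of g satisfy the Ore condition, and left
g-torsion is right g-torsion.

Uniqueness of the rank. Pass to the fibre K ⊗_ℬ ℬ[𝒟] at the residue field K of q. It is a nonzero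
right ℬ[𝒟]-module on which even functions not vanishing at q act injectively, so the transition
matrix between two local bases acts injectively on tuples (`Fiber.ρ_transition_injective`). Since M
is smooth, finitely many vector fields generate all of them and supercommute up to lower order, so
the operators of order less than n span a subspace of the fibre of dimension at most a power of n. A
matrix of operators raises orders by a bounded amount; if it were injective with too few columns,
iteration would force exponential growth (`VectorFrame.card_le_of_injective`). If 𝒪_M is purely
even, the right action on the fibre ignores parity, the blocks of the transition matrix mixing even
and odd members act by zero, and the same count applies to each diagonal block. -/

theorem zmod_two_cases (i : ZMod 2) : i = 0 ∨ i = 1 := by revert i; decide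

@[simp] theorem koszul_zero_left (i : ZMod 2) : koszul 0 i = 1 := by simp [koszul]

@[simp] theorem koszul_zero_right (i : ZMod 2) : koszul i 0 = 1 := by simp [koszul]

@[simp] theorem koszul_one_one : koszul 1 1 = -1 := rfl

theorem koszul_mul_self (i j : ZMod 2) : koszul i j * koszul i j = 1 := by
  revert i j; decide

theorem koszul_add_left (i j l : ZMod 2) : koszul (i + j) l = koszul i l * koszul j l := by
  revert i j l; decide

section Components

variable (k : Type u) [Field k] [CharZero k] {A B : Type u}
variable [Ring A] [Algebra k A] [Super k A] [Ring B] [Algebra k B] [Super k B]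

/-- The homogeneous component of parity `i`. -/
def homPart (i : ZMod 2) : A →ₗ[k] A :=
  (2⁻¹ : k) • (LinearMap.id + koszul i 1 • (parity k A).toLinearMap)

theorem homPart_apply (i : ZMod 2) (a : A) :
    homPart k i a = (2⁻¹ : k) • (a + koszul i 1 • parity k A a) := rfl

variable {k}

theorem isHom_zero_iff {a : A} : IsHom k 0 a ↔ parity k A a = a := by simp [IsHom]

theorem isHom_homPart (i : ZMod 2) (a : A) : IsHom k i (homPart k i a) := by
  unfold IsHom
  rw [homPart_apply, map_smul, map_add, map_zsmul, parity_parity, smul_comm (koszul i 1)]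
  congr 1
  rw [smul_add, smul_smul, koszul_mul_self, one_smul, add_comm]

theorem parity_homPart (i : ZMod 2) (a : A) :
    parity k A (homPart k i a) = koszul i 1 • homPart k i a := isHom_homPart i a

theorem homPart_parity (i : ZMod 2) (a : A) :
    homPart k i (parity k A a) = koszul i 1 • homPart k i a := by
  rw [← parity_homPart, homPart_apply, homPart_apply]
  simp

theorem homPart_add_homPart (a : A) : homPart k 0 a + homPart k 1 a = a := by
  rw [homPart_apply, homPart_apply, ← smul_add]
  simp only [koszul_zero_left, koszul_one_one, one_smul, neg_smul]
  rw [show a + parity k A a + (a + -parity k A a) = (2 : k) • a by rw [two_smul]; abel,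
    smul_smul, inv_mul_cancel₀ two_ne_zero, one_smul]

theorem IsHom.homPart_self {i : ZMod 2} {a : A} (h : IsHom k i a) : homPart k i a = a := by
  rw [homPart_apply, h, smul_smul, koszul_mul_self, one_smul, ← two_smul k, smul_smul,
    inv_mul_cancel₀ two_ne_zero, one_smul]

theorem IsHom.homPart_of_ne {i j : ZMod 2} {a : A} (h : IsHom k i a) (hij : i ≠ j) :
    homPart k j a = 0 := by
  have hs := homPart_add_homPart (k := k) a
  have h' := h.homPart_self
  rcases zmod_two_cases i with rfl | rfl <;> rcases zmod_two_cases j with rfl | rfl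
  · exact absurd rfl hij
  · rwa [h', add_eq_left] at hs
  · rwa [h', add_eq_right] at hs
  · exact absurd rfl hij

theorem parity_eq_sub (a : A) : parity k A a = homPart k 0 a - homPart k 1 a := by
  conv_lhs => rw [← homPart_add_homPart (k := k) a, map_add, parity_homPart, parity_homPart]
  simp [sub_eq_add_neg]

theorem IsHom.mul {i j : ZMod 2} {a b : A} (ha : IsHom k i a) (hb : IsHom k j b) :
    IsHom k (i + j) (a * b) := by
  unfold IsHom at *
  rw [map_mul, ha, hb, koszul_add_left, smul_mul_smul_comm]

theorem IsHom.sum {ι : Type*} {s : Finset ι} {i : ZMod 2} {a : ι → A}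
    (h : ∀ t ∈ s, IsHom k i (a t)) : IsHom k i (∑ t ∈ s, a t) := by
  unfold IsHom at *
  rw [map_sum, Finset.smul_sum]
  exact Finset.sum_congr rfl h

theorem isHom_one : IsHom k 0 (1 : A) := isHom_zero_iff.2 (map_one _)

theorem IsHom.pow {a : A} (h : IsHom k 0 a) (l : ℕ) : IsHom k 0 (a ^ l) :=
  isHom_zero_iff.2 (by rw [map_pow, isHom_zero_iff.1 h])

theorem homPart_zero_mul (a b : A) :
    homPart k 0 (a * b) = homPart k 0 a * homPart k 0 b + homPart k 1 a * homPart k 1 b := by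
  conv_lhs => rw [← homPart_add_homPart (k := k) a, ← homPart_add_homPart (k := k) b]
  have h (i j : ZMod 2) := (isHom_homPart i a).mul (isHom_homPart (k := k) j b)
  simp only [add_mul, mul_add, map_add]
  rw [IsHom.homPart_self (i := 0) (h 0 0), IsHom.homPart_of_ne (h 0 1) (by decide),
    IsHom.homPart_of_ne (h 1 0) (by decide), IsHom.homPart_self (i := 0) (h 1 1)]
  simp

theorem homPart_one_mul (a b : A) :
    homPart k 1 (a * b) = homPart k 0 a * homPart k 1 b + homPart k 1 a * homPart k 0 b := by
  conv_lhs => rw [← homPart_add_homPart (k := k) a, ← homPart_add_homPart (k := k) b]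
  have h (i j : ZMod 2) := (isHom_homPart i a).mul (isHom_homPart (k := k) j b)
  simp only [add_mul, mul_add, map_add]
  rw [IsHom.homPart_of_ne (h 0 0) (by decide), IsHom.homPart_self (i := 1) (h 0 1),
    IsHom.homPart_self (i := 1) (h 1 0), IsHom.homPart_of_ne (h 1 1) (by decide)]
  simp [add_comm]

theorem SuperHom.isHom (f : SuperHom k A B) {i : ZMod 2} {a : A} (h : IsHom k i a) :
    IsHom k i (f.toAlgHom a) := by
  unfold IsHom at *
  rw [← map_zsmul, ← h]
  exact (f.map_parity a).symm

theorem SuperHom.parity_apply (f : SuperHom k A B) (a : A) :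
    parity k B (f.toAlgHom a) = f.toAlgHom (parity k A a) := (f.map_parity a).symm

theorem SuperHom.homPart_apply (f : SuperHom k A B) (i : ZMod 2) (a : A) :
    homPart k i (f.toAlgHom a) = f.toAlgHom (homPart k i a) := by
  simp only [DGeom.homPart_apply, map_smul, map_add, map_zsmul, f.parity_apply]

theorem IsSuperComm.even_comm (hA : IsSuperComm k A) {a : A} (ha : IsHom k 0 a) (b : A) :
    a * b = b * a := by
  rw [← homPart_add_homPart (k := k) b, mul_add, add_mul,
    hA 0 0 _ _ ha (isHom_homPart 0 b), hA 0 1 _ _ ha (isHom_homPart 1 b)]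
  simp

theorem IsSuperComm.odd_mul (hA : IsSuperComm k A) {a : A} (ha : IsHom k 1 a) (b : A) :
    a * b = parity k A b * a := by
  rw [parity_eq_sub]
  conv_lhs => rw [← homPart_add_homPart (k := k) b, mul_add,
    hA 1 0 _ _ ha (isHom_homPart 0 b), hA 1 1 _ _ ha (isHom_homPart 1 b)]
  simp [add_mul, sub_eq_add_neg]

theorem IsSuperComm.mul_eq (hA : IsSuperComm k A) (a b : A) :
    a * b = homPart k 0 b * a + homPart k 1 b * parity k A a := by
  conv_lhs => rw [← homPart_add_homPart (k := k) b, mul_add]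
  rw [hA.even_comm (isHom_homPart 0 b), hA.odd_mul (isHom_homPart 1 b), parity_parity]

end Components

/-! ## Super modules and square-zero extensions -/

/-- A left action of the superalgebra `A` on `N`, with a compatible parity involution of `N`. -/
structure SuperAction (k A N : Type u) [Field k] [Ring A] [Algebra k A] [Super k A]
    [AddCommGroup N] where
  act : A →+* AddMonoid.End N
  par : N →+ N
  par_par : ∀ n, par (par n) = n
  par_act : ∀ a n, par (act a n) = act (parity k A a) (par n)

namespace SuperAction

variable {k A B N : Type u} [Field k] [CharZero k] [Ring A] [Algebra k A] [Super k A]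
  [Ring B] [Algebra k B] [Super k B] [AddCommGroup N]

/-- Restriction of scalars. -/
def comp (M : SuperAction k A N) (f : SuperHom k B A) : SuperAction k B N where
  act := M.act.comp f.toAlgHom.toRingHom
  par := M.par
  par_par := M.par_par
  par_act b n := (M.par_act _ n).trans
    (congrArg (fun a => M.act a (M.par n)) (f.parity_apply b))

variable (M : SuperAction k A N)

theorem act_mul (a b : A) (n : N) : M.act (a * b) n = M.act a (M.act b n) := by
  rw [map_mul]; rfl

theorem act_one (n : N) : M.act 1 n = n := by rw [map_one]; rfl

theorem act_add (a b : A) (n : N) : M.act (a + b) n = M.act a n + M.act b n := by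
  rw [map_add]; rfl

theorem act_zero (n : N) : M.act 0 n = 0 := by rw [map_zero]; rfl

theorem act_nadd (a : A) (m n : N) : M.act a (m + n) = M.act a m + M.act a n := map_add _ _ _

/-- The right action `n · b = (-1)^(|n| |b|) b n`. -/
def right (n : N) (b : A) : N := M.act (homPart k 0 b) n + M.act (homPart k 1 b) (M.par n)

theorem right_add (n : N) (a b : A) : M.right n (a + b) = M.right n a + M.right n b := by
  simp only [right, map_add (homPart k 0), map_add (homPart k 1), act_add]; abel

theorem add_right (n n' : N) (b : A) : M.right (n + n') b = M.right n b + M.right n' b := by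
  simp only [right, map_add]; abel

theorem zero_right (b : A) : M.right 0 b = 0 := by simp [right]

theorem right_zero (n : N) : M.right n 0 = 0 := by simp [right, act_zero]

theorem right_one (n : N) : M.right n 1 = n := by
  rw [right, (isHom_one (k := k) (A := A)).homPart_self, isHom_one.homPart_of_ne (by decide),
    act_one, act_zero, add_zero]

/-- Two odd factors b, c act through the parity of n twice, and the parity of b n contributes the
sign; supercommutativity of `A` puts b and c back in the order of the product. -/
theorem right_right (hA : IsSuperComm k A) (n : N) (b c : A) :
    M.right (M.right n b) c = M.right n (b * c) := by
  have h (i j : ZMod 2) := hA i j _ _ (isHom_homPart i b) (isHom_homPart j c)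
  simp only [right, M.par.map_add, act_nadd, homPart_zero_mul, homPart_one_mul, act_add, par_act,
    par_par, parity_homPart, h, koszul_zero_left, koszul_zero_right,
    koszul_one_one, ← act_mul, neg_smul, one_smul, smul_neg, mul_neg, mul_smul_comm]
  abel

theorem right_act (hA : IsSuperComm k A) (n : N) (a b : A) :
    M.right (M.act a n) b = M.act a (M.right n b) := by
  simp only [right, map_add, par_act, ← act_mul]
  rw [hA.even_comm (isHom_homPart 0 b), hA.odd_mul (isHom_homPart 1 b), parity_parity]

theorem par_right (n : N) (b : A) : M.par (M.right n b) = M.right (M.par n) (parity k A b) := by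
  simp only [right, map_add, par_act, parity_homPart, homPart_parity]

theorem right_of_isHom {i j : ZMod 2} {n : N} {b : A} (hn : M.par n = koszul i 1 • n)
    (hb : IsHom k j b) : M.right n b = koszul i j • M.act b n := by
  rcases zmod_two_cases j with rfl | rfl
  · simp [right, hb.homPart_self, hb.homPart_of_ne (show (0 : ZMod 2) ≠ 1 by decide), act_zero]
  · simp [right, hb.homPart_self, hb.homPart_of_ne (show (1 : ZMod 2) ≠ 0 by decide), act_zero, hn]

end SuperAction

/-- The square-zero extension `A ⊕ N` of a commutative superalgebra. -/
@[ext] structure SqZeroExt {k A N : Type u} [Field k] [Ring A] [Algebra k A] [Super k A]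
    [AddCommGroup N] (M : SuperAction k A N) (hA : IsSuperComm k A) where
  fst : A
  snd : N

namespace SqZeroExt

variable {k A N : Type u} [Field k] [CharZero k] [Ring A] [Algebra k A] [Super k A]
  [AddCommGroup N] (M : SuperAction k A N) (hA : IsSuperComm k A)

instance : Zero (SqZeroExt M hA) := ⟨⟨0, 0⟩⟩
instance : One (SqZeroExt M hA) := ⟨⟨1, 0⟩⟩
instance : Add (SqZeroExt M hA) := ⟨fun x y => ⟨x.fst + y.fst, x.snd + y.snd⟩⟩
instance : Neg (SqZeroExt M hA) := ⟨fun x => ⟨-x.fst, -x.snd⟩⟩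
instance : Mul (SqZeroExt M hA) :=
  ⟨fun x y => ⟨x.fst * y.fst, M.act x.fst y.snd + M.right x.snd y.fst⟩⟩

@[simp] theorem fst_zero : (0 : SqZeroExt M hA).fst = 0 := rfl
@[simp] theorem snd_zero : (0 : SqZeroExt M hA).snd = 0 := rfl
@[simp] theorem fst_one : (1 : SqZeroExt M hA).fst = 1 := rfl
@[simp] theorem snd_one : (1 : SqZeroExt M hA).snd = 0 := rfl

variable {M hA}

@[simp] theorem fst_add (x y : SqZeroExt M hA) : (x + y).fst = x.fst + y.fst := rfl
@[simp] theorem snd_add (x y : SqZeroExt M hA) : (x + y).snd = x.snd + y.snd := rfl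
@[simp] theorem fst_mul (x y : SqZeroExt M hA) : (x * y).fst = x.fst * y.fst := rfl
@[simp] theorem snd_mul (x y : SqZeroExt M hA) :
    (x * y).snd = M.act x.fst y.snd + M.right x.snd y.fst := rfl

instance : Ring (SqZeroExt M hA) where
  add_assoc x y z := SqZeroExt.ext (add_assoc _ _ _) (add_assoc _ _ _)
  zero_add x := SqZeroExt.ext (zero_add _) (zero_add _)
  add_zero x := SqZeroExt.ext (add_zero _) (add_zero _)
  add_comm x y := SqZeroExt.ext (add_comm _ _) (add_comm _ _)
  left_distrib x y z := SqZeroExt.ext (mul_add _ _ _) (by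
    simp only [snd_mul, snd_add, fst_add, map_add, M.right_add]; abel)
  right_distrib x y z := SqZeroExt.ext (add_mul _ _ _) (by
    simp only [snd_mul, snd_add, fst_add, M.act_add, M.add_right]; abel)
  zero_mul x := SqZeroExt.ext (zero_mul _) (by simp [M.act_zero, M.zero_right])
  mul_zero x := SqZeroExt.ext (mul_zero _) (by simp [M.right_zero])
  mul_assoc x y z := SqZeroExt.ext (mul_assoc _ _ _) (by
    simp only [snd_mul, fst_mul, M.act_mul, M.add_right, M.right_right hA, M.right_act hA, map_add]
    abel)
  one_mul x := SqZeroExt.ext (one_mul _) (by simp [M.act_one, M.zero_right])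
  mul_one x := SqZeroExt.ext (mul_one _) (by simp [M.right_one])
  neg_add_cancel x := SqZeroExt.ext (neg_add_cancel _) (neg_add_cancel _)
  nsmul := nsmulRec
  zsmul := zsmulRec

variable (M hA) in
/-- The inclusion `A → A ⊕ N`. -/
def inl : A →+* SqZeroExt M hA where
  toFun a := ⟨a, 0⟩
  map_one' := rfl
  map_zero' := rfl
  map_mul' a b := SqZeroExt.ext rfl (by simp [M.zero_right])
  map_add' a b := SqZeroExt.ext rfl (add_zero 0).symm

@[simp] theorem fst_inl (a : A) : (inl M hA a).fst = a := rfl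
@[simp] theorem snd_inl (a : A) : (inl M hA a).snd = 0 := rfl

theorem isHom_algebraMap (c : k) : IsHom k 0 (algebraMap k A c) :=
  isHom_zero_iff.2 ((parity k A).commutes c)

instance : Algebra k (SqZeroExt M hA) :=
  RingHom.toAlgebra' ((inl M hA).comp (algebraMap k A)) fun c x => by
    have h := isHom_algebraMap (A := A) c
    refine SqZeroExt.ext (Algebra.commutes c x.fst) ?_
    simp only [RingHom.coe_comp, Function.comp_apply, snd_mul, fst_inl, snd_inl, M.zero_right,
      map_zero, add_zero, zero_add]
    simp [SuperAction.right, h.homPart_self, h.homPart_of_ne (show (0 : ZMod 2) ≠ 1 by decide),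
      M.act_zero]

variable (M hA) in
/-- The projection `A ⊕ N → A`. -/
def fstHom : SqZeroExt M hA →+* A where
  toFun := SqZeroExt.fst
  map_one' := rfl
  map_zero' := rfl
  map_mul' _ _ := rfl
  map_add' _ _ := rfl

variable (M hA) in
/-- The projection `A ⊕ N → N`. -/
def sndHom : SqZeroExt M hA →+ N where
  toFun := SqZeroExt.snd
  map_zero' := rfl
  map_add' _ _ := rfl

theorem fst_zsmul (c : ℤ) (x : SqZeroExt M hA) : (c • x).fst = c • x.fst :=
  map_zsmul (fstHom M hA) c x

theorem snd_zsmul (c : ℤ) (x : SqZeroExt M hA) : (c • x).snd = c • x.snd :=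
  map_zsmul (sndHom M hA) c x

instance : Super k (SqZeroExt M hA) where
  aut :=
    { toFun := fun x => ⟨parity k A x.fst, M.par x.snd⟩
      map_one' := SqZeroExt.ext (map_one _) (map_zero _)
      map_zero' := SqZeroExt.ext (map_zero _) (map_zero _)
      map_mul' := fun x y => SqZeroExt.ext (map_mul _ _ _) (by
        simp only [snd_mul, map_add, M.par_act, M.par_right])
      map_add' := fun x y => SqZeroExt.ext (map_add _ _ _) (map_add _ _ _)
      commutes' := fun c => SqZeroExt.ext ((parity k A).commutes c) (map_zero _) }
  aut_aut x := SqZeroExt.ext (parity_parity k x.fst) (M.par_par x.snd)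

theorem fst_parity (x : SqZeroExt M hA) : (parity k _ x).fst = parity k A x.fst := rfl

theorem snd_parity (x : SqZeroExt M hA) : (parity k _ x).snd = M.par x.snd := rfl

theorem isSuperComm : IsSuperComm k (SqZeroExt M hA) := by
  intro i j x y hx hy
  have hx1 : IsHom k i x.fst := by
    have := congrArg SqZeroExt.fst hx; rwa [fst_zsmul] at this
  have hy1 : IsHom k j y.fst := by
    have := congrArg SqZeroExt.fst hy; rwa [fst_zsmul] at this
  have hx2 : M.par x.snd = koszul i 1 • x.snd := by
    have := congrArg SqZeroExt.snd hx; rwa [snd_zsmul] at this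
  have hy2 : M.par y.snd = koszul j 1 • y.snd := by
    have := congrArg SqZeroExt.snd hy; rwa [snd_zsmul] at this
  refine SqZeroExt.ext ?_ ?_
  · rw [fst_zsmul]; exact hA i j _ _ hx1 hy1
  · rw [snd_zsmul, snd_mul, snd_mul, M.right_of_isHom hx2 hy1, M.right_of_isHom hy2 hx1, smul_add,
      smul_smul, show koszul j i = koszul i j by simp [koszul, and_comm], koszul_mul_self,
      one_smul, add_comm]

end SqZeroExt

/-! ## Derivations -/

section Leibniz

variable {k A N : Type u} [Field k] [CharZero k] [Ring A] [Algebra k A] [Super k A]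
  [AddCommGroup N]

variable (k) in
/-- `d` satisfies the super Leibniz rule `d(ab) = a db + (-1)^(|a| |b|) b da`. -/
def IsLeibniz (act : A →+* AddMonoid.End N) (d : A →+ N) : Prop :=
  ∀ (i j : ZMod 2) (a b : A), IsHom k i a → IsHom k j b →
    d (a * b) = act a (d b) + koszul i j • act b (d a)

variable {act : A →+* AddMonoid.End N} {d : A →+ N}

/-- Splitting only the right factor and applying parity to the left one absorbs the Koszul sign.
This form makes sense for inhomogeneous elements and matches the product of a square-zero extension.
-/
theorem IsLeibniz.apply_mul (h : IsLeibniz k act d) (a b : A) :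
    d (a * b) = act a (d b) + (act (homPart k 0 b) (d a) + act (homPart k 1 b) (d (parity k A a))) := by
  have e (i j : ZMod 2) := h i j _ _ (isHom_homPart i a) (isHom_homPart j b)
  have hact (x y : A) (n : N) : act (x + y) n = act x n + act y n := by rw [map_add]; rfl
  have hnadd (x : A) (n m : N) : act x (n + m) = act x n + act x m := map_add _ _ _
  have hneg (x : A) (n : N) : act x (-n) = -act x n := map_neg _ _
  obtain ⟨a0, a1, ha0, ha1⟩ : ∃ a0 a1, homPart k 0 a = a0 ∧ homPart k 1 a = a1 := ⟨_, _, rfl, rfl⟩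
  obtain ⟨b0, b1, hb0, hb1⟩ : ∃ b0 b1, homPart k 0 b = b0 ∧ homPart k 1 b = b1 := ⟨_, _, rfl, rfl⟩
  have ea := homPart_add_homPart (k := k) a
  have eb := homPart_add_homPart (k := k) b
  have e00 := e 0 0
  have e01 := e 0 1
  have e10 := e 1 0
  have e11 := e 1 1
  rw [parity_eq_sub]
  simp only [ha0, ha1, hb0, hb1, koszul_zero_left, koszul_zero_right, koszul_one_one, one_smul,
    neg_smul] at *
  subst ea eb
  simp only [mul_add, add_mul, map_add d, map_sub d, map_neg d, e00, e01, e10, e11, hact, hnadd, hneg,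
    sub_eq_add_neg, map_neg d]
  abel

theorem isLeibniz_of_apply_mul (h : ∀ a b, d (a * b) = act a (d b) +
    (act (homPart k 0 b) (d a) + act (homPart k 1 b) (d (parity k A a)))) : IsLeibniz k act d := by
  intro i j a b ha hb
  have h0 (n : N) : act 0 n = 0 := by rw [map_zero]; rfl
  rw [h]
  congr 1
  rcases zmod_two_cases j with rfl | rfl
  · rw [hb.homPart_self, hb.homPart_of_ne (by decide), h0]; simp
  · rw [hb.homPart_self, hb.homPart_of_ne (by decide), h0, ha, map_zsmul, map_zsmul, zero_add]

theorem IsLeibniz.map_one (h : IsLeibniz k act d) : d 1 = 0 := by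
  have := h 0 0 1 1 isHom_one isHom_one
  simpa using this

end Leibniz

namespace SqZeroExt

variable {k A N S : Type u} [Field k] [CharZero k] [Ring A] [Algebra k A] [Super k A]
  [Ring S] [Algebra k S] [Super k S] [AddCommGroup N] (M : SuperAction k A N)
  (hA : IsSuperComm k A)

/-- A parity preserving derivation defines a morphism to the square-zero extension. -/
def ofDerivation (f : SuperHom k S A) (d : S →+ N) (hd : IsLeibniz k (M.comp f).act d)
    (hk : ∀ c : k, d (algebraMap k S c) = 0) (hp : ∀ s, M.par (d s) = d (parity k S s)) :
    SuperHom k S (SqZeroExt M hA) where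
  toFun s := ⟨f.toAlgHom s, d s⟩
  map_one' := SqZeroExt.ext (map_one _) hd.map_one
  map_zero' := SqZeroExt.ext (map_zero _) (map_zero d)
  map_mul' s t := SqZeroExt.ext (map_mul _ _ _) (by
    rw [hd.apply_mul, snd_mul]
    simp only [SuperAction.right, f.homPart_apply, hp]
    rfl)
  map_add' s t := SqZeroExt.ext (map_add _ _ _) (map_add _ _ _)
  commutes' c := SqZeroExt.ext (f.toAlgHom.commutes c) (hk c)
  map_parity s := SqZeroExt.ext (f.parity_apply s).symm (hp s).symm

variable {M hA}

/-- The first projection, as a morphism of superalgebras. -/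
def fstSuperHom : SuperHom k (SqZeroExt M hA) A where
  toFun := SqZeroExt.fst
  map_one' := rfl
  map_zero' := rfl
  map_mul' _ _ := rfl
  map_add' _ _ := rfl
  commutes' _ := rfl
  map_parity _ := rfl

/-- The second component of a morphism to a square-zero extension. -/
def sndOf (l : SuperHom k S (SqZeroExt M hA)) : S →+ N :=
  (sndHom M hA).comp l.toAlgHom.toRingHom.toAddMonoidHom

theorem sndOf_apply (l : SuperHom k S (SqZeroExt M hA)) (s : S) :
    sndOf l s = (l.toAlgHom s).snd := rfl

theorem par_sndOf (l : SuperHom k S (SqZeroExt M hA)) (s : S) :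
    M.par (sndOf l s) = sndOf l (parity k S s) := by
  rw [sndOf_apply, ← snd_parity, l.parity_apply]
  rfl

/-- This is the converse of `ofDerivation`: comparing second components in the product of the
extension gives the Leibniz rule, since parity on `N` corresponds to parity on `S`. -/
theorem isLeibniz_sndOf (l : SuperHom k S (SqZeroExt M hA)) (f : SuperHom k S A)
    (hf : ∀ s, (l.toAlgHom s).fst = f.toAlgHom s) : IsLeibniz k (M.comp f).act (sndOf l) := by
  refine isLeibniz_of_apply_mul fun a b => ?_
  rw [← par_sndOf]
  simp only [sndOf_apply, map_mul, snd_mul, hf, SuperAction.right, f.homPart_apply]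
  rfl

end SqZeroExt

/-! ## The universal property of differential forms -/

section FinsuppLift

variable {S C N α : Type u} [Ring S] [Ring C] [AddCommGroup N] [Module C N]

/-- The semilinear map on a free module with given values on the basis. -/
def finsuppLift (ψ : S →+* C) (δ : α → N) : (α →₀ S) →ₛₗ[ψ] N where
  toFun := Finsupp.liftAddHom fun s => ((smulAddHom C N).flip (δ s)).comp ψ.toAddMonoidHom
  map_add' := map_add _
  map_smul' c x := by
    induction x using Finsupp.induction_linear with
    | zero => simp
    | add x y hx hy => simp only [smul_add, map_add, hx, hy]
    | single s a =>
      rw [Finsupp.smul_single, smul_eq_mul, Finsupp.liftAddHom_apply_single,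
        Finsupp.liftAddHom_apply_single]
      simp [mul_smul]

theorem finsuppLift_single (ψ : S →+* C) (δ : α → N) (s : α) (c : S) :
    finsuppLift ψ δ (Finsupp.single s c) = ψ c • δ s := by
  simp [finsuppLift]

end FinsuppLift

namespace RelForms

variable {k R S : Type u} [Field k] [CharZero k] [Ring R] [Algebra k R] [Super k R]
variable [Ring S] [Algebra k S] [Super k S] (φ : SuperHom k R S)

theorem d_add (s t : S) : d φ (s + t) = d φ s + d φ t := by
  have h := (Submodule.Quotient.mk_eq_zero _).2
    (Submodule.subset_span (R := S) (RelFormRel.add (φ := φ) s t))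
  rw [Submodule.Quotient.mk_sub, Submodule.Quotient.mk_sub, sub_sub, sub_eq_zero] at h
  exact h

theorem d_base (f : R) : d φ (φ.toAlgHom f) = 0 :=
  (Submodule.Quotient.mk_eq_zero _).2 (Submodule.subset_span (RelFormRel.base (φ := φ) f))

theorem mk_single (s c : S) :
    (Submodule.Quotient.mk (Finsupp.single s c) : RelForms φ) = c • d φ s := by
  rw [d, ← Submodule.Quotient.mk_smul, Finsupp.smul_single, smul_eq_mul, mul_one]

/-- The universal derivation as an additive map. -/
def dHom : S →+ RelForms φ := AddMonoidHom.mk' (d φ) (d_add φ)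

theorem isLeibniz_d : IsLeibniz k (Module.toAddMonoidEnd S (RelForms φ)) (dHom φ) := by
  intro i j s t hs ht
  have h := (Submodule.Quotient.mk_eq_zero _).2
    (Submodule.subset_span (R := S) (RelFormRel.leibniz (φ := φ) i j s t hs ht))
  rw [Submodule.Quotient.mk_sub, Submodule.Quotient.mk_sub, sub_sub, sub_eq_zero,
    Submodule.Quotient.mk_smul, mk_single, mk_single, mk_single, one_smul] at h
  exact h

theorem span_d : Submodule.span S (Set.range (d φ)) = ⊤ := by
  rw [eq_top_iff]
  rintro ω -
  obtain ⟨x, rfl⟩ := Submodule.Quotient.mk_surjective _ ω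
  induction x using Finsupp.induction_linear with
  | zero => exact zero_mem _
  | add x y hx hy => exact add_mem hx hy
  | single s c =>
    rw [mk_single]
    exact Submodule.smul_mem _ _ (Submodule.subset_span ⟨s, rfl⟩)

variable {φ} in
theorem induction_on {p : RelForms φ → Prop} (zero : p 0) (add : ∀ x y, p x → p y → p (x + y))
    (smul : ∀ c s : S, p (c • d φ s)) (ω : RelForms φ) : p ω := by
  obtain ⟨x, rfl⟩ := Submodule.Quotient.mk_surjective _ ω
  induction x using Finsupp.induction_linear with
  | zero => exact zero
  | add x y hx hy => exact add _ _ hx hy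
  | single s c =>
    rw [mk_single]
    exact smul c s

variable {C N : Type u} [Ring C] [AddCommGroup N] [Module C N]

/-- The semilinear map defined by an `R`-linear derivation. -/
def lift (ψ : S →+* C) (δ : S →+ N) (hb : ∀ f, δ (φ.toAlgHom f) = 0)
    (hδ : IsLeibniz k ((Module.toAddMonoidEnd C N).comp ψ) δ) : RelForms φ →ₛₗ[ψ] N :=
  Submodule.liftQ _ (finsuppLift ψ δ) (by
    rw [Submodule.span_le]
    rintro _ (⟨s, t⟩ | ⟨f⟩ | ⟨i, j, s, t, hs, ht⟩)
    · show finsuppLift ψ δ _ = 0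
      simp only [map_sub, finsuppLift_single, map_one, one_smul, map_add, add_sub_cancel_left,
        sub_self]
    · show finsuppLift ψ δ _ = 0
      rw [finsuppLift_single, hb, smul_zero]
    · show finsuppLift ψ δ _ = 0
      simp only [map_sub, map_zsmul, finsuppLift_single, map_one, one_smul]
      rw [hδ i j s t hs ht, sub_sub]
      exact sub_self _)

theorem lift_d (ψ : S →+* C) (δ : S →+ N) (hb : ∀ f, δ (φ.toAlgHom f) = 0)
    (hδ : IsLeibniz k ((Module.toAddMonoidEnd C N).comp ψ) δ) (s : S) :
    lift φ ψ δ hb hδ (d φ s) = δ s := by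
  refine (finsuppLift_single ψ δ s 1).trans ?_
  rw [map_one, one_smul]

/-- The parity of differential forms. -/
def par : RelForms φ →ₛₗ[(parity k S).toRingHom] RelForms φ :=
  lift φ _ ((dHom φ).comp (parity k S).toRingHom.toAddMonoidHom)
    (fun f => by
      have h := φ.parity_apply f
      show d φ (parity k S (φ.toAlgHom f)) = 0
      rw [h, d_base])
    (fun i j s t hs ht => by
      have h := isLeibniz_d φ i j _ _ (show IsHom k i (parity k S s) by
        unfold IsHom at *; rw [hs, map_zsmul, ← hs])
        (show IsHom k j (parity k S t) by unfold IsHom at *; rw [ht, map_zsmul, ← ht])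
      rw [← map_mul] at h
      exact h)

theorem par_d (s : S) : par φ (d φ s) = d φ (parity k S s) := lift_d φ _ _ _ _ s

/-- Differential forms as a super module. -/
def superAction : SuperAction k S (RelForms φ) where
  act := Module.toAddMonoidEnd S _
  par := (par φ).toAddMonoidHom
  par_act a ω := (par φ).map_smulₛₗ a ω
  par_par ω := by
    induction ω using induction_on with
    | zero => simp
    | add x y hx hy => simp only [map_add, hx, hy]
    | smul c s =>
      show par φ (par φ (c • d φ s)) = c • d φ s
      rw [map_smulₛₗ, map_smulₛₗ, par_d, par_d, parity_parity]
      exact congrArg (fun a : S => a • d φ s) (parity_parity k c)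

end RelForms

/-- Free modules on homogeneous generators as super modules. -/
def SuperAction.free {k S ι : Type u} [Field k] [Ring S] [Algebra k S] [Super k S]
    (p : ι → ZMod 2) : SuperAction k S (ι → S) where
  act := Module.toAddMonoidEnd S _
  par :=
    { toFun := fun f t => koszul (p t) 1 • parity k S (f t)
      map_zero' := by ext t; simp
      map_add' := fun f g => by ext t; simp }
  par_par f := by
    ext t
    show koszul (p t) 1 • parity k S (koszul (p t) 1 • parity k S (f t)) = f t
    rw [map_zsmul, parity_parity, smul_smul, koszul_mul_self, one_smul]
  par_act a f := by
    ext t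
    show koszul (p t) 1 • parity k S (a * f t) = parity k S a * koszul (p t) 1 • parity k S (f t)
    rw [map_mul, mul_smul_comm]

namespace Forms

variable (k R A : Type u) [Field k] [CharZero k] [Ring R] [Algebra k R] [Super k R]
variable [Ring A] [Algebra k A] [Super k A] [DAlgebra k R A]

variable {A}

theorem d_add (a b : A) : d k R (a + b) = d k R a + d k R b := by
  have h := (Submodule.Quotient.mk_eq_zero _).2
    (Submodule.subset_span (R := AD k R A) (FormRel.add (k := k) (R := R) a b))
  rw [Submodule.Quotient.mk_sub, Submodule.Quotient.mk_sub, sub_sub, sub_eq_zero] at h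
  exact h

theorem mk_single (a : A) (c : AD k R A) :
    (Submodule.Quotient.mk (Finsupp.single a c) : Forms k R A) = c • d k R a := by
  rw [d, ← Submodule.Quotient.mk_smul, Finsupp.smul_single, smul_eq_mul, mul_one]

theorem d_act (P : diffOps k R) (a : A) :
    d k R (DAlgebra.act P a) = AD.ofOp k R A P • d k R a := by
  have h := (Submodule.Quotient.mk_eq_zero _).2
    (Submodule.subset_span (R := AD k R A) (FormRel.act P a))
  rw [Submodule.Quotient.mk_sub, sub_eq_zero, mk_single, mk_single, one_smul] at h
  exact h

variable (A) in
/-- The universal derivation as an additive map. -/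
def dHom : A →+ Forms k R A := AddMonoidHom.mk' (d k R) (d_add k R)

theorem isLeibniz_d : IsLeibniz k ((Module.toAddMonoidEnd (AD k R A) (Forms k R A)).comp
    (AD.ofFun k R A).toRingHom) (dHom k R A) := by
  intro i j s t hs ht
  have h := (Submodule.Quotient.mk_eq_zero _).2
    (Submodule.subset_span (R := AD k R A) (FormRel.leibniz (k := k) (R := R) i j s t hs ht))
  rw [Submodule.Quotient.mk_sub, Submodule.Quotient.mk_sub, sub_sub, sub_eq_zero,
    Submodule.Quotient.mk_smul, mk_single, mk_single, mk_single, one_smul] at h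
  exact h

variable {k R} in
theorem induction_on {p : Forms k R A → Prop} (zero : p 0) (add : ∀ x y, p x → p y → p (x + y))
    (smul : ∀ (c : AD k R A) (a : A), p (c • d k R a)) (ω : Forms k R A) : p ω := by
  obtain ⟨x, rfl⟩ := Submodule.Quotient.mk_surjective _ ω
  induction x using Finsupp.induction_linear with
  | zero => exact zero
  | add x y hx hy => exact add _ _ hx hy
  | single s c =>
    rw [mk_single]
    exact smul c s

theorem hom_ext {N : Type u} [AddCommGroup N] [Module (AD k R A) N]
    {f g : Forms k R A →ₗ[AD k R A] N} (h : ∀ a, f (d k R a) = g (d k R a)) : f = g := by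
  refine LinearMap.ext fun ω => ?_
  induction ω using induction_on with
  | zero => simp
  | add x y hx hy => simp only [map_add, hx, hy]
  | smul c a => rw [map_smul, map_smul, h]

variable {N : Type u} [AddCommGroup N] [Module (AD k R A) N]

/-- The linear map defined by a `𝒟`-linear derivation. -/
def lift (δ : A →+ N) (hP : ∀ P a, δ (DAlgebra.act P a) = AD.ofOp k R A P • δ a)
    (hδ : IsLeibniz k ((Module.toAddMonoidEnd (AD k R A) N).comp (AD.ofFun k R A).toRingHom) δ) :
    Forms k R A →ₗ[AD k R A] N :=
  Submodule.liftQ _ (finsuppLift (RingHom.id _) δ) (by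
    rw [Submodule.span_le]
    rintro _ (⟨s, t⟩ | ⟨P, a⟩ | ⟨i, j, s, t, hs, ht⟩)
    · show finsuppLift _ δ _ = 0
      simp only [map_sub, finsuppLift_single, map_one, one_smul, map_add, add_sub_cancel_left,
        sub_self]
    · show finsuppLift _ δ _ = 0
      rw [map_sub, finsuppLift_single, finsuppLift_single, hP, map_one, one_smul]
      exact sub_self _
    · show finsuppLift _ δ _ = 0
      simp only [map_sub, map_zsmul, finsuppLift_single, map_one, one_smul]
      rw [hδ i j s t hs ht, sub_sub]
      exact sub_self _)

theorem lift_d (δ : A →+ N) (hP : ∀ P a, δ (DAlgebra.act P a) = AD.ofOp k R A P • δ a)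
    (hδ : IsLeibniz k ((Module.toAddMonoidEnd (AD k R A) N).comp (AD.ofFun k R A).toRingHom) δ)
    (a : A) : lift k R δ hP hδ (d k R a) = δ a := by
  refine (finsuppLift_single (RingHom.id _) δ a 1).trans ?_
  rw [map_one, one_smul]

end Forms

/-! ## Dual bases of differential forms of smooth morphisms -/

section DualBasis

variable {k R S : Type u} [Field k] [CharZero k] [Ring R] [Algebra k R] [Super k R]
variable [Ring S] [Algebra k S] [Super k S] (φ : SuperHom k R S)

theorem RelForms.isLeibniz_d_apply (a b : S) : RelForms.d φ (a * b) = a • RelForms.d φ b +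
    (homPart k 0 b • RelForms.d φ a + homPart k 1 b • RelForms.d φ (parity k S a)) :=
  (RelForms.isLeibniz_d φ).apply_mul a b

theorem RelForms.d_algebraMap (c : k) : RelForms.d φ (algebraMap k S c) = 0 := by
  rw [← φ.toAlgHom.commutes]
  exact RelForms.d_base φ _

/-- The forms `d x` for homogeneous components `x` of a system of generators span. -/
theorem RelForms.span_d_homPart (T : Set S)
    (hT : Algebra.adjoin k (Set.range φ.toAlgHom ∪ T) = ⊤) :
    Submodule.span S (Set.range fun i : T × ZMod 2 => RelForms.d φ (homPart k i.2 (i.1 : S))) =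
      ⊤ := by
  rw [eq_top_iff, ← RelForms.span_d φ, Submodule.span_le]
  rintro _ ⟨s, rfl⟩
  set P := Submodule.span S (Set.range fun i : T × ZMod 2 => RelForms.d φ (homPart k i.2 (i.1 : S)))
    with hP
  -- The Leibniz rule for a product involves d of the parity conjugate of the left factor, so the
  -- induction must carry both memberships.
  suffices h : RelForms.d φ s ∈ P ∧ RelForms.d φ (parity k S s) ∈ P from h.1
  have hs : s ∈ Algebra.adjoin k (Set.range φ.toAlgHom ∪ T) := hT ▸ Algebra.mem_top
  induction hs using Algebra.adjoin_induction with
  | mem s hs =>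
    rcases hs with ⟨f, rfl⟩ | hs
    · have := φ.parity_apply f
      rw [this, RelForms.d_base, RelForms.d_base]
      exact ⟨zero_mem _, zero_mem _⟩
    · have h (i : ZMod 2) : RelForms.d φ (homPart k i s) ∈ P :=
        Submodule.subset_span ⟨(⟨s, hs⟩, i), rfl⟩
      constructor
      · rw [← homPart_add_homPart (k := k) s, RelForms.d_add]
        exact add_mem (h 0) (h 1)
      · rw [parity_eq_sub]
        have := map_sub (RelForms.dHom φ) (homPart k 0 s) (homPart k 1 s)
        exact (congrArg (· ∈ P) this).mpr (sub_mem (h 0) (h 1))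
  | algebraMap c =>
    rw [(parity k S).commutes, RelForms.d_algebraMap]
    exact ⟨zero_mem _, zero_mem _⟩
  | add s t _ _ hs ht =>
    rw [map_add, RelForms.d_add, RelForms.d_add]
    exact ⟨add_mem hs.1 ht.1, add_mem hs.2 ht.2⟩
  | mul s t _ _ hs ht =>
    rw [map_mul, RelForms.isLeibniz_d_apply, RelForms.isLeibniz_d_apply, parity_parity]
    exact ⟨add_mem (P.smul_mem _ ht.1) (add_mem (P.smul_mem _ hs.1) (P.smul_mem _ hs.2)),
      add_mem (P.smul_mem _ ht.2) (add_mem (P.smul_mem _ hs.2) (P.smul_mem _ hs.1))⟩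

/-- A homogeneous dual basis of `Ω¹_{C/M}`, consisting of exact forms and vector fields. -/
structure DualBasis (ι : Type u) [Fintype ι] where
  par : ι → ZMod 2
  x : ι → S
  field : ι → RelFields φ
  isHom : ∀ t, IsHom k (par t) (x t)
  isHomog : ∀ t, (field t).IsHomog (par t)
  sum_smul : ∀ ω, ∑ t, field t ω • RelForms.d φ (x t) = ω

section Lifting

variable {φ} (hS : IsSuperComm k S) {ι : Type u} [Fintype ι] (p : ι → ZMod 2) (x : ι → S)

/-- The morphism `S ⊕ S^ι → S ⊕ Ω¹` defined by homogeneous elements `x`. -/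
def formsOfFree (hx : ∀ t, IsHom k (p t) (x t)) :
    SuperHom k (SqZeroExt (SuperAction.free (k := k) (S := S) p) hS)
      (SqZeroExt (RelForms.superAction φ) hS) :=
  SqZeroExt.ofDerivation _ hS SqZeroExt.fstSuperHom
    ((Fintype.linearCombination S fun t => RelForms.d φ (x t)).toAddMonoidHom.comp
      (SqZeroExt.sndHom _ hS))
    (by
      refine isLeibniz_of_apply_mul fun a b => ?_
      show Fintype.linearCombination S (fun t => RelForms.d φ (x t)) (a.fst • b.snd +
        (homPart k 0 b.fst • a.snd + homPart k 1 b.fst • (SuperAction.free p).par a.snd)) = _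
      rw [map_add, map_add, map_smul, map_smul, map_smul]
      have h (i : ZMod 2) : homPart k i b.fst = (homPart k i b).fst :=
        SuperHom.homPart_apply SqZeroExt.fstSuperHom i b
      rw [h, h]
      rfl)
    (fun c => map_zero (Fintype.linearCombination S fun t => RelForms.d φ (x t)))
    (fun s => by
      show (RelForms.par φ) (Fintype.linearCombination S (fun t => RelForms.d φ (x t)) s.snd) =
        Fintype.linearCombination S (fun t => RelForms.d φ (x t)) ((SuperAction.free p).par s.snd)
      rw [Fintype.linearCombination_apply, Fintype.linearCombination_apply, map_sum]
      refine Finset.sum_congr rfl fun t _ => ?_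
      rw [map_smulₛₗ, RelForms.par_d, hx t]
      show parity k S (s.snd t) • RelForms.dHom φ (koszul (p t) 1 • x t) =
        (koszul (p t) 1 • parity k S (s.snd t)) • RelForms.dHom φ (x t)
      rw [map_zsmul, smul_assoc, smul_comm])

end Lifting

variable {φ}

/-- The lifting property splits the surjection from a free module onto Ω¹_{C/M}: a lift of s ↦ s +
ds to S ⊕ S^ι has as second component a derivation, whose coordinates are the required vector
fields. Parity preservation of the lift makes these coordinates homogeneous. -/
theorem IsSmooth.exists_dualBasis (hS : IsSuperComm k S) (hφ : IsSmooth φ) :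
    ∃ (ι : Type u) (_ : Fintype ι), Nonempty (DualBasis φ ι) := by
  obtain ⟨T, hT⟩ := hφ.finiteType
  let ι : Type u := Prod (T : Set S) (ZMod 2)
  let p : ι → ZMod 2 := fun i => i.2
  let x : ι → S := fun i => homPart k i.2 (i.1 : S)
  have hx (t : ι) : IsHom k (p t) (x t) := isHom_homPart _ _
  let M := SuperAction.free (k := k) (S := S) p
  let π := formsOfFree (φ := φ) hS p x hx
  have hπ (a : SqZeroExt M hS) : (π.toAlgHom a).snd = ∑ t, a.snd t • RelForms.d φ (x t) := rfl
  have hπ' (a : SqZeroExt M hS) : (π.toAlgHom a).fst = a.fst := rfl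
  have hspan := RelForms.span_d_homPart φ (T : Set S) hT
  have hsurj : Function.Surjective π.toAlgHom := by
    rintro ⟨s, ω⟩
    have hω : ω ∈ LinearMap.range (Fintype.linearCombination S fun t : ι => RelForms.d φ (x t)) := by
      rw [Fintype.range_linearCombination]
      exact hspan ▸ Submodule.mem_top
    obtain ⟨f, hf⟩ := hω
    exact ⟨⟨s, f⟩, SqZeroExt.ext rfl hf⟩
  have hsq (a b : SqZeroExt M hS) (ha : π.toAlgHom a = 0) (hb : π.toAlgHom b = 0) : a * b = 0 := by
    have ha' : a.fst = 0 := by rw [← hπ', ha]; rfl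
    have hb' : b.fst = 0 := by rw [← hπ', hb]; rfl
    refine SqZeroExt.ext ?_ ?_
    · rw [SqZeroExt.fst_mul, ha', zero_mul, SqZeroExt.fst_zero]
    · rw [SqZeroExt.snd_mul, ha', hb', M.act_zero, M.right_zero, add_zero, SqZeroExt.snd_zero]
  -- The lift is prescribed on `R` with zero second component, which makes the resulting derivation
  -- `R`-linear.
  let r : SuperHom k R (SqZeroExt M hS) := SqZeroExt.ofDerivation M hS φ 0
    (isLeibniz_of_apply_mul fun a b => by simp) (fun _ => rfl) (fun _ => map_zero _)
  let h : SuperHom k S (SqZeroExt (RelForms.superAction φ) hS) :=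
    SqZeroExt.ofDerivation _ hS ⟨AlgHom.id k S, fun _ => rfl⟩ (RelForms.dHom φ)
      (RelForms.isLeibniz_d φ) (RelForms.d_algebraMap φ) (RelForms.par_d φ)
  obtain ⟨l, hl, hl'⟩ := hφ.lifting _ _ SqZeroExt.isSuperComm SqZeroExt.isSuperComm π hsurj hsq r h
    (fun f => SqZeroExt.ext rfl (by
      rw [hπ]
      refine (RelForms.d_base φ f).trans ?_
      exact (Finset.sum_eq_zero fun t _ => zero_smul S _).symm))
  have hl1 (s : S) : (l.toAlgHom s).fst = s := by
    rw [← hπ', hl']; rfl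
  -- The second component of the lifting equation is the dual basis identity on exact forms.
  have hl2 (s : S) : ∑ t, SqZeroExt.sndOf l s t • RelForms.d φ (x t) = RelForms.d φ s :=
    (hπ (l.toAlgHom s)).symm.trans (congrArg SqZeroExt.snd (hl' s))
  have hleib : IsLeibniz k M.act (SqZeroExt.sndOf l) :=
    SqZeroExt.isLeibniz_sndOf l ⟨AlgHom.id k S, fun _ => rfl⟩ hl1
  have hbase (f : R) : SqZeroExt.sndOf l (φ.toAlgHom f) = 0 := by
    rw [SqZeroExt.sndOf_apply, hl]; rfl
  let θ (t : ι) : RelFields φ := RelForms.lift φ (RingHom.id S)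
    ((Pi.evalAddMonoidHom (fun _ : ι => S) t).comp (SqZeroExt.sndOf l))
    (fun f => congrFun (hbase f) t)
    (fun i j a b ha hb => congrFun (hleib i j a b ha hb) t)
  have hθ (t : ι) (s : S) : θ t (RelForms.d φ s) = SqZeroExt.sndOf l s t :=
    RelForms.lift_d φ _ _ _ _ s
  refine ⟨ι, inferInstance, ⟨⟨p, x, θ, hx, fun t s => ?_, fun ω => ?_⟩⟩⟩
  · have := congrFun (SqZeroExt.par_sndOf l s) t
    rw [hθ, hθ, ← this]
    show _ = koszul (p t) 1 • koszul (p t) 1 • parity k S _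
    rw [smul_smul, koszul_mul_self, one_smul]
  · induction ω using RelForms.induction_on with
    | zero => simp
    | add a b ha hb =>
      simp only [map_add, add_smul, Finset.sum_add_distrib, ha, hb]
    | smul c s =>
      simp only [map_smul, smul_assoc, ← Finset.smul_sum, hθ, hl2]

end DualBasis

/-! ## The universal property of the jet algebra -/

namespace Jet

variable {k R S E : Type u} [Field k] [CharZero k] [Ring R] [Algebra k R] [Super k R]
variable [Ring S] [Algebra k S] [Super k S] [Ring E] [Algebra k E] [Super k E] [DAlgebra k R E]

/-- The value of an expression in a commutative `𝒟`-algebra. -/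
def Pre.eval (g : SuperHom k S E) : Pre k R S → E
  | .of s => g.toAlgHom s
  | .scalar c => algebraMap k E c
  | .add a b => a.eval g + b.eval g
  | .mul a b => a.eval g * b.eval g
  | .act P a => DAlgebra.act P (a.eval g)
  | .par a => parity k E (a.eval g)

variable {φ : SuperHom k R S}

theorem scalar_intCast_mul (n : ℤ) (x : E) : algebraMap k E (n : k) * x = n • x := by
  rw [map_intCast, zsmul_eq_mul]

/-- Each clause of the congruence is an identity in every commutative 𝒟-algebra receiving `S`
compatibly with 𝒪, so evaluation descends to the quotient. -/
theorem Rel.eval_eq (g : SuperHom k S E)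
    (hg : ∀ f, g.toAlgHom (φ.toAlgHom f) = DAlgebra.act (mulOp k f) 1) {a b : Pre k R S}
    (h : Rel φ a b) : a.eval g = b.eval g := by
  induction h with
  | refl a => rfl
  | symm _ ih => exact ih.symm
  | trans _ _ ih ih' => exact ih.trans ih'
  | add_congr _ _ ih ih' => exact congrArg₂ (· + ·) ih ih'
  | mul_congr _ _ ih ih' => exact congrArg₂ (· * ·) ih ih'
  | act_congr P _ ih => exact congrArg (DAlgebra.act P) ih
  | par_congr _ ih => exact congrArg (parity k E) ih
  | add_assoc => exact _root_.add_assoc _ _ _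
  | add_comm => exact _root_.add_comm _ _
  | zero_add a => simp [Pre.eval]
  | neg_add a => simp [Pre.eval]
  | mul_assoc => exact _root_.mul_assoc _ _ _
  | one_mul a => simp [Pre.eval]
  | mul_one a => simp [Pre.eval]
  | mul_add => exact _root_.mul_add _ _ _
  | add_mul => exact _root_.add_mul _ _ _
  | scalar_add c d => exact map_add _ _ _
  | scalar_mul c d => exact map_mul _ _ _
  | scalar_comm c a => exact Algebra.commutes _ _
  | par_par a => exact parity_parity k _
  | par_add a b => exact map_add _ _ _
  | par_mul a b => exact map_mul _ _ _
  | par_scalar c => exact (parity k E).commutes c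
  -- The premises are themselves relations; their induction hypotheses say that the two values are
  -- homogeneous.
  | comm i j _ _ ha hb =>
    simp only [Pre.eval, scalar_intCast_mul] at *
    exact DAlgebra.comm (R := R) i j _ _ ha hb
  | act_add P a b => exact map_add _ _ _
  | add_act P Q a => simp [Pre.eval]
  | mul_act P Q a => simp [Pre.eval]
  | scalar_act c a =>
    simp only [Pre.eval, AlgHom.commutes]
    exact Algebra.smul_def c _
  | par_act P a => exact DAlgebra.parity_act P _
  | mulOp_act f a b => exact DAlgebra.act_mulOp f _ _
  | derOp_act h a b =>
    refine (DAlgebra.act_derOp h _ _).trans ?_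
    unfold twist
    split_ifs <;> rfl
  | of_add s t => exact map_add _ _ _
  | of_mul s t => exact map_mul _ _ _
  | of_scalar c => exact g.toAlgHom.commutes c
  | of_par s => exact (g.parity_apply s).symm
  | of_map f => simpa [Pre.eval] using hg f

/-- The morphism from the jet algebra to a commutative `𝒟`-algebra defined by a morphism of
`𝒪`-algebras. -/
def lift (g : SuperHom k S E)
    (hg : ∀ f, g.toAlgHom (φ.toAlgHom f) = DAlgebra.act (mulOp k f) 1) : SuperHom k (Jet φ) E where
  toFun := Quotient.lift (Pre.eval g) fun _ _ h => Rel.eval_eq g hg h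
  map_one' := map_one (algebraMap k E)
  map_zero' := map_zero (algebraMap k E)
  map_mul' := ind fun _ => ind fun _ => rfl
  map_add' := ind fun _ => ind fun _ => rfl
  commutes' _ := rfl
  map_parity := ind fun _ => rfl

theorem lift_act (g : SuperHom k S E)
    (hg : ∀ f, g.toAlgHom (φ.toAlgHom f) = DAlgebra.act (mulOp k f) 1) (P : diffOps k R) :
    ∀ x, (lift g hg).toAlgHom (DAlgebra.act P x) = DAlgebra.act P ((lift g hg).toAlgHom x) :=
  ind fun _ => rfl

theorem act_mulOp_one (f : R) :
    DAlgebra.act (mulOp k f) (1 : Jet φ) = (of φ).toAlgHom (φ.toAlgHom f) :=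
  (sound (.of_map f)).symm

/-- Induction on expressions. -/
theorem induction_on {p : Jet φ → Prop} (hof : ∀ s, p ((of φ).toAlgHom s))
    (hscalar : ∀ c : k, p (algebraMap k _ c)) (hadd : ∀ a b, p a → p b → p (a + b))
    (hmul : ∀ a b, p a → p b → p (a * b)) (hact : ∀ (P : diffOps k R) (a : Jet φ), p a → p (DAlgebra.act P a))
    (hpar : ∀ a, p a → p (parity k _ a)) : ∀ x, p x := by
  refine ind fun a => ?_
  induction a with
  | of s => exact hof s
  | scalar c => exact hscalar c
  | add a b ha hb => exact hadd _ _ ha hb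
  | mul a b ha hb => exact hmul _ _ ha hb
  | act P a ha => exact hact P _ ha
  | par a ha => exact hpar _ ha

end Jet

/-! ## Square-zero extensions of `𝒟`-algebras -/

/-- The left regular module, with its parity shifted by `i`. -/
def SuperAction.regular {k B : Type u} [Field k] [Ring B] [Algebra k B] [Super k B] (i : ZMod 2) :
    SuperAction k B B where
  act := Module.toAddMonoidEnd B B
  par := koszul i 1 • (parity k B).toRingHom.toAddMonoidHom
  par_par b := by
    show koszul i 1 • parity k B (koszul i 1 • parity k B b) = b
    rw [map_zsmul, parity_parity, smul_smul, koszul_mul_self, one_smul]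
  par_act a b := by
    show koszul i 1 • parity k B (a * b) = parity k B a * koszul i 1 • parity k B b
    rw [map_mul, mul_smul_comm]

section SqZeroD

variable {k R A N : Type u} [Field k] [CharZero k] [Ring R] [Algebra k R] [Super k R]
variable [Ring A] [Algebra k A] [Super k A] [DAlgebra k R A] [AddCommGroup N]

variable (k R A) in
/-- The inclusion of functions, as a morphism of superalgebras. -/
def AD.ofFunHom : SuperHom k A (AD k R A) where
  toAlgHom := AD.ofFun k R A
  map_parity a := (AD.parityHom_ofFun k R A a).symm

theorem AD.parity_ofFun (a : A) : parity k (AD k R A) (AD.ofFun k R A a) =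
    AD.ofFun k R A (parity k A a) := AD.parityHom_ofFun k R A a

theorem AD.parity_ofOp (P : diffOps k R) : parity k (AD k R A) (AD.ofOp k R A P) =
    AD.ofOp k R A (parity k _ P) := AD.parityHom_ofOp k R A P

theorem DAlgebra.act_mulOp_eq (f : R) (a : A) :
    DAlgebra.act (mulOp k f) a = DAlgebra.act (A := A) (mulOp k f) 1 * a := by
  rw [← DAlgebra.act_mulOp, one_mul]

theorem DAlgebra.homPart_act {i j : ZMod 2} {δ : Module.End k R} (h : IsSuperDer k i δ) (a : A) :
    homPart k j (DAlgebra.act (derOp h) a) = DAlgebra.act (derOp h) (homPart k (j + i) a) := by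
  have hp : parity k (diffOps k R) (derOp h) = _ := isHom_derOp k R h
  rw [homPart_apply, homPart_apply, DAlgebra.parity_act, hp, koszul_add_left]
  simp only [map_zsmul, map_smul, map_add, LinearMap.smul_apply, mul_smul]

variable (M : SuperAction k (AD k R A) N) (hA : IsSuperComm k A)

theorem SqZeroExt.snd_smul (M : SuperAction k A N) (c : k) (x : SqZeroExt M hA) :
    (c • x).snd = M.act (algebraMap k A c) x.snd := by
  rw [Algebra.smul_def, SqZeroExt.snd_mul]
  exact (congrArg _ (M.zero_right _)).trans (add_zero _)

theorem SqZeroExt.fst_smul (M : SuperAction k A N) (c : k) (x : SqZeroExt M hA) :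
    (c • x).fst = c • x.fst := by
  rw [Algebra.smul_def, SqZeroExt.fst_mul, Algebra.smul_def]
  rfl

/-- The action of a differential operator on a square-zero extension. -/
def SqZeroExt.actEnd (P : diffOps k R) :
    Module.End k (SqZeroExt (M.comp (AD.ofFunHom k R A)) hA) where
  toFun x := ⟨DAlgebra.act P x.fst, M.act (AD.ofOp k R A P) x.snd⟩
  map_add' x y := SqZeroExt.ext (map_add _ _ _) (map_add _ _ _)
  map_smul' c x := SqZeroExt.ext (by
      simp only [SqZeroExt.fst_smul, map_smul, RingHom.id_apply]) (by
      simp only [SqZeroExt.snd_smul, RingHom.id_apply]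
      show M.act _ (M.act (AD.ofFun k R A _) _) = M.act (AD.ofFun k R A _) (M.act _ _)
      rw [← M.act_mul, ← M.act_mul, AlgHom.commutes, Algebra.commutes])

theorem SuperAction.right_comp (n : N) (a : A) : (M.comp (AD.ofFunHom k R A)).right n a =
    M.act (AD.ofFun k R A (homPart k 0 a)) n + M.act (AD.ofFun k R A (homPart k 1 a)) (M.par n) :=
  rfl

theorem SuperAction.act_comp (n : N) (a : A) :
    (M.comp (AD.ofFunHom k R A)).act a n = M.act (AD.ofFun k R A a) n := rfl

theorem SuperAction.act_derOp {i : ZMod 2} {δ : Module.End k R} (h : IsSuperDer k i δ)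
    (n : N) (a : A) : M.act (AD.ofOp k R A (derOp h)) (M.act (AD.ofFun k R A a) n) =
      M.act (AD.ofFun k R A (DAlgebra.act (derOp h) a)) n +
        M.act (AD.ofFun k R A (twist k i a)) (M.act (AD.ofOp k R A (derOp h)) n) := by
  rw [← M.act_mul, AD.ofOp_derOp_mul, M.act_add, M.act_mul]

/-- An odd vector field acquires a sign when it passes n, recorded by applying `M.par` to n. This is
the Leibniz rule for the half of the product of the square-zero extension in which n stands on the
left. -/
theorem SuperAction.act_derOp_right {i : ZMod 2} {δ : Module.End k R} (h : IsSuperDer k i δ)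
    (n : N) (a : A) :
    M.act (AD.ofOp k R A (derOp h)) ((M.comp (AD.ofFunHom k R A)).right n a) =
      (M.comp (AD.ofFunHom k R A)).right (M.act (AD.ofOp k R A (derOp h)) n) a +
        (M.comp (AD.ofFunHom k R A)).right (if i = 1 then M.par n else n)
          (DAlgebra.act (derOp h) a) := by
  have hp : parity k (AD k R A) (AD.ofOp k R A (derOp h)) = koszul i 1 • AD.ofOp k R A (derOp h) := by
    rw [AD.parity_ofOp, ← map_zsmul, ← isHom_derOp k R h]
  rw [M.right_comp, M.right_comp, M.right_comp, M.act_nadd, M.act_derOp, M.act_derOp, M.par_act, hp,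
    DAlgebra.homPart_act, DAlgebra.homPart_act]
  rcases zmod_two_cases i with rfl | rfl
  · simp only [twist, koszul_zero_left, one_smul, add_zero, zero_ne_one, if_false]
    abel
  · simp only [twist, if_true, koszul_one_one, parity_homPart, koszul_zero_left, one_smul, zero_add,
      neg_smul, M.par_par, show (1 : ZMod 2) + 1 = 0 from rfl]
    have hneg (x : AD k R A) (n : N) : M.act (-x) n = -M.act x n := by rw [map_neg]; rfl
    have hneg' (x : AD k R A) (n : N) : M.act x (-n) = -M.act x n := map_neg _ _
    simp only [map_neg (AD.ofFun k R A), hneg, hneg']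
    abel

/-- Because `N` is a module over `A[𝒟]` and not merely over `A`, differential operators act on both
summands; the commutation relation between vector fields and functions in `A[𝒟]` supplies the
Leibniz rule in the summand `N`. -/
instance SqZeroExt.dAlgebra : DAlgebra k R (SqZeroExt (M.comp (AD.ofFunHom k R A)) hA) where
  comm := SqZeroExt.isSuperComm
  act :=
    { toFun := SqZeroExt.actEnd M hA
      map_one' := LinearMap.ext fun x => SqZeroExt.ext
        (congrArg (fun f : Module.End k A => f x.fst) (map_one DAlgebra.act))
        (by show M.act _ _ = _; rw [map_one, M.act_one]; rfl)
      map_zero' := LinearMap.ext fun x => SqZeroExt.ext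
        (congrArg (fun f : Module.End k A => f x.fst) (map_zero DAlgebra.act))
        (by show M.act _ _ = _; rw [map_zero, M.act_zero]; rfl)
      map_mul' := fun P Q => LinearMap.ext fun x => SqZeroExt.ext
        (congrArg (fun f : Module.End k A => f x.fst) (map_mul DAlgebra.act P Q))
        (by show M.act _ _ = _; rw [map_mul, M.act_mul]; rfl)
      map_add' := fun P Q => LinearMap.ext fun x => SqZeroExt.ext
        (congrArg (fun f : Module.End k A => f x.fst) (map_add DAlgebra.act P Q))
        (by show M.act _ _ = _; rw [map_add, M.act_add]; rfl)
      commutes' := fun c => LinearMap.ext fun x => SqZeroExt.ext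
        (by
          refine (congrArg (fun f : Module.End k A => f x.fst)
            (DAlgebra.act.commutes c)).trans ?_
          exact (SqZeroExt.fst_smul hA _ c x).symm)
        (by
          refine Eq.trans ?_ (SqZeroExt.snd_smul hA _ c x).symm
          show M.act _ _ = M.act (AD.ofFun k R A _) _
          rw [AlgHom.commutes, AlgHom.commutes]) }
  parity_act P x := SqZeroExt.ext (DAlgebra.parity_act P x.fst) (by
    show M.par (M.act _ _) = M.act _ (M.par _)
    rw [M.par_act, AD.parity_ofOp])
  act_mulOp f x y := SqZeroExt.ext (DAlgebra.act_mulOp f x.fst y.fst) (by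
    show M.act _ ((M.comp _).act _ _ + (M.comp _).right _ _) =
      (M.comp _).act (DAlgebra.act (mulOp k f) x.fst) _ + (M.comp _).right (M.act _ _) _
    rw [M.act_nadd, AD.ofOp_mulOp, ← M.act_comp, ← M.act_comp, ← SuperAction.right_act _ hA,
      ← SuperAction.act_mul, ← DAlgebra.act_mulOp_eq]
    rfl)
  act_derOp {i δ} h x y := SqZeroExt.ext ((DAlgebra.act_derOp h x.fst y.fst).trans (by
      unfold twist; split_ifs <;> rfl)) (by
    show M.act _ ((M.comp _).act _ _ + (M.comp _).right _ _) =
      ((M.comp _).act (DAlgebra.act (derOp h) x.fst) _ + (M.comp _).right (M.act _ _) _) +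
        ((M.comp _).act (twist k i x).fst (M.act _ _) + (M.comp _).right (twist k i x).snd _)
    have h1 : (twist k i x).fst = twist k i x.fst := by unfold twist; split_ifs <;> rfl
    have h2 : (twist k i x).snd = if i = 1 then M.par x.snd else x.snd := by
      unfold twist; split_ifs <;> rfl
    rw [M.act_nadd, M.act_derOp_right, h1, h2, M.act_comp, M.act_derOp, M.act_comp, M.act_comp]
    abel)

end SqZeroD

/-! ## Local vector fields on the jet space -/

namespace LocalFields

variable {k R A : Type u} [Field k] [CharZero k] [Ring R] [Algebra k R] [Super k R]
variable [Ring A] [Algebra k A] [Super k A] [DAlgebra k R A]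

theorem d_mul (a b : A) : Forms.d k R (a * b) = AD.ofFun k R A a • Forms.d k R b +
    (AD.ofFun k R A (homPart k 0 b) • Forms.d k R a +
      AD.ofFun k R A (homPart k 1 b) • Forms.d k R (parity k A a)) :=
  (Forms.isLeibniz_d k R).apply_mul a b

theorem d_algebraMap (c : k) : Forms.d k R (algebraMap k A c) = 0 := by
  have h : algebraMap k A c = DAlgebra.act (algebraMap k (diffOps k R) c) 1 := by
    rw [AlgHom.commutes, Algebra.algebraMap_eq_smul_one]; rfl
  have h1 : Forms.d k R (1 : A) = 0 := (Forms.isLeibniz_d k R).map_one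
  rw [h, Forms.d_act, h1, smul_zero]

/-- The parity of local vector fields. -/
def conj (θ : LocalFields k R A) : LocalFields k R A :=
  Forms.lift k R
    ((parity k (AD k R A)).toRingHom.toAddMonoidHom.comp (θ.toAddMonoidHom.comp
      ((Forms.dHom k R A).comp (parity k A).toRingHom.toAddMonoidHom)))
    (fun P a => by
      show parity k _ (θ (Forms.d k R (parity k A _))) = _ * parity k _ (θ (Forms.d k R _))
      rw [DAlgebra.parity_act, Forms.d_act, map_smul, smul_eq_mul, map_mul, AD.parity_ofOp,
        parity_parity]
      rfl)
    (isLeibniz_of_apply_mul fun a b => by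
      show parity k _ (θ (Forms.d k R (parity k A _))) =
        _ * parity k _ (θ (Forms.d k R (parity k A b))) +
          (_ * parity k _ (θ (Forms.d k R (parity k A a))) +
            _ * parity k _ (θ (Forms.d k R (parity k A (parity k A a)))))
      rw [map_mul, d_mul]
      simp only [map_add, map_smul, smul_eq_mul, map_mul, AD.parity_ofFun, parity_homPart,
        homPart_parity, parity_parity, map_zsmul, smul_smul, koszul_mul_self, one_smul]
      rfl)

theorem conj_d (θ : LocalFields k R A) (a : A) :
    conj θ (Forms.d k R a) = parity k _ (θ (Forms.d k R (parity k A a))) :=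
  Forms.lift_d k R _ _ _ a

theorem isHomog_iff {i : ZMod 2} {θ : LocalFields k R A} :
    θ.IsHomog i ↔ conj θ = koszul i 1 • θ := by
  constructor
  · intro h
    refine Forms.hom_ext k R fun a => ?_
    rw [conj_d, h, parity_parity]
    rfl
  · intro h a
    have := LinearMap.congr_fun h (Forms.d k R (parity k A a))
    rwa [conj_d, parity_parity] at this

theorem conj_add (θ θ' : LocalFields k R A) : conj (θ + θ') = conj θ + conj θ' :=
  Forms.hom_ext k R fun a => by simp [conj_d]

theorem conj_smul (c : AD k R A) (θ : LocalFields k R A) :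
    conj (op c • θ) = op (parity k _ c) • conj θ :=
  Forms.hom_ext k R fun a => by simp [conj_d]

end LocalFields

section Extension

variable {k R S : Type u} [Field k] [CharZero k] [Ring R] [Algebra k R] [Super k R]
variable [Ring S] [Algebra k S] [Super k S] (φ : SuperHom k R S)

/-- The morphism `𝒪_C → ℬ[𝒟]`. -/
def toJetD : S →+* JetD φ := (AD.ofFun k R (Jet φ)).toRingHom.comp (Jet.of φ).toAlgHom.toRingHom

theorem toJetD_apply (s : S) : toJetD φ s = AD.ofFun k R (Jet φ) ((Jet.of φ).toAlgHom s) := rfl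

theorem parity_toJetD (s : S) : parity k _ (toJetD φ s) = toJetD φ (parity k S s) := by
  rw [toJetD_apply, AD.parity_ofFun, SuperHom.parity_apply]
  rfl

variable {φ}

/-- The jet algebra is generated from the image of `S` by ring operations, differential operators
and parity, and d is a 𝒟-linear derivation; hence the forms d(p^*s) determine an `A[𝒟]`-linear map.
-/
theorem LocalFields.ext_restrict {θ θ' : LocalFields k R (Jet φ)}
    (h : LocalFields.restrict φ θ = LocalFields.restrict φ θ') : θ = θ' := by
  refine Forms.hom_ext k R fun a => ?_
  -- As before, the Leibniz rule brings in the parity conjugate, so agreement is proved for both.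
  suffices H : θ (Forms.d k R a) = θ' (Forms.d k R a) ∧
      θ (Forms.d k R (parity k _ a)) = θ' (Forms.d k R (parity k _ a)) from H.1
  induction a using Jet.induction_on with
  | hof s =>
    refine ⟨congrFun h s, ?_⟩
    rw [(Jet.of φ).parity_apply]
    exact congrFun h _
  | hscalar c => rw [(parity k (Jet φ)).commutes, LocalFields.d_algebraMap]; simp
  | hadd a b ha hb => simp only [map_add, Forms.d_add, ha, hb, and_self]
  | hmul a b ha hb =>
    simp only [map_mul, LocalFields.d_mul, map_add, map_smul, ha, hb, parity_parity, and_self]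
  | hact P a ha => simp only [DAlgebra.parity_act, Forms.d_act, map_smul, ha, and_self]
  | hpar a ha => exact ⟨ha.2, by rw [parity_parity]; exact ha.1⟩

/-- With the parity of ℬ[𝒟] shifted by `i`, the pair (p^*, δ) becomes a parity preserving morphism
from `S` to the square-zero extension of ℬ. The universal property of the jet algebra extends it to
ℬ, and the second component of the extension is a 𝒟-linear derivation. -/
theorem exists_localField_of_parity (i : ZMod 2) (δ : S →+ JetD φ)
    (hb : ∀ f, δ (φ.toAlgHom f) = 0)
    (hδ : IsLeibniz k ((Module.toAddMonoidEnd (JetD φ) (JetD φ)).comp (toJetD φ)) δ)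
    (hp : ∀ s, koszul i 1 • parity k _ (δ s) = δ (parity k S s)) :
    ∃ θ : LocalFields k R (Jet φ), LocalFields.restrict φ θ = δ := by
  let M : SuperAction k (JetD φ) (JetD φ) := SuperAction.regular i
  let M' := M.comp (AD.ofFunHom k R (Jet φ))
  have hA : IsSuperComm k (Jet φ) := DAlgebra.comm (R := R)
  let g : SuperHom k S (SqZeroExt M' hA) := SqZeroExt.ofDerivation M' hA (Jet.of φ) δ hδ
    (fun c => by rw [← φ.toAlgHom.commutes]; exact hb _) hp
  have hg (f : R) : g.toAlgHom (φ.toAlgHom f) = DAlgebra.act (mulOp k f) 1 :=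
    SqZeroExt.ext (Jet.act_mulOp_one f).symm ((hb f).trans (map_zero _).symm)
  let l : SuperHom k (Jet φ) (SqZeroExt M' hA) := Jet.lift g hg
  -- Without this the second component would be a derivation along some endomorphism of ℬ. The first
  -- component respects all operations and fixes the image of `S`, hence is the identity.
  have hl1 (x : Jet φ) : (l.toAlgHom x).fst = x := by
    induction x using Jet.induction_on with
    | hof s => rfl
    | hscalar c => rw [AlgHom.commutes]; rfl
    | hadd a b ha hb => rw [map_add, SqZeroExt.fst_add, ha, hb]
    | hmul a b ha hb => rw [map_mul, SqZeroExt.fst_mul, ha, hb]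
    | hact P a ha =>
      refine (congrArg SqZeroExt.fst (Jet.lift_act g hg P a)).trans ?_
      exact congrArg (DAlgebra.act P) ha
    | hpar a ha => rw [← l.parity_apply, SqZeroExt.fst_parity, ha]
  refine ⟨Forms.lift k R (SqZeroExt.sndOf l) (fun P a => ?_) ?_, funext fun s => ?_⟩
  · exact congrArg SqZeroExt.snd (Jet.lift_act g hg P a)
  · exact SqZeroExt.isLeibniz_sndOf l ⟨AlgHom.id k _, fun _ => rfl⟩ hl1
  · exact Forms.lift_d k R _ _ _ _

/-- Every derivation `𝒪_C → ℬ[𝒟]` over `𝒪_M` extends to a local vector field. -/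
theorem exists_localField (δ : S →+ JetD φ) (hb : ∀ f, δ (φ.toAlgHom f) = 0)
    (hδ : IsLeibniz k ((Module.toAddMonoidEnd (JetD φ) (JetD φ)).comp (toJetD φ)) δ) :
    ∃ θ : LocalFields k R (Jet φ), LocalFields.restrict φ θ = δ := by
  let par' : JetD φ →+ JetD φ := (parity k (JetD φ)).toRingHom.toAddMonoidHom
  let half : JetD φ →+ JetD φ := DistribSMul.toAddMonoidHom _ (2⁻¹ : k)
  -- These are the homogeneous components of δ: averages of δ and its parity conjugate, with a sign.
  -- They add up to δ.
  let δ' (i : ZMod 2) : S →+ JetD φ := half.comp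
    (δ + koszul i 1 • par'.comp (δ.comp (parity k S).toRingHom.toAddMonoidHom))
  have hδ' (i : ZMod 2) (s : S) :
      δ' i s = (2⁻¹ : k) • (δ s + koszul i 1 • parity k _ (δ (parity k S s))) := rfl
  have H (i : ZMod 2) : ∃ θ : LocalFields k R (Jet φ), LocalFields.restrict φ θ = δ' i := by
    refine exists_localField_of_parity i (δ' i) (fun f => ?_) ?_ fun s => ?_
    · rw [hδ', φ.parity_apply, hb, hb, map_zero, smul_zero, add_zero, smul_zero]
    · refine isLeibniz_of_apply_mul fun a b => ?_
      have h (a b : S) : δ (a * b) = toJetD φ a * δ b + (toJetD φ (homPart k 0 b) * δ a +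
        toJetD φ (homPart k 1 b) * δ (parity k S a)) := hδ.apply_mul a b
      show δ' i (a * b) = toJetD φ a * δ' i b + (toJetD φ (homPart k 0 b) * δ' i a +
        toJetD φ (homPart k 1 b) * δ' i (parity k S a))
      rw [hδ', hδ', hδ', hδ', map_mul (parity k S), h, h]
      simp only [map_add, map_mul, parity_toJetD, parity_parity, homPart_parity, map_zsmul,
        parity_homPart, smul_smul, koszul_mul_self, one_smul, smul_add, mul_add, mul_smul_comm]
      abel
    · rw [hδ', hδ', parity_parity, map_smul, map_add, map_zsmul, parity_parity, smul_comm,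
        smul_add (koszul i 1), smul_smul, koszul_mul_self, one_smul, add_comm]
  obtain ⟨θ₀, h₀⟩ := H 0
  obtain ⟨θ₁, h₁⟩ := H 1
  refine ⟨θ₀ + θ₁, funext fun s => ?_⟩
  show LocalFields.restrict φ θ₀ s + LocalFields.restrict φ θ₁ s = δ s
  rw [h₀, h₁, hδ', hδ', ← smul_add]
  simp only [koszul_zero_left, koszul_one_one, one_smul, neg_smul]
  rw [show ∀ x y : JetD φ, x + y + (x + -y) = (2 : k) • x by intro x y; rw [two_smul]; abel,
    smul_smul, inv_mul_cancel₀ two_ne_zero, one_smul]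

theorem LocalFields.isHomog_of_restrict {i : ZMod 2} {θ : LocalFields k R (Jet φ)}
    (h : ∀ s, parity k _ (LocalFields.restrict φ θ s) =
      koszul i 1 • LocalFields.restrict φ θ (parity k S s)) : θ.IsHomog i := by
  rw [LocalFields.isHomog_iff]
  refine LocalFields.ext_restrict (funext fun s => ?_)
  refine (LocalFields.conj_d θ _).trans ?_
  have := h (parity k S s)
  rw [parity_parity] at this
  rw [(Jet.of φ).parity_apply]
  exact this

end Extension

/-! ## Extension of scalars -/

namespace RightExt

open TensorProduct

variable {A C : Type u} [Ring A] [Ring C] (f : A →+* C)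
variable {X : Type u} [AddCommGroup X] [Module Aᵐᵒᵖ X]

theorem tmul_add (x : X) (c c' : C) : tmul f x (c + c') = tmul f x c + tmul f x c' := by
  unfold tmul; rw [TensorProduct.add_tmul, Submodule.Quotient.mk_add]

theorem add_tmul (x x' : X) (c : C) : tmul f (x + x') c = tmul f x c + tmul f x' c := by
  unfold tmul; rw [TensorProduct.tmul_add, Submodule.Quotient.mk_add]

theorem smul_tmul (x : X) (c c' : C) : op c' • tmul f x c = tmul f x (c * c') := by
  unfold tmul; rw [← Submodule.Quotient.mk_smul, TensorProduct.smul_tmul', op_smul_eq_mul]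

theorem tmul_smul (a : A) (x : X) (c : C) : tmul f (op a • x) c = tmul f x (f a * c) := by
  have h := (Submodule.Quotient.mk_eq_zero _).2 (Submodule.subset_span (R := Cᵐᵒᵖ)
    (show (f a * c) ⊗ₜ[ℤ] x - c ⊗ₜ[ℤ] (op a • x) ∈ {z : C ⊗[ℤ] X | ∃ (c : C) (a : A) (x : X),
      z = (f a * c) ⊗ₜ[ℤ] x - c ⊗ₜ[ℤ] (op a • x)} from ⟨c, a, x, rfl⟩))
  rw [Submodule.Quotient.mk_sub, sub_eq_zero] at h
  exact h.symm

theorem sum_tmul {ι : Type*} (s : Finset ι) (x : ι → X) (c : C) :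
    tmul f (∑ t ∈ s, x t) c = ∑ t ∈ s, tmul f (x t) c :=
  map_sum (AddMonoidHom.mk' (fun x => tmul f x c) fun x y => add_tmul f x y c) _ _

theorem tmul_zero (x : X) : tmul f x 0 = 0 :=
  map_zero (AddMonoidHom.mk' (fun c => tmul f x c) fun c c' => tmul_add f x c c')

variable {f} in
theorem induction_on {p : RightExt f X → Prop} (add : ∀ x y : RightExt f X, p x → p y → p (x + y))
    (tmul : ∀ (x : X) (c : C), p (tmul f x c)) (z : RightExt f X) : p z := by
  obtain ⟨z, rfl⟩ := Submodule.Quotient.mk_surjective _ z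
  induction z with
  | zero =>
    have h := tmul 0 0
    rwa [tmul_zero] at h
  | tmul c x => exact tmul x c
  | add x y hx hy => exact add _ _ hx hy

end RightExt

/-! ## The natural isomorphism -/

/-- The homogeneous functions of parity `i` between superalgebras. -/
def homogFun (k S B : Type u) [Field k] [Ring S] [Algebra k S] [Super k S] [Ring B] [Algebra k B]
    [Super k B] (i : ZMod 2) : AddSubgroup (S → B) where
  carrier := {x | ∀ s, parity k B (x s) = koszul i 1 • x (parity k S s)}
  add_mem' hx hy s := by simp only [Pi.add_apply, map_add, smul_add, hx s, hy s]
  zero_mem' s := by simp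
  neg_mem' hx s := by simp only [Pi.neg_apply, map_neg, smul_neg, hx s]

namespace DualBasis

variable {k R S : Type u} [Field k] [CharZero k] [Ring R] [Algebra k R] [Super k R]
variable [Ring S] [Algebra k S] [Super k S] {φ : SuperHom k R S} {ι : Type u} [Fintype ι]
  (β : DualBasis φ ι)

theorem field_eq_sum (θ : RelFields φ) :
    θ = ∑ t, op (θ (RelForms.d φ (β.x t))) • β.field t := by
  refine LinearMap.ext fun ω => ?_
  conv_lhs => rw [← β.sum_smul ω]
  simp

/-- The generators of `p^*Θ ⊗ ℬ[𝒟]`. -/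
def gen (t : ι) (P : JetD φ) : InducedFields φ := RightExt.tmul _ (RightExt.tmul _ (β.field t) 1) P

/-- An element is recovered from its values on the forms d(x t): expand the vector field factor in
the dual basis and move the coefficients through both tensor products. Injectivity of the pairing is
immediate from this. -/
theorem eq_sum_eval (z : InducedFields φ) :
    z = ∑ t, β.gen t (InducedFields.eval φ z (β.x t)) := by
  unfold gen
  induction z using RightExt.induction_on with
  | add x y hx hy =>
    conv_lhs => rw [hx, hy]
    simp only [map_add, Pi.add_apply, RightExt.tmul_add, Finset.sum_add_distrib]
  | tmul y P =>
    induction y using RightExt.induction_on with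
    | add x y hx hy =>
      conv_lhs => rw [RightExt.add_tmul, hx, hy]
      simp only [RightExt.add_tmul, map_add, Pi.add_apply, RightExt.tmul_add,
        Finset.sum_add_distrib]
    | tmul θ b =>
      conv_lhs => rw [β.field_eq_sum θ, RightExt.sum_tmul, RightExt.sum_tmul]
      refine Finset.sum_congr rfl fun t _ => ?_
      rw [InducedFields.eval_tmul, RightExt.tmul_smul, ← one_mul (_ * b), ← RightExt.smul_tmul,
        RightExt.tmul_smul]
      rfl

theorem eval_injective (β : DualBasis φ ι) : Function.Injective (InducedFields.eval φ) := by
  intro z z' h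
  rw [β.eq_sum_eval z, h, ← β.eq_sum_eval z']

theorem eval_gen (t : ι) (P : JetD φ) (s : S) :
    InducedFields.eval φ (β.gen t P) s = toJetD φ (β.field t (RelForms.d φ s)) * P := by
  rw [gen, InducedFields.eval_tmul, mul_one]
  rfl

theorem isLeibniz_eval (z : InducedFields φ) :
    IsLeibniz k ((Module.toAddMonoidEnd (JetD φ) (JetD φ)).comp (toJetD φ)) 
      (AddMonoidHom.mk' (InducedFields.eval φ z) fun s s' => by
        rw [β.eq_sum_eval z]
        simp only [map_sum, Finset.sum_apply, eval_gen, RelForms.d_add, map_add, add_mul,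
          Finset.sum_add_distrib]) := by
  intro i j a b ha hb
  show InducedFields.eval φ z (a * b) = toJetD φ a * InducedFields.eval φ z b +
    koszul i j • (toJetD φ b * InducedFields.eval φ z a)
  have h : RelForms.d φ (a * b) = a • RelForms.d φ b + koszul i j • (b • RelForms.d φ a) :=
    RelForms.isLeibniz_d φ i j a b ha hb
  rw [β.eq_sum_eval z]
  simp only [map_sum, Finset.sum_apply, eval_gen, h, map_add, map_smul, map_zsmul, smul_eq_mul,
    map_mul, add_mul, Finset.sum_add_distrib, Finset.mul_sum, Finset.smul_sum, mul_assoc,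
    smul_mul_assoc]

theorem eval_base (β : DualBasis φ ι) (z : InducedFields φ) (f : R) :
    InducedFields.eval φ z (φ.toAlgHom f) = 0 := by
  rw [β.eq_sum_eval z]
  simp [eval_gen, RelForms.d_base]

/-- The map `Θ_ℬ → p^*Θ ⊗ ℬ[𝒟]`. -/
def toInduced : LocalFields k R (Jet φ) →ₗ[(JetD φ)ᵐᵒᵖ] InducedFields φ where
  toFun θ := ∑ t, β.gen t (LocalFields.restrict φ θ (β.x t))
  map_add' θ θ' := by
    rw [← Finset.sum_add_distrib]
    exact Finset.sum_congr rfl fun t _ => RightExt.tmul_add _ _ _ _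
  map_smul' c θ := by
    rw [Finset.smul_sum]
    exact Finset.sum_congr rfl fun t _ => (RightExt.smul_tmul _ _ _ c.unop).symm

/-- The restriction of θ is a derivation killing 𝒪_M, so it factors through a semilinear map on
Ω¹_{C/M}; applying that map to ds = Σ θ_t(ds) d(x t) gives the formula defining `toInduced`. The
equation also shows that the map does not depend on the dual basis, since the pairing is injective.
-/
theorem eval_toInduced (θ : LocalFields k R (Jet φ)) :
    InducedFields.eval φ (β.toInduced θ) = LocalFields.restrict φ θ := by
  have hδ : IsLeibniz k ((Module.toAddMonoidEnd (JetD φ) (JetD φ)).comp (toJetD φ))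
      (θ.toAddMonoidHom.comp ((Forms.dHom k R (Jet φ)).comp
        (Jet.of φ).toAlgHom.toRingHom.toAddMonoidHom)) := by
    intro i j a b ha hb
    have := Forms.isLeibniz_d k R i j _ _ ((Jet.of φ).isHom ha) ((Jet.of φ).isHom hb)
    rw [← map_mul] at this
    refine (congrArg θ this).trans ?_
    rw [map_add, map_zsmul]
    exact congrArg₂ _ (map_smul θ _ _) (congrArg _ (map_smul θ _ _))
  let h := RelForms.lift φ (toJetD φ) _ (fun f => by
    show θ (Forms.d k R ((Jet.of φ).toAlgHom (φ.toAlgHom f))) = 0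
    have h1 : Forms.d k R (1 : Jet φ) = 0 := (Forms.isLeibniz_d k R).map_one
    rw [← Jet.act_mulOp_one, Forms.d_act, h1, smul_zero, map_zero]) hδ
  have hh (s : S) : h (RelForms.d φ s) = LocalFields.restrict φ θ s := RelForms.lift_d φ _ _ _ _ s
  funext s
  rw [← hh s]
  conv_rhs => rw [← β.sum_smul (RelForms.d φ s)]
  rw [map_sum]
  show InducedFields.eval φ (∑ t, β.gen t (LocalFields.restrict φ θ (β.x t))) s = _
  rw [map_sum, Finset.sum_apply]
  refine Finset.sum_congr rfl fun t _ => ?_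
  rw [eval_gen, map_smulₛₗ, hh, smul_eq_mul]

/-- The pairing turns `toInduced` into restriction. Restriction is injective, and every element of
the target pairs to a derivation over 𝒪_M, which extends to a local field. -/
theorem toInduced_bijective : Function.Bijective β.toInduced := by
  constructor
  · intro θ θ' h
    refine LocalFields.ext_restrict ?_
    rw [← β.eval_toInduced, h, β.eval_toInduced]
  · intro z
    obtain ⟨θ, hθ⟩ := exists_localField _ (β.eval_base z) (β.isLeibniz_eval z)
    refine ⟨θ, β.eval_injective ?_⟩
    rw [β.eval_toInduced, hθ]
    rfl

theorem parity_eval_of_mem_homog {i : ZMod 2} {z : InducedFields φ}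
    (hz : z ∈ InducedFields.homog φ i) : InducedFields.eval φ z ∈ homogFun k S (JetD φ) i := by
  have h : InducedFields.homog φ i ≤
      (homogFun k S (JetD φ) i).comap (InducedFields.eval φ).toAddMonoidHom := by
    refine (AddSubgroup.closure_le _).2 fun z hz =>
      (?_ : ∀ s, parity k _ (InducedFields.eval φ z s) =
        koszul i 1 • InducedFields.eval φ z (parity k S s))
    obtain ⟨i₁, i₂, i₃, θ, b, P, rfl, hθ, hb, hP, rfl⟩ := hz
    intro s
    rw [InducedFields.eval_tmul, InducedFields.eval_tmul, map_mul, AD.parity_ofFun, map_mul,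
      (Jet.of φ).parity_apply, hθ, hb, hP, koszul_add_left, koszul_add_left]
    simp only [map_zsmul, smul_mul_assoc, mul_smul_comm, smul_smul]
    rw [mul_comm (koszul i₂ 1), mul_comm (koszul i₃ 1)]
  exact h hz

theorem isHomog_iff_toInduced_mem (i : ZMod 2) (θ : LocalFields k R (Jet φ)) :
    θ.IsHomog i ↔ β.toInduced θ ∈ InducedFields.homog φ i := by
  constructor
  · intro h
    -- The coefficient of the t-th generator is the value of θ on d(x t), of parity `i + β.par t`;
    -- together with the parity of the t-th field this totals `i` modulo 2.
    refine sum_mem fun t _ => AddSubgroup.subset_closure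
      ⟨β.par t, 0, i + β.par t, β.field t, 1, _, ?_, β.isHomog t, isHom_one, ?_, rfl⟩
    · exact (by decide : ∀ i j : ZMod 2, j + 0 + (i + j) = i) _ _
    · unfold IsHom LocalFields.restrict
      rw [h, (Jet.of φ).parity_apply, β.isHom t, koszul_add_left, mul_smul]
      congr 1
      exact map_zsmul (θ.toAddMonoidHom.comp ((Forms.dHom k R (Jet φ)).comp
        (Jet.of φ).toAlgHom.toRingHom.toAddMonoidHom)) _ _
  · intro h
    refine LocalFields.isHomog_of_restrict fun s => ?_
    rw [← β.eval_toInduced]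
    exact parity_eval_of_mem_homog h s

/-- The natural isomorphism `Θ_ℬ ≃ p^*Θ ⊗ ℬ[𝒟]`. -/
def equiv : LocalFields k R (Jet φ) ≃ₗ[(JetD φ)ᵐᵒᵖ] InducedFields φ :=
  LinearEquiv.ofBijective β.toInduced β.toInduced_bijective

end DualBasis

/-! ## The even subalgebra -/

section Even

variable {k A : Type u} [Field k] [CharZero k] [Ring A] [Algebra k A] [Super k A]

/-- The commutative ring of even elements. -/
def Even (_ : IsSuperComm k A) : Type u := AlgHom.equalizer (parity k A) (AlgHom.id k A)

namespace Even

variable (hA : IsSuperComm k A)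

instance : Ring (Even hA) :=
  inferInstanceAs (Ring (AlgHom.equalizer (parity k A) (AlgHom.id k A)))

instance : CommRing (Even hA) :=
  { (inferInstance : Ring (Even hA)) with
    mul_comm := fun a b => Subtype.ext (hA.even_comm (isHom_zero_iff.2 a.2) b.1) }

/-- The inclusion of the even subalgebra. -/
def val : Even hA →+* A := (AlgHom.equalizer (parity k A) (AlgHom.id k A)).val.toRingHom

variable {hA}

theorem isHom_val (a : Even hA) : IsHom k 0 (val hA a) := isHom_zero_iff.2 a.2

variable (hA) in
/-- An even element. -/
def mk (a : A) (ha : IsHom k 0 a) : Even hA := ⟨a, isHom_zero_iff.1 ha⟩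

@[simp] theorem val_mk (a : A) (ha : IsHom k 0 a) : val hA (mk hA a ha) = a := rfl

theorem val_comm (a : Even hA) (b : A) : val hA a * b = b * val hA a :=
  hA.even_comm (isHom_val a) b

/-- Cramer's rule for a matrix of even elements. -/
theorem det_mul_eq_zero {T : Type*} [Fintype T] [DecidableEq T] (W : Matrix T T (Even hA))
    (c : T → A) (h : ∀ i, ∑ l, val hA (W i l) * c l = 0) (i : T) : val hA W.det * c i = 0 := by
  have h1 : (W.map (val hA)).mulVec c = 0 := funext h
  have h2 : (W.adjugate.map (val hA)).mulVec ((W.map (val hA)).mulVec c) = 0 := by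
    rw [h1, Matrix.mulVec_zero]
  rw [Matrix.mulVec_mulVec, ← Matrix.map_mul, Matrix.adjugate_mul] at h2
  have h3 := congrFun h2 i
  rw [Matrix.mulVec, dotProduct, Finset.sum_eq_single i] at h3
  · simpa using h3
  · intro j _ hj
    simp [Matrix.one_apply_ne hj.symm]
  · simp

end Even

/-! ### Prime ideals of commutative superalgebras, and matrices that are scalar modulo a prime -/

section Prime

variable (k) in
-- An odd element satisfies a² = -a², so it squares to zero in characteristic zero.
theorem IsSuperComm.odd_mem (hA : IsSuperComm k A) {q : Ideal A} (hq : q.IsPrime) {a : A}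
    (ha : IsHom k 1 a) : a ∈ q := by
  have h := hA 1 1 a a ha ha
  rw [koszul_one_one, neg_smul, one_smul, eq_neg_iff_add_eq_zero, ← two_smul k,
    smul_eq_zero_iff_right two_ne_zero] at h
  rcases hq.mem_or_mem (show a * a ∈ q by rw [h]; exact zero_mem _) with h | h <;> exact h

theorem IsSuperComm.homPart_zero_mem_iff (hA : IsSuperComm k A) {q : Ideal A} (hq : q.IsPrime)
    {a : A} : homPart k 0 a ∈ q ↔ a ∈ q := by
  conv_rhs => rw [← homPart_add_homPart (k := k) a]
  exact (Ideal.add_mem_iff_left _ (hA.odd_mem k hq (isHom_homPart 1 a))).symm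

/-- The prime ideal of the even subring defined by a prime ideal. -/
theorem IsSuperComm.isPrime_comap (hA : IsSuperComm k A) {q : Ideal A} (hq : q.IsPrime) :
    (q.comap (Even.val hA)).IsPrime where
  ne_top' h := hq.ne_top (by
    rw [Ideal.eq_top_iff_one] at h ⊢
    rwa [Ideal.mem_comap, map_one] at h)
  mem_or_mem' h := hq.mem_or_mem (by simpa using h)

/-- Left prime ideals are two-sided: even elements are central, and odd ones lie in the ideal and
move past any factor up to parity. -/
theorem IsSuperComm.mul_mem_right (hA : IsSuperComm k A) {q : Ideal A} (hq : q.IsPrime)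
    {a : A} (b : A) (ha : a ∈ q) : a * b ∈ q := by
  have h0 := (hA.homPart_zero_mem_iff hq).2 ha
  have h1 := hA.odd_mem k hq (isHom_homPart (k := k) 1 a)
  rw [← homPart_add_homPart (k := k) a, add_mul, hA.even_comm (isHom_homPart 0 a),
    hA.odd_mul (isHom_homPart 1 a)]
  exact add_mem (q.mul_mem_left _ h0) (q.mul_mem_left _ h1)

/-- A matrix over a commutative superalgebra which is a nonzero scalar modulo a prime ideal has a
kernel killed by an even element outside this prime ideal. -/
theorem IsSuperComm.exists_mul_eq_zero (hA : IsSuperComm k A) {q : Ideal A} (hq : q.IsPrime)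
    {T : Type*} [Fintype T] [DecidableEq T] (H : T → T → A) (g : A) (hg : g ∉ q)
    (hH : ∀ i l, H i l - (if i = l then g else 0) ∈ q) :
    ∃ g' : Even hA, Even.val hA g' ∉ q ∧
      ∀ c : T → A, (∀ i, ∑ l, H i l * c l = 0) → ∀ i, Even.val hA g' * c i = 0 := by
  have hprime := hA.isPrime_comap hq
  set q0 := q.comap (Even.val hA) with hq0
  let H0 : Matrix T T (Even hA) := fun i l => Even.mk hA _ (isHom_homPart 0 (H i l))
  -- Write H = H₀ + H₁ by parity. Multiplying H c = 0 by the adjugate of the even part gives det(H₀)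
  -- c + Z c = 0 with Z = adj(H₀) H₁ odd.
  let Z : T → T → A := fun i l => ∑ m, Even.val hA (H0.adjugate i m) * homPart k 1 (H m l)
  have hZ (i l : T) : IsHom k 1 (Z i l) :=
    IsHom.sum fun m _ => by simpa using (Even.isHom_val (H0.adjugate i m)).mul (isHom_homPart 1 (H m l))
  have hZZ (i l : T) : IsHom k 0 (∑ m, Z i m * Z m l) :=
    IsHom.sum fun m _ => (hZ i m).mul (hZ m l)
  -- W = det(H₀)² - Z² has even entries, so commutative determinants apply. Modulo the prime it is
  -- the scalar det(H₀)², because the entries of Z are odd; this scalar is nonzero because H₀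
  -- reduces to a nonzero scalar matrix.
  let W : Matrix T T (Even hA) :=
    fun i l => (if i = l then H0.det ^ 2 else 0) - Even.mk hA _ (hZZ i l)
  have hgp : (Ideal.Quotient.mk q0) (Even.mk hA _ (isHom_homPart 0 g)) ≠ 0 := by
    rw [Ne, Ideal.Quotient.eq_zero_iff_mem, hq0, Ideal.mem_comap, Even.val_mk,
      hA.homPart_zero_mem_iff hq]
    exact hg
  have hdet : (Ideal.Quotient.mk q0) H0.det ≠ 0 := by
    rw [RingHom.map_det]
    have : (Ideal.Quotient.mk q0).mapMatrix H0 =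
        Matrix.diagonal fun _ => (Ideal.Quotient.mk q0) (Even.mk hA _ (isHom_homPart 0 g)) := by
      ext i l
      have h1 : homPart k 0 (H i l) - (if i = l then homPart k 0 g else 0) ∈ q := by
        have := (hA.homPart_zero_mem_iff hq).2 (hH i l)
        rw [map_sub] at this
        convert this using 2
        split_ifs <;> simp
      have h2 : Even.val hA (H0 i l) = homPart k 0 (H i l) := rfl
      rw [RingHom.mapMatrix_apply, Matrix.map_apply, Matrix.diagonal_apply]
      split_ifs with h
      · rw [Ideal.Quotient.eq, hq0, Ideal.mem_comap, map_sub, h2, Even.val_mk]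
        simpa [h] using h1
      · rw [Ideal.Quotient.eq_zero_iff_mem, hq0, Ideal.mem_comap, h2]
        simpa [h] using h1
    rw [this, Matrix.det_diagonal]
    exact Finset.prod_ne_zero_iff.2 fun _ _ => hgp
  refine ⟨W.det, ?_, fun c hc i => Even.det_mul_eq_zero W c (fun i => ?_) i⟩
  · suffices h : (Ideal.Quotient.mk q0) W.det ≠ 0 by
      rwa [Ne, Ideal.Quotient.eq_zero_iff_mem] at h
    rw [RingHom.map_det]
    have : (Ideal.Quotient.mk q0).mapMatrix W =
        Matrix.diagonal fun _ => (Ideal.Quotient.mk q0) H0.det ^ 2 := by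
      ext i l
      have h1 : (Ideal.Quotient.mk q0) (Even.mk hA _ (hZZ i l)) = 0 := by
        rw [Ideal.Quotient.eq_zero_iff_mem, hq0, Ideal.mem_comap, Even.val_mk]
        exact sum_mem fun m _ => q.mul_mem_left _ (hA.odd_mem k hq (hZ m l))
      rw [RingHom.mapMatrix_apply, Matrix.map_apply, Matrix.diagonal_apply, map_sub, h1, sub_zero]
      split_ifs <;> simp
    rw [this, Matrix.det_diagonal]
    exact Finset.prod_ne_zero_iff.2 fun _ _ => pow_ne_zero _ hdet
  -- Using det(H₀) c = -Z c twice gives W c = 0, and Cramer's rule for W shows that det(W) kills c.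
  · have key (i : T) : Even.val hA H0.det * c i + ∑ l, Z i l * c l = 0 := by
      have h1 : ∑ m, Even.val hA (H0.adjugate i m) * ∑ l, H m l * c l = 0 := by simp [hc]
      have h2 (l : T) : ∑ m, Even.val hA (H0.adjugate i m) * homPart k 0 (H m l) =
          if i = l then Even.val hA H0.det else 0 := by
        have := congrArg (fun M => Even.val hA (M i l)) (Matrix.adjugate_mul H0)
        simp only [Matrix.mul_apply, map_sum, map_mul] at this
        refine Eq.trans this ?_
        rw [Matrix.smul_apply, Matrix.one_apply]
        split_ifs <;> simp
      simp only [Finset.mul_sum] at h1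
      rw [Finset.sum_comm] at h1
      have h3 (l : T) : ∑ m, Even.val hA (H0.adjugate i m) * (H m l * c l) =
          (if i = l then Even.val hA H0.det * c l else 0) + Z i l * c l := by
        have : (if i = l then Even.val hA H0.det * c l else 0) =
          (if i = l then Even.val hA H0.det else 0) * c l := by split_ifs <;> simp
        rw [this, ← h2 l, ← add_mul, ← Finset.sum_add_distrib, Finset.sum_mul]
        refine Finset.sum_congr rfl fun m _ => ?_
        rw [← mul_add, homPart_add_homPart, mul_assoc]
      rw [Finset.sum_congr rfl fun l _ => h3 l, Finset.sum_add_distrib, Finset.sum_ite_eq] at h1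
      simpa using h1
    have e1 : ∑ l, Even.val hA (W i l) * c l =
        Even.val hA H0.det * (Even.val hA H0.det * c i) - ∑ l, ∑ m, Z i m * (Z m l * c l) := by
      have h3 (l : T) : Even.val hA (W i l) * c l =
          (if i = l then Even.val hA H0.det * (Even.val hA H0.det * c l) else 0) -
            ∑ m, Z i m * (Z m l * c l) := by
        show Even.val hA ((if i = l then H0.det ^ 2 else 0) - Even.mk hA _ (hZZ i l)) * c l = _
        rw [map_sub, Even.val_mk, sub_mul, Finset.sum_mul]
        simp only [mul_assoc]
        congr 1
        split_ifs
        · rw [map_pow, pow_two, mul_assoc]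
        · simp
      rw [Finset.sum_congr rfl fun l _ => h3 l, Finset.sum_sub_distrib, Finset.sum_ite_eq]
      simp
    rw [e1, Finset.sum_comm]
    simp only [← Finset.mul_sum]
    have h4 (m : T) : ∑ l, Z m l * c l = -(Even.val hA H0.det * c m) :=
      eq_neg_of_add_eq_zero_right (key m)
    simp only [h4, mul_neg]
    have h5 : ∑ m, Z i m * (Even.val hA H0.det * c m) =
        Even.val hA H0.det * ∑ m, Z i m * c m := by
      rw [Finset.mul_sum]
      refine Finset.sum_congr rfl fun m _ => ?_
      rw [← mul_assoc, ← Even.val_comm, mul_assoc]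
    rw [Finset.sum_neg_distrib, sub_neg_eq_add, h5, ← mul_add, key, mul_zero]

end Prime

end Even

/-! ## Local freeness of relative vector fields -/

theorem FreeNear.exists_of_family {k A C N : Type u} [Field k] [Ring A] [Algebra k A] [Super k A]
    [Ring C] {f : A →+* C} [AddCommGroup N] [Module Cᵐᵒᵖ N] {homog : ZMod 2 → N → Prop}
    {q : Ideal A} {T : Type*} [Fintype T] (p : T → ZMod 2) (v : T → N)
    (hv : ∀ t, homog (p t) (v t)) (g : A) (hg : IsHom k 0 g) (hgq : g ∉ q)
    (hspan : ∀ x : N, ∃ (l : ℕ) (c : T → C), op (f g ^ l) • x = ∑ t, op (c t) • v t)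
    (hind : ∀ c : T → C, ∑ t, op (c t) • v t = 0 → ∃ l : ℕ, ∀ t, c t * f g ^ l = 0) :
    ∃ m n : ℕ, FreeNear k f homog q m n := by
  classical
  let e : Fin (Fintype.card {t // p t = 0}) ⊕ Fin (Fintype.card {t // ¬p t = 0}) ≃ T :=
    (Equiv.sumCongr (Fintype.equivFin _).symm (Fintype.equivFin _).symm).trans
      (Equiv.sumCompl fun t => p t = 0)
  refine ⟨_, _, g, hg, hgq, v ∘ e, fun t => ?_, fun t => ?_, fun x => ?_, fun c hc => ?_⟩
  · have h : p (e (.inl t)) = 0 := ((Fintype.equivFin {t // p t = 0}).symm t).2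
    have h' := hv (e (.inl t))
    rwa [h] at h'
  · have h : p (e (.inr t)) = 1 := (zmod_two_cases _).resolve_left
      ((Fintype.equivFin {t // ¬p t = 0}).symm t).2
    have h' := hv (e (.inr t))
    rwa [h] at h'
  · obtain ⟨l, c, h⟩ := hspan x
    exact ⟨l, c ∘ e, h.trans (Equiv.sum_comp e fun t => op (c t) • v t).symm⟩
  · obtain ⟨l, h⟩ := hind (c ∘ e.symm) (by
      rw [← Equiv.sum_comp e]
      simpa using hc)
    exact ⟨l, fun t => by simpa using h (e t)⟩

namespace RelFields

variable {k R S : Type u} [Field k] [CharZero k] [Ring R] [Algebra k R] [Super k R]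
variable [Ring S] [Algebra k S] [Super k S] {φ : SuperHom k R S}

/-- The parity of relative vector fields. -/
def conj (θ : RelFields φ) : RelFields φ where
  toFun ω := parity k S (θ (RelForms.par φ ω))
  map_add' x y := by simp only [map_add]
  map_smul' c x := by
    have h : (parity k S).toRingHom c = parity k S c := rfl
    rw [map_smulₛₗ, map_smul, smul_eq_mul, map_mul, h, parity_parity]
    rfl

theorem hom_ext {θ θ' : RelFields φ} (h : ∀ s, θ (RelForms.d φ s) = θ' (RelForms.d φ s)) :
    θ = θ' := by
  refine LinearMap.ext fun ω => ?_
  induction ω using RelForms.induction_on with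
  | zero => simp
  | add x y hx hy => simp only [map_add, hx, hy]
  | smul c a => rw [map_smul, map_smul, h]

theorem conj_d (θ : RelFields φ) (s : S) :
    conj θ (RelForms.d φ s) = parity k _ (θ (RelForms.d φ (parity k S s))) := by
  show parity k S (θ (RelForms.par φ _)) = _
  rw [RelForms.par_d]

theorem IsHomog.conj_eq {i : ZMod 2} {θ : RelFields φ} (h : θ.IsHomog i) :
    conj θ = koszul i 1 • θ := by
  refine hom_ext fun s => ?_
  rw [conj_d, h, parity_parity]
  rfl

theorem conj_smul (c : S) (θ : RelFields φ) :
    conj (op c • θ) = op (parity k _ c) • conj θ :=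
  hom_ext fun s => by simp [conj_d]

variable (φ) in
/-- The parity of relative vector fields, as an additive map. -/
def conjHom : RelFields φ →+ RelFields φ :=
  AddMonoidHom.mk' conj fun θ θ' => hom_ext fun s => by simp [conj_d]

end RelFields

/-! ## Existence of local bases of relative vector fields -/

theorem op_sub_smul {C N : Type*} [Ring C] [AddCommGroup N] [Module Cᵐᵒᵖ N] (a b : C) (x : N) :
    op (a - b) • x = op a • x - op b • x := by
  rw [eq_sub_iff_add_eq, ← add_smul, ← op_add, sub_add_cancel]

namespace DualBasis

variable {k R S : Type u} [Field k] [CharZero k] [Ring R] [Algebra k R] [Super k R]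
variable [Ring S] [Algebra k S] [Super k S] {φ : SuperHom k R S} {ι : Type u} [Fintype ι]
  (β : DualBasis φ ι)

/-- The members of `T` generate the relative vector fields near `q`. -/
def Generates (q : Ideal S) (T : Finset ι) : Prop :=
  ∃ g : S, IsHom k 0 g ∧ g ∉ q ∧ ∀ j, ∃ a : ι → S,
    op g • β.field j = ∑ t ∈ T, op (a t) • β.field t

variable {β} in
-- A relation whose i-th coefficient is a unit at q expresses the i-th field through the others near
-- q. The relation is first made homogeneous, since only even elements may be inverted.
theorem Generates.erase [DecidableEq ι] (hS : IsSuperComm k S) {q : Ideal S} (hq : q.IsPrime)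
    {T : Finset ι} (hT : β.Generates q T) {c : ι → S} (hc : ∑ t ∈ T, op (c t) • β.field t = 0)
    {i : ι} (hi : i ∈ T) (hci : c i ∉ q) : β.Generates q (T.erase i) := by
  obtain ⟨g, hg, hgq, ha⟩ := hT
  -- Adding the parity conjugate of the relation, with the sign of the i-th field, leaves twice the
  -- part in which the i-th coefficient is even. That coefficient stays outside q because the odd
  -- part of `c i` lies in q.
  let c' (t : ι) : S := c t + (koszul (β.par i) 1 * koszul (β.par t) 1) • parity k S (c t)
  have hc' : ∑ t ∈ T, op (c' t) • β.field t = 0 := by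
    have h := congrArg (RelFields.conjHom φ) hc
    rw [map_sum, map_zero] at h
    have h' : koszul (β.par i) 1 • ∑ t ∈ T, RelFields.conjHom φ (op (c t) • β.field t) = 0 := by
      rw [h, smul_zero]
    refine Eq.trans ?_ ((congrArg₂ (· + ·) hc h').trans (add_zero 0))
    rw [Finset.smul_sum, ← Finset.sum_add_distrib]
    refine Finset.sum_congr rfl fun t _ => ?_
    have e : RelFields.conjHom φ (op (c t) • β.field t) =
        op (parity k S (c t)) • (koszul (β.par t) 1 • β.field t) :=
      (RelFields.conj_smul _ _).trans (by rw [(β.isHomog t).conj_eq])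
    rw [e, op_add, op_smul, add_smul, smul_comm (op _) (koszul (β.par t) 1), smul_smul, smul_assoc]
  have hi2 : c' i = (2 : k) • homPart k 0 (c i) := by
    show c i + (koszul (β.par i) 1 * koszul (β.par i) 1) • parity k S (c i) = _
    rw [koszul_mul_self, one_smul, homPart_apply, smul_smul, mul_inv_cancel₀ two_ne_zero,
      koszul_zero_left, one_smul, one_smul]
  have hi0 : IsHom k 0 (c' i) := by
    rw [hi2, isHom_zero_iff, map_smul, parity_homPart, koszul_zero_left, one_smul]
  have hiq : c' i ∉ q := by
    intro h
    refine hci ((hS.homPart_zero_mem_iff hq).1 ?_)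
    have h2 : homPart k 0 (c i) = algebraMap k S 2⁻¹ * c' i := by
      rw [hi2, ← Algebra.smul_def, smul_smul, inv_mul_cancel₀ two_ne_zero, one_smul]
    rw [h2]
    exact q.mul_mem_left _ h
  refine ⟨g * c' i, by simpa using hg.mul hi0, fun h => (hq.mem_or_mem h).elim hgq hiq,
    fun j => ?_⟩
  obtain ⟨a, ha⟩ := ha j
  -- The expansion is multiplied by the even element `c' i`, and the relation times `a i` is
  -- subtracted; the i-th terms cancel.
  refine ⟨fun t => a t * c' i - c' t * a i, ?_⟩
  have e1 : op (g * c' i) • β.field j = ∑ t ∈ T, op (a t * c' i) • β.field t := by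
    rw [op_mul, mul_smul, ha, Finset.smul_sum]
    simp only [op_mul, mul_smul]
  have e2 : ∑ t ∈ T, op (c' t * a i) • β.field t = 0 := by
    simp only [op_mul, mul_smul, ← Finset.smul_sum, hc', smul_zero]
  rw [e1, ← sub_zero (∑ t ∈ T, _), ← e2, ← Finset.sum_sub_distrib, ← Finset.sum_erase_add _ _ hi,
    hS.even_comm hi0, sub_self, add_zero]
  exact Finset.sum_congr rfl fun t _ => (op_sub_smul _ _ _).symm

theorem generates_univ {q : Ideal S} (hq : q.IsPrime) : β.Generates q Finset.univ := by
  classical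
  refine ⟨1, isHom_one, fun h => hq.ne_top ((Ideal.eq_top_iff_one q).2 h),
    fun j => ⟨fun t => if t = j then 1 else 0, ?_⟩⟩
  rw [Finset.sum_eq_single j]
  · simp
  · intro t _ ht
    simp [ht]
  · simp

/-- A generating subfamily near q of least cardinality admits only relations with all coefficients
in q. Self-expansion of its members then gives a matrix that is a nonzero scalar modulo q, and the
kernel of such a matrix, hence every relation, dies after inverting one more even element. -/
theorem exists_freeNear (β : DualBasis φ ι) (hS : IsSuperComm k S) {q : Ideal S}
    (hq : q.IsPrime) :
    ∃ m n : ℕ, FreeNear k (RingHom.id S) (RelFields.IsHomog (φ := φ)) q m n := by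
  classical
  obtain ⟨T, hT, hmin⟩ := Finset.exists_min_image
    (Finset.univ.filter fun T : Finset ι => β.Generates q T) Finset.card
    ⟨Finset.univ, by simpa using β.generates_univ hq⟩
  simp only [Finset.mem_filter, Finset.mem_univ, true_and] at hT hmin
  have hrel (c : ι → S) (hc : ∑ t ∈ T, op (c t) • β.field t = 0) (i : ι) (hi : i ∈ T) :
      c i ∈ q := by
    by_contra hci
    exact (Finset.card_erase_lt_of_mem hi).not_ge (hmin _ (hT.erase hS hq hc hi hci))
  obtain ⟨g, hg, hgq, ha⟩ := hT
  choose a ha using ha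
  -- Coordinates of g θ in the subfamily, chosen linear in θ: expand θ in the dual basis, then each
  -- field of the dual basis in the subfamily. Linearity lets the coordinates be applied to a
  -- relation.
  let h (i : ι) (θ : RelFields φ) : S := ∑ j, a j i * θ (RelForms.d φ (β.x j))
  have hspan (θ : RelFields φ) : op g • θ = ∑ i ∈ T, op (h i θ) • β.field i := by
    conv_lhs => rw [β.field_eq_sum θ, Finset.smul_sum]
    have e (j : ι) : op g • op (θ (RelForms.d φ (β.x j))) • β.field j =
        ∑ i ∈ T, op (a j i * θ (RelForms.d φ (β.x j))) • β.field i := by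
      rw [smul_smul, ← op_mul, ← hS.even_comm hg, op_mul, mul_smul, ha, Finset.smul_sum]
      simp only [op_mul, mul_smul]
    rw [Finset.sum_congr rfl fun j _ => e j, Finset.sum_comm]
    refine Finset.sum_congr rfl fun i _ => ?_
    rw [← Finset.sum_smul]
    congr 1
    exact (map_sum (opAddEquiv (α := S)) _ _).symm
  have hlin (i : ι) (c : ι → S) : h i (∑ l ∈ T, op (c l) • β.field l) =
      ∑ l ∈ T, h i (β.field l) * c l := by
    simp only [h, LinearMap.sum_apply, Finset.mul_sum, Finset.sum_mul]
    rw [Finset.sum_comm]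
    refine Finset.sum_congr rfl fun l _ => Finset.sum_congr rfl fun j _ => ?_
    rw [mul_assoc]
    rfl
  -- The expansion of g times the l-th field and the tautological expression differ by a relation,
  -- so their coefficients agree modulo q.
  have hH (l : ι) (hl : l ∈ T) (i : ι) (hi : i ∈ T) :
      h i (β.field l) - (if i = l then g else 0) ∈ q := by
    refine hrel (fun i => h i (β.field l) - (if i = l then g else 0)) ?_ i hi
    have hsub (t : ι) : op (h t (β.field l) - (if t = l then g else 0)) • β.field t =
        op (h t (β.field l)) • β.field t - op (if t = l then g else 0) • β.field t :=
      op_sub_smul (h t (β.field l)) (if t = l then g else 0) (β.field t)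
    rw [Finset.sum_congr rfl fun t _ => hsub t, Finset.sum_sub_distrib, ← hspan,
      Finset.sum_eq_single_of_mem l hl fun t _ ht => by rw [if_neg ht, op_zero, zero_smul],
      if_pos rfl, sub_self]
  obtain ⟨g', hg', hkill⟩ := hS.exists_mul_eq_zero hq (T := T)
    (fun i l => h i (β.field l)) g hgq fun i l => by
      simpa only [Subtype.ext_iff] using hH l l.2 i i.2
  refine FreeNear.exists_of_family (T := T) (fun t => β.par t) (fun t => β.field t)
    (fun t => β.isHomog t) (g * Even.val hS g') (by simpa using hg.mul (Even.isHom_val g'))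
    (fun hh => (hq.mem_or_mem hh).elim hgq hg') (fun θ => ⟨1, fun t => h t θ * Even.val hS g', ?_⟩)
    fun c hc => ⟨1, fun t => ?_⟩
  · simp only [op_mul, mul_smul, ← Finset.smul_sum, pow_one, RingHom.id_apply]
    rw [hspan, Finset.sum_coe_sort T fun t => op (h t θ) • β.field t]
  · let c' (i : ι) : S := if hi : i ∈ T then c ⟨i, hi⟩ else 0
    have hc' : ∑ l ∈ T, op (c' l) • β.field l = 0 := by
      rw [← Finset.sum_coe_sort, ← hc]
      refine Finset.sum_congr rfl fun t _ => ?_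
      simp [c']
    have := hkill c (fun i => by
      have e := hlin i c'
      rw [hc', ← Finset.sum_coe_sort] at e
      refine Eq.trans ?_ (e.symm.trans ?_)
      · refine Finset.sum_congr rfl fun t _ => ?_
        simp [c']
      · simp [h]) t
    rw [RingHom.id_apply, pow_one, hS.even_comm hg, ← mul_assoc, ← Even.val_comm, this, zero_mul]

end DualBasis

/-! ## Localization at elements with locally nilpotent commutators -/

section Nilpotent

variable {k C : Type u} [Field k] [Ring C] [Algebra k C]

variable (k) in
/-- The commutator `x ↦ x g - g x`. -/
def commutatorEnd (g : C) : Module.End k C := LinearMap.mulRight k g - LinearMap.mulLeft k g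

theorem commutatorEnd_apply (g x : C) : commutatorEnd k g x = x * g - g * x := rfl

variable (k) in
/-- Some iterated commutator of `x` with `g` vanishes. -/
def AdNilpotent (g x : C) : Prop := ∃ d : ℕ, (commutatorEnd k g ^ d) x = 0

/-- The commutator with g is a derivation. In each term of the iterated Leibniz expansion of a
product, one of the factors has been differentiated often enough to vanish. -/
theorem commutatorEnd_pow_mul (g : C) (n : ℕ) : ∀ (d e : ℕ) (x y : C), d + e = n →
    (commutatorEnd k g ^ d) x = 0 → (commutatorEnd k g ^ e) y = 0 →
    (commutatorEnd k g ^ n) (x * y) = 0 := by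
  induction n with
  | zero =>
    intro d e x y h hx _
    obtain rfl : d = 0 := by omega
    obtain rfl : x = 0 := hx
    simp
  | succ n ih =>
    intro d e x y h hx hy
    rcases d with _ | d
    · obtain rfl : x = 0 := hx
      simp
    rcases e with _ | e
    · obtain rfl : y = 0 := hy
      simp
    rw [pow_succ, Module.End.mul_apply] at hx hy ⊢
    have h1 : commutatorEnd k g (x * y) = commutatorEnd k g x * y + x * commutatorEnd k g y := by
      simp only [commutatorEnd_apply]
      noncomm_ring
    rw [h1, map_add, ih d (e + 1) _ _ (by omega) hx (by rwa [pow_succ, Module.End.mul_apply]),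
      ih (d + 1) e _ _ (by omega) (by rwa [pow_succ, Module.End.mul_apply]) hy, add_zero]

theorem AdNilpotent.mul {g x y : C} (hx : AdNilpotent k g x) (hy : AdNilpotent k g y) :
    AdNilpotent k g (x * y) := by
  obtain ⟨d, hx⟩ := hx
  obtain ⟨e, hy⟩ := hy
  exact ⟨d + e, commutatorEnd_pow_mul g _ d e x y rfl hx hy⟩

theorem AdNilpotent.add {g x y : C} (hx : AdNilpotent k g x) (hy : AdNilpotent k g y) :
    AdNilpotent k g (x + y) := by
  obtain ⟨d, hx⟩ := hx
  obtain ⟨e, hy⟩ := hy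
  refine ⟨d + e, ?_⟩
  rw [map_add, pow_add, Module.End.mul_apply, Module.End.mul_apply, hy, map_zero, add_zero,
    ← Module.End.mul_apply, ← pow_add, add_comm, pow_add, Module.End.mul_apply, hx, map_zero]

/-- Right multiplication by g is the sum of left multiplication and the commutator, which commute;
the binomial theorem applies. -/
theorem mul_pow_eq_sum (g x : C) (n : ℕ) : x * g ^ n =
    ∑ m ∈ Finset.range (n + 1), g ^ m * (commutatorEnd k g ^ (n - m)) (n.choose m • x) := by
  have hc : Commute (LinearMap.mulLeft k g) (commutatorEnd k g) := by
    refine LinearMap.ext fun y => ?_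
    show g * (y * g - g * y) = g * y * g - g * (g * y)
    noncomm_ring
  have h := hc.add_pow n
  have h1 : LinearMap.mulLeft k g + commutatorEnd k g = LinearMap.mulRight k g :=
    add_sub_cancel _ _
  rw [h1] at h
  have h2 := LinearMap.congr_fun h x
  rw [LinearMap.pow_mulRight, LinearMap.mulRight_apply, LinearMap.sum_apply] at h2
  rw [h2]
  refine Finset.sum_congr rfl fun m _ => ?_
  rw [Module.End.mul_apply, Module.End.mul_apply, LinearMap.pow_mulLeft, LinearMap.mulLeft_apply]
  simp

/-- The Ore condition. -/
theorem AdNilpotent.exists_mul_pow {g x : C} (h : AdNilpotent k g x) (l : ℕ) :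
    ∃ (L : ℕ) (y : C), x * g ^ L = g ^ l * y := by
  obtain ⟨d, hd⟩ := h
  -- With exponent l + d, the terms with m < l contain at least d commutators and vanish; the others
  -- have the left factor g^l.
  refine ⟨l + d, ∑ m ∈ Finset.range (l + d + 1), if l ≤ m then
    g ^ (m - l) * (commutatorEnd k g ^ (l + d - m)) ((l + d).choose m • x) else 0, ?_⟩
  rw [mul_pow_eq_sum (k := k), Finset.mul_sum]
  refine Finset.sum_congr rfl fun m _ => ?_
  split_ifs with hm
  · rw [← mul_assoc, ← pow_add, Nat.add_sub_cancel' hm]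
  · have : l + d - m = (l - m) + d := by omega
    rw [this, pow_add, Module.End.mul_apply, map_nsmul, hd]
    simp

/-- Left torsion elements are right torsion elements. -/
theorem AdNilpotent.exists_mul_pow_eq_zero {g x : C} (h : AdNilpotent k g x) {l : ℕ}
    (hl : g ^ l * x = 0) : ∃ L : ℕ, x * g ^ L = 0 := by
  obtain ⟨d, hd⟩ := h
  -- Terms with m < l vanish as in the Ore condition. For m ≥ l the factor g^m commutes past the
  -- commutators and kills x.
  refine ⟨l + d, ?_⟩
  rw [mul_pow_eq_sum (k := k)]
  refine Finset.sum_eq_zero fun m _ => ?_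
  rcases le_or_gt l m with hm | hm
  · have hc : Commute (LinearMap.mulLeft k (g ^ m)) (commutatorEnd k g ^ (l + d - m)) := by
      refine Commute.pow_right ?_ _
      refine LinearMap.ext fun y => ?_
      show g ^ m * (y * g - g * y) = g ^ m * y * g - g * (g ^ m * y)
      rw [mul_sub, ← mul_assoc, ← mul_assoc, ← mul_assoc, ← pow_succ, ← pow_succ']
    have := LinearMap.congr_fun hc.eq ((l + d).choose m • x)
    rw [Module.End.mul_apply, Module.End.mul_apply, LinearMap.mulLeft_apply,
      LinearMap.mulLeft_apply] at this
    rw [this, mul_smul_comm, ← Nat.sub_add_cancel hm, pow_add, mul_assoc, hl]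
    simp
  · have : l + d - m = (l - m) + d := by omega
    rw [this, pow_add, Module.End.mul_apply, map_nsmul, hd]
    simp

end Nilpotent

namespace AD

variable {k R A : Type u} [Field k] [CharZero k] [Ring R] [Algebra k R] [Super k R]
variable [Ring A] [Algebra k A] [Super k A] [DAlgebra k R A]

/-- 𝒟 is generated by functions and vector fields, and the functions in 𝒟 are identified with
functions in `A`; so `A` and the vector fields generate the algebra. -/
theorem induction_on {p : AD k R A → Prop} (hfun : ∀ a, p (ofFun k R A a))
    (hder : ∀ {i : ZMod 2} {δ : Module.End k R} (h : IsSuperDer k i δ), p (ofOp k R A (derOp h)))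
    (hadd : ∀ x y, p x → p y → p (x + y)) (hmul : ∀ x y, p x → p y → p (x * y))
    (x : AD k R A) : p x := by
  have hop (P : diffOps k R) : p (ofOp k R A P) := by
    obtain ⟨P, hP⟩ := P
    have hP' := hP
    induction hP' using Algebra.adjoin_induction with
    | mem P h =>
      rcases h with ⟨f, rfl⟩ | ⟨i, h⟩
      · have := ofOp_mulOp k R A f
        exact (congrArg p this).mpr (hfun _)
      · exact hder h
    | algebraMap c =>
      have : ofOp k R A (algebraMap k _ c) = ofFun k R A (algebraMap k A c) := by
        rw [AlgHom.commutes, AlgHom.commutes]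
      exact (congrArg p this).mpr (hfun _)
    | add P Q hP₁ hQ₁ ihP ihQ =>
      have := map_add (ofOp k R A) ⟨P, hP₁⟩ ⟨Q, hQ₁⟩
      exact (congrArg p this).mpr (hadd _ _ (ihP _) (ihQ _))
    | mul P Q hP₁ hQ₁ ihP ihQ =>
      have := map_mul (ofOp k R A) ⟨P, hP₁⟩ ⟨Q, hQ₁⟩
      exact (congrArg p this).mpr (hmul _ _ (ihP _) (ihQ _))
  obtain ⟨y, rfl⟩ : ∃ y, mk k R A y = x := RingQuot.mkAlgHom_surjective k (AD.Rel k R A) x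
  induction y using FreeAlgebra.induction with
  | grade0 c =>
    rw [AlgHom.commutes, ← (ofFun k R A).commutes c]
    exact hfun _
  | grade1 x =>
    rcases x with a | P
    · exact hfun a
    · exact hop P
  | mul x y hx hy =>
    rw [map_mul]
    exact hmul _ _ hx hy
  | add x y hx hy =>
    rw [map_add]
    exact hadd _ _ hx hy

theorem derOp_comm_even {i : ZMod 2} {δ : Module.End k R} (h : IsSuperDer k i δ) {g : A}
    (hg : IsHom k 0 g) : ofOp k R A (derOp h) * ofFun k R A g =
      ofFun k R A (DAlgebra.act (derOp h) g) + ofFun k R A g * ofOp k R A (derOp h) := by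
  rw [ofOp_derOp_mul]
  congr 3
  unfold twist
  split_ifs
  · exact isHom_zero_iff.1 hg
  · rfl

theorem ofFun_even_comm {g : A} (hg : IsHom k 0 g) (a : A) :
    ofFun k R A a * ofFun k R A g = ofFun k R A g * ofFun k R A a := by
  have hA : IsSuperComm k A := DAlgebra.comm (R := R)
  rw [← map_mul, ← map_mul, hA.even_comm hg]

/-- Functions commute with the even g, while the commutator of a vector field with g is a function,
killed by a second commutator. Local nilpotency passes to sums and products. -/
theorem adNilpotent {g : A} (hg : IsHom k 0 g) (x : AD k R A) :
    AdNilpotent k (ofFun k R A g) x := by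
  induction x using AD.induction_on with
  | hfun a =>
    refine ⟨1, ?_⟩
    rw [pow_one, commutatorEnd_apply, ofFun_even_comm hg, sub_self]
  | hder h =>
    refine ⟨2, ?_⟩
    rw [pow_two, Module.End.mul_apply, commutatorEnd_apply, commutatorEnd_apply,
      derOp_comm_even h hg, add_sub_cancel_right, ofFun_even_comm hg, sub_self]
  | hadd x y hx hy => exact hx.add hy
  | hmul x y hx hy => exact hx.mul hy

end AD

/-! ## Local bases of local vector fields -/

section RightModule

variable {C N N' T : Type*} [Ring C] [AddCommGroup N] [Module Cᵐᵒᵖ N] [AddCommGroup N']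
  [Module Cᵐᵒᵖ N'] [Fintype T]

theorem op_pow_smul_op_smul {G P y : C} {x : N} {W : T → N} {c : T → C} {l L : ℕ}
    (hx : op (G ^ l) • x = ∑ t, op (c t) • W t) (hy : P * G ^ L = G ^ l * y) :
    op (G ^ L) • op P • x = ∑ t, op (c t * y) • W t := by
  rw [smul_smul, ← op_mul, hy, op_mul, mul_smul, hx, Finset.smul_sum]
  simp only [op_mul, mul_smul]

theorem exists_op_pow_smul_add {G : C} {x y : N} {W : T → N}
    (hx : ∃ (l : ℕ) (c : T → C), op (G ^ l) • x = ∑ t, op (c t) • W t)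
    (hy : ∃ (l : ℕ) (c : T → C), op (G ^ l) • y = ∑ t, op (c t) • W t) :
    ∃ (l : ℕ) (c : T → C), op (G ^ l) • (x + y) = ∑ t, op (c t) • W t := by
  obtain ⟨l, c, hx⟩ := hx
  obtain ⟨l', c', hy⟩ := hy
  refine ⟨l + l', fun t => c t * G ^ l' + c' t * G ^ l, ?_⟩
  have h1 : op (G ^ (l + l')) • x = op (G ^ l') • op (G ^ l) • x := by
    rw [smul_smul, ← op_mul, pow_add]
  have h2 : op (G ^ (l + l')) • y = op (G ^ l) • op (G ^ l') • y := by
    rw [smul_smul, ← op_mul, add_comm, pow_add]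
  rw [smul_add, h1, h2, hx, hy]
  simp only [op_add, op_mul, add_smul, mul_smul, Finset.sum_add_distrib, Finset.smul_sum]

theorem sum_op_smul_map (f : N →ₗ[Cᵐᵒᵖ] N') (W : T → N) (c : T → C) :
    f (∑ t, op (c t) • W t) = ∑ t, op (c t) • f (W t) := by
  rw [map_sum]
  simp only [map_smul]

end RightModule

namespace DualBasis

variable {k R S : Type u} [Field k] [CharZero k] [Ring R] [Algebra k R] [Super k R]
variable [Ring S] [Algebra k S] [Super k S] {φ : SuperHom k R S} {ι : Type u} [Fintype ι]
  (β : DualBasis φ ι)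

/-- The element of `p^*Θ ⊗ ℬ[𝒟]` defined by a relative vector field. -/
def induced (θ : RelFields φ) : InducedFields φ := RightExt.tmul _ (RightExt.tmul _ θ 1) 1

theorem tmul_tmul_eq (θ : RelFields φ) (b : Jet φ) (P : JetD φ) :
    (RightExt.tmul _ (RightExt.tmul _ θ b) P : InducedFields φ) =
      op (AD.ofFun k R (Jet φ) b * P) • induced θ := by
  rw [induced, RightExt.smul_tmul, one_mul, ← one_mul b, ← RightExt.smul_tmul, RightExt.tmul_smul,
    one_mul]
  rfl

theorem induced_add (θ θ' : RelFields φ) : induced (θ + θ') = induced θ + induced θ' := by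
  rw [induced, RightExt.add_tmul, RightExt.add_tmul]
  rfl

theorem induced_smul (c : S) (θ : RelFields φ) :
    induced (op c • θ) = op (toJetD φ c) • induced θ := by
  rw [induced, RightExt.tmul_smul, tmul_tmul_eq, mul_one, mul_one]
  rfl

theorem induced_sum {T : Type*} [Fintype T] (θ : T → RelFields φ) :
    induced (∑ t, θ t) = ∑ t, induced (θ t) :=
  map_sum (AddMonoidHom.mk' (induced (φ := φ)) induced_add) _ _

theorem eval_induced (θ : RelFields φ) (s : S) :
    InducedFields.eval φ (induced θ) s = toJetD φ (θ (RelForms.d φ s)) := by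
  rw [induced, InducedFields.eval_tmul, mul_one, mul_one]
  rfl

/-- A denominator for θ stands to the left of the operator P in θ ⊗ P; the Ore condition moves it to
the right. -/
theorem exists_pow_smul_eq_sum {T : Type*} [Fintype T] {g : S} (hg : IsHom k 0 g)
    {v : T → RelFields φ}
    (hspan : ∀ θ : RelFields φ, ∃ (l : ℕ) (c : T → S), op (g ^ l) • θ = ∑ t, op (c t) • v t)
    (z : InducedFields φ) : ∃ (l : ℕ) (c : T → JetD φ),
      op (toJetD φ g ^ l) • z = ∑ t, op (c t) • induced (v t) := by
  have htmul (θ : RelFields φ) (P : JetD φ) : ∃ (l : ℕ) (c : T → JetD φ),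
      op (toJetD φ g ^ l) • op P • induced θ = ∑ t, op (c t) • induced (v t) := by
    obtain ⟨l, c, hl⟩ := hspan θ
    obtain ⟨L, y, hy⟩ := (AD.adNilpotent (R := R) ((Jet.of φ).isHom hg) P).exists_mul_pow l
    have hl' : op (toJetD φ g ^ l) • induced θ = ∑ t, op (toJetD φ (c t)) • induced (v t) := by
      rw [← map_pow, ← induced_smul, hl, induced_sum]
      exact Finset.sum_congr rfl fun t _ => induced_smul _ _
    exact ⟨L, fun t => toJetD φ (c t) * y, op_pow_smul_op_smul hl' hy⟩
  induction z using RightExt.induction_on with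
  | add x y hx hy => exact exists_op_pow_smul_add hx hy
  | tmul y P =>
    induction y using RightExt.induction_on with
    | add x y hx hy => rw [RightExt.add_tmul]; exact exists_op_pow_smul_add hx hy
    | tmul θ b => rw [tmul_tmul_eq]; exact htmul θ _

/-- Pairing a relation with the forms d(x j) and recombining by the local expansion of the dual
basis recovers each coefficient up to a power of g on its left. Local nilpotency of commutators
turns this left torsion into right torsion. -/
theorem exists_mul_pow_eq_zero (β : DualBasis φ ι) (hS : IsSuperComm k S) {T : Type*} [Fintype T]
    [DecidableEq T] {g : S} (hg : IsHom k 0 g) {v : T → RelFields φ}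
    (hspan : ∀ θ : RelFields φ, ∃ (l : ℕ) (c : T → S), op (g ^ l) • θ = ∑ t, op (c t) • v t)
    (hind : ∀ c : T → S, ∑ t, op (c t) • v t = 0 → ∃ l : ℕ, ∀ t, c t * g ^ l = 0)
    {c : T → JetD φ} (hc' : ∀ s, ∑ t, toJetD φ (v t (RelForms.d φ s)) * c t = 0) :
    ∃ l : ℕ, ∀ t, c t * toJetD φ g ^ l = 0 := by
  choose l₀ a₀ ha₀ using fun j => hspan (β.field j)
  obtain ⟨l, a, ha⟩ : ∃ (l : ℕ) (a : ι → T → S),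
      ∀ j, op (g ^ l) • β.field j = ∑ t, op (a j t) • v t := by
    -- The sum of the exponents bounds each one, giving a common denominator.
    refine ⟨∑ j, l₀ j, fun j t => a₀ j t * g ^ (∑ j, l₀ j - l₀ j), fun j => ?_⟩
    have : l₀ j ≤ ∑ j, l₀ j := Finset.single_le_sum (fun _ _ => Nat.zero_le _) (Finset.mem_univ j)
    conv_lhs => rw [← Nat.add_sub_cancel' this, pow_add, op_mul, mul_smul, ha₀, Finset.smul_sum]
    simp only [op_mul, mul_smul]
  -- The matrix of g^l times the family v expressed in v itself; by independence it equals g^l times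
  -- the identity up to g-torsion.
  let E (s t : T) : S := ∑ j, a j s * v t (RelForms.d φ (β.x j))
  have hE (t : T) : ∃ l' : ℕ, ∀ s, (E s t - if s = t then g ^ l else 0) * g ^ l' = 0 := by
    refine hind _ ?_
    have h1 : ∑ s, op (E s t) • v s = op (g ^ l) • v t := by
      conv_rhs => rw [β.field_eq_sum (v t), Finset.smul_sum]
      have e (j : ι) : op (g ^ l) • op (v t (RelForms.d φ (β.x j))) • β.field j =
          ∑ s, op (a j s * v t (RelForms.d φ (β.x j))) • v s := by
        rw [smul_smul, ← op_mul, ← hS.even_comm (hg.pow l), op_mul, mul_smul, ha, Finset.smul_sum]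
        simp only [op_mul, mul_smul]
      rw [Finset.sum_congr rfl fun j _ => e j, Finset.sum_comm]
      refine Finset.sum_congr rfl fun s _ => ?_
      rw [← Finset.sum_smul]
      congr 1
      exact map_sum (opAddEquiv (α := S)) _ _
    have h2 (s : T) : op (E s t - if s = t then g ^ l else 0) • v s =
        op (E s t) • v s - op (if s = t then g ^ l else 0) • v s :=
      op_sub_smul (E s t) (if s = t then g ^ l else 0) (v s)
    rw [Finset.sum_congr rfl fun s _ => h2 s, Finset.sum_sub_distrib, h1,
      Finset.sum_eq_single t (fun s _ hs => by rw [if_neg hs, op_zero, zero_smul]) (by simp),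
      if_pos rfl, sub_self]
  choose l₁ hl₁ using hE
  have hl₁' (s t : T) :
      E s t * g ^ ∑ t, l₁ t = (if s = t then g ^ l else 0) * g ^ ∑ t, l₁ t := by
    have : l₁ t ≤ ∑ t, l₁ t := Finset.single_le_sum (fun _ _ => Nat.zero_le _) (Finset.mem_univ t)
    rw [← sub_eq_zero, ← sub_mul, ← Nat.add_sub_cancel' this, pow_add, ← mul_assoc, hl₁, zero_mul]
  -- The coefficients of E are first multiplied by a common power of g, placed on the left since g
  -- is even. The off-diagonal terms then vanish exactly.
  have hleft (s : T) : toJetD φ g ^ (∑ t, l₁ t + l) * c s = 0 := by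
    have h1 : ∑ t, toJetD φ (E s t * g ^ ∑ t, l₁ t) * c t = 0 := by
      have e (t : T) : toJetD φ (E s t * g ^ ∑ t, l₁ t) * c t =
          ∑ j, toJetD φ (g ^ (∑ t, l₁ t) * a j s) *
            (toJetD φ (v t (RelForms.d φ (β.x j))) * c t) := by
        rw [← hS.even_comm (hg.pow _), Finset.mul_sum, map_sum, Finset.sum_mul]
        refine Finset.sum_congr rfl fun j _ => ?_
        simp only [map_mul, mul_assoc]
      rw [Finset.sum_congr rfl fun t _ => e t, Finset.sum_comm]
      refine Finset.sum_eq_zero fun j _ => ?_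
      rw [← Finset.mul_sum, hc', mul_zero]
    rw [Finset.sum_eq_single s (fun t _ ht => by
      rw [hl₁', if_neg ht.symm, zero_mul, map_zero, zero_mul]) (by simp), hl₁', if_pos rfl,
      ← pow_add, map_pow, add_comm] at h1
    exact h1
  choose L hL using fun s =>
    (AD.adNilpotent (R := R) ((Jet.of φ).isHom hg) (c s)).exists_mul_pow_eq_zero (hleft s)
  refine ⟨∑ s, L s, fun s => ?_⟩
  have : L s ≤ ∑ s, L s := Finset.single_le_sum (fun _ _ => Nat.zero_le _) (Finset.mem_univ s)
  have e : c s * toJetD φ g ^ L s = 0 := hL s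
  rw [← Nat.add_sub_cancel' this, pow_add, ← mul_assoc, e, zero_mul]

theorem isHomog_equiv_symm_induced {i : ZMod 2} {θ : RelFields φ} (hθ : θ.IsHomog i) :
    (β.equiv.symm (induced θ)).IsHomog i := by
  rw [β.isHomog_iff_toInduced_mem]
  have : β.toInduced (β.equiv.symm (induced θ)) = induced θ := β.equiv.apply_symm_apply _
  rw [this]
  exact AddSubgroup.subset_closure ⟨i, 0, 0, θ, 1, 1, by simp, hθ, isHom_one, isHom_one, rfl⟩

/-- The same local basis works over p^*g: both conditions are transported through `equiv` and the
pairing, with denominators controlled by the Ore condition. -/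
theorem freeNear_localFields (β : DualBasis φ ι) (hS : IsSuperComm k S) {q : Ideal (Jet φ)}
    {m n : ℕ} (h : FreeNear k (RingHom.id S) (RelFields.IsHomog (φ := φ))
      (q.comap (Jet.of φ).toAlgHom) m n) :
    FreeNear k (AD.ofFun k R (Jet φ)).toRingHom
      (LocalFields.IsHomog (k := k) (R := R) (A := Jet φ)) q m n := by
  obtain ⟨g, hg, hgq, v, hv0, hv1, hspan, hind⟩ := h
  refine ⟨(Jet.of φ).toAlgHom g, (Jet.of φ).isHom hg, hgq, fun t => β.equiv.symm (induced (v t)),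
    fun t => β.isHomog_equiv_symm_induced (hv0 t), fun t => β.isHomog_equiv_symm_induced (hv1 t),
    fun x => ?_, fun c hc => ?_⟩
  · obtain ⟨l, c, h⟩ := exists_pow_smul_eq_sum hg hspan (β.equiv x)
    refine ⟨l, c, β.equiv.injective ?_⟩
    refine (map_smul β.equiv _ _).trans (Eq.trans (Eq.trans h ?_)
      (sum_op_smul_map β.equiv.toLinearMap _ c).symm)
    exact Finset.sum_congr rfl fun t _ => congrArg _ (β.equiv.apply_symm_apply _).symm
  · refine β.exists_mul_pow_eq_zero hS hg hspan hind fun s => ?_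
    have h1 := (sum_op_smul_map ((InducedFields.eval φ).comp β.equiv.toLinearMap) _ c).symm.trans
      ((congrArg _ hc).trans (map_zero _))
    have h2 := congrFun h1 s
    rw [Finset.sum_apply] at h2
    refine Eq.trans (Finset.sum_congr rfl fun t _ => ?_) h2
    have h3 : ((InducedFields.eval φ).comp β.equiv.toLinearMap) (β.equiv.symm (induced (v t))) s =
        toJetD φ (v t (RelForms.d φ s)) := by
      rw [← eval_induced, LinearMap.comp_apply]
      exact congrArg (fun z => InducedFields.eval φ z s) (β.equiv.apply_symm_apply _)
    rw [← h3]
    rfl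

end DualBasis

/-! ## Vector fields on a smooth supervariety -/

section VectorFields

variable {k R : Type u} [Field k] [CharZero k] [Ring R] [Algebra k R] [Super k R]

theorem twist_zero (a : R) : twist k 0 a = a := rfl

theorem twist_one (a : R) : twist k 1 a = parity k R a := rfl

theorem twist_add (i : ZMod 2) (a b : R) : twist k i (a + b) = twist k i a + twist k i b := by
  unfold twist; split_ifs <;> simp

theorem twist_mul (i : ZMod 2) (a b : R) : twist k i (a * b) = twist k i a * twist k i b := by
  unfold twist; split_ifs <;> simp

theorem twist_smul (i : ZMod 2) (c : k) (a : R) : twist k i (c • a) = c • twist k i a := by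
  unfold twist; split_ifs <;> simp

theorem twist_twist (i j : ZMod 2) (a : R) : twist k i (twist k j a) = twist k (i + j) a := by
  rcases zmod_two_cases i with rfl | rfl <;> rcases zmod_two_cases j with rfl | rfl
  · rfl
  · rfl
  · rfl
  · exact parity_parity k a

theorem homPart_twist (i j : ZMod 2) (a : R) :
    homPart k j (twist k i a) = koszul i j • homPart k j a := by
  rcases zmod_two_cases i with rfl | rfl
  · simp [twist_zero]
  · rw [twist_one, homPart_parity]
    congr 1
    revert j; decide

theorem IsHom.twist_eq {i j : ZMod 2} {a : R} (ha : IsHom k j a) :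
    twist k i a = koszul i j • a := by
  rcases zmod_two_cases i with rfl | rfl
  · simp [twist_zero]
  · rw [twist_one, ha]
    congr 1
    simp [koszul, and_comm]

theorem twist_zsmul (i : ZMod 2) (n : ℤ) (a : R) : twist k i (n • a) = n • twist k i a := by
  unfold twist; split_ifs
  · rw [map_zsmul]
  · rfl

/-- Moving a homogeneous element to the left. -/
theorem IsSuperComm.mul_eq_mul_twist (hR : IsSuperComm k R) {j : ZMod 2} {c : R} (hc : IsHom k j c)
    (x : R) : x * c = c * twist k j x := by
  rcases zmod_two_cases j with rfl | rfl
  · exact (hR.even_comm hc x).symm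
  · rw [twist_one, hR.odd_mul hc, parity_parity]

theorem IsSuperDer.map_one {i : ZMod 2} {δ : Module.End k R} (h : IsSuperDer k i δ) : δ 1 = 0 := by
  have h1 := h.leibniz 1 1
  have h2 : twist k i (1 : R) = 1 := by unfold twist; split_ifs <;> simp
  rw [mul_one, mul_one, h2, one_mul] at h1
  simpa using h1

theorem IsSuperDer.twist {i : ZMod 2} {δ : Module.End k R} (h : IsSuperDer k i δ) (j : ZMod 2)
    (a : R) : DGeom.twist k j (δ a) = koszul i j • δ (DGeom.twist k j a) := by
  rcases zmod_two_cases j with rfl | rfl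
  · simp [twist_zero]
  · rw [twist_one, twist_one, h.parity]

/-- The supercommutator of vector fields is a vector field. -/
theorem IsSuperDer.bracket {i j : ZMod 2} {δ ε : Module.End k R} (hδ : IsSuperDer k i δ)
    (hε : IsSuperDer k j ε) : IsSuperDer k (i + j) (δ * ε - koszul i j • (ε * δ)) where
  parity a := by
    simp only [LinearMap.sub_apply, LinearMap.smul_apply, Module.End.mul_apply, map_sub, map_zsmul,
      hδ.parity, hε.parity, koszul_add_left, smul_smul, smul_sub, mul_comm, mul_left_comm]
  leibniz a b := by
    simp only [LinearMap.sub_apply, LinearMap.smul_apply, Module.End.mul_apply, hδ.leibniz,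
      hε.leibniz, map_add, hδ.twist, hε.twist, twist_twist, mul_add, add_mul, sub_mul, mul_sub,
      smul_add, smul_mul_assoc, mul_smul_comm, smul_smul, add_comm j i]
    have h : koszul j i = koszul i j := by simp [koszul, and_comm]
    rw [h, koszul_mul_self, one_smul]
    abel

namespace DualBasis

variable {κ : Type u} [Fintype κ] (β : DualBasis (SuperHom.scalars k R) κ)

theorem twist_field (t : κ) (j : ZMod 2) (a : R) :
    twist k j (β.field t (RelForms.d _ a)) =
      koszul (β.par t) j • β.field t (RelForms.d _ (twist k j a)) := by
  rcases zmod_two_cases j with rfl | rfl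
  · simp [twist_zero]
  · rw [twist_one, twist_one, β.isHomog t]

/-- The vector fields of a dual basis, as differential operators. -/
def der (t : κ) : Module.End k R where
  toFun a := β.field t (RelForms.d _ (twist k (β.par t) a))
  map_add' a b := by rw [twist_add, RelForms.d_add, map_add]
  map_smul' c a := by
    rw [twist_smul, Algebra.smul_def, RelForms.isLeibniz_d_apply, RelForms.d_algebraMap,
      AlgHom.commutes, RelForms.d_algebraMap]
    simp [Algebra.smul_def]

/-- A linear functional on Ω¹ satisfies the Leibniz rule without a sign on the first term, whereas a
vector field acting on the left carries the sign there. Precomposition with the twist in `der`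
converts one convention into the other. -/
theorem isSuperDer_der (hR : IsSuperComm k R) (t : κ) : IsSuperDer k (β.par t) (β.der t) where
  parity a := by
    show parity k R (β.field t _) = _ • β.field t _
    rw [β.isHomog t, AD.parity_twist]
  leibniz a b := by
    show β.field t _ = β.field t _ * b + _ * β.field t _
    rw [twist_mul, RelForms.isLeibniz_d_apply, map_add, map_add, map_smul, map_smul, map_smul,
      hR.mul_eq, homPart_twist, homPart_twist, β.isHomog t, koszul_zero_right, one_smul]
    simp only [smul_eq_mul, smul_mul_assoc, mul_smul_comm]
    abel

/-- Undoing the twist makes δ a linear functional on Ω¹, which the dual basis expands. -/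
theorem eq_sum_der (hR : IsSuperComm k R) {i : ZMod 2} {δ : Module.End k R}
    (h : IsSuperDer k i δ) : ∃ f : κ → R, ∀ a, δ a = ∑ t, f t * β.der t a := by
  let D : R →+ R := AddMonoidHom.mk' (fun a => δ (twist k i a)) fun a b => by
    rw [twist_add, map_add]
  have hD (a : R) : D a = δ (twist k i a) := rfl
  have hleib : IsLeibniz k ((Module.toAddMonoidEnd R R).comp (RingHom.id R)) D := by
    refine isLeibniz_of_apply_mul fun a b => ?_
    show D (a * b) = a * D b + (homPart k 0 b * D a + homPart k 1 b * D (parity k R a))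
    rw [hD, hD, hD, hD, twist_mul, h.leibniz, twist_twist, hR.mul_eq, homPart_twist, homPart_twist,
      h.parity, ← AD.parity_twist]
    have : twist k (i + i) a = a := by
      rw [CharTwo.add_self_eq_zero]; rfl
    rw [this]
    simp only [koszul_zero_right, one_smul, smul_mul_assoc, mul_smul_comm, smul_smul,
      koszul_mul_self]
    abel
  let η : RelFields (SuperHom.scalars k R) := RelForms.lift _ (RingHom.id R) D
    (fun c => by
      show δ (twist k i (algebraMap k R c)) = 0
      rw [(SqZeroExt.isHom_algebraMap c).twist_eq, koszul_zero_right, one_smul,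
        Algebra.algebraMap_eq_smul_one, map_smul, h.map_one, smul_zero]) hleib
  have hη (a : R) : η (RelForms.d _ a) = D a := RelForms.lift_d _ _ _ _ _ a
  have hc (t : κ) : IsHom k (i + β.par t) (D (β.x t)) := by
    unfold IsHom
    rw [hD, h.parity, AD.parity_twist, β.isHom t, twist_zsmul, map_zsmul, smul_smul,
      koszul_add_left]
  refine ⟨fun t => koszul (β.par t) (i + β.par t) • D (β.x t), fun a => ?_⟩
  have h1 : δ a = η (RelForms.d _ (twist k i a)) := by
    rw [hη, hD, twist_twist, CharTwo.add_self_eq_zero]; rfl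
  rw [h1, β.field_eq_sum η, LinearMap.sum_apply]
  refine Finset.sum_congr rfl fun t _ => ?_
  show β.field t _ * η _ = _
  -- The dual basis expansion has its coefficients on the right; moving a coefficient of parity `i +
  -- β.par t` to the left twists the other factor and produces the Koszul sign absorbed in the
  -- chosen coefficients.
  have ht : twist k (i + β.par t) (β.field t (RelForms.d _ (twist k i a))) =
      koszul (β.par t) (i + β.par t) • β.der t a := by
    rw [β.twist_field, twist_twist, add_right_comm, CharTwo.add_self_eq_zero, zero_add]
    rfl
  rw [hη, hR.mul_eq_mul_twist (hc t), ht, mul_smul_comm, smul_mul_assoc]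

end DualBasis

end VectorFields

/-! ## The order filtration -/

section Words

variable {k R A : Type u} [Field k] [CharZero k] [Ring R] [Algebra k R] [Super k R]
variable [Ring A] [Algebra k A] [Super k A] [DAlgebra k R A]

/-- A finite family of vector fields generating all vector fields over the functions. -/
structure VectorFrame (k R : Type u) [Field k] [CharZero k] [Ring R] [Algebra k R] [Super k R]
    (κ : Type u) [Fintype κ] where
  par : κ → ZMod 2
  der : κ → Module.End k R
  isSuperDer : ∀ t, IsSuperDer k (par t) (der t)
  eq_sum : ∀ {i : ZMod 2} {δ : Module.End k R}, IsSuperDer k i δ →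
    ∃ f : κ → R, ∀ a, δ a = ∑ t, f t * der t a

namespace VectorFrame

variable {κ : Type u} [Fintype κ] (F : VectorFrame k R κ)

variable (A) in
/-- The members of the frame, as elements of `A[𝒟]`. -/
def diff (t : κ) : AD k R A := AD.ofOp k R A (derOp (F.isSuperDer t))

variable (A) in
/-- Monomials in the frame. -/
def word (l : List κ) : AD k R A := (l.map (F.diff A)).prod

theorem word_nil : F.word A [] = 1 := rfl

theorem word_cons (t : κ) (l : List κ) : F.word A (t :: l) = F.diff A t * F.word A l := by
  simp [word]

variable (A) in
/-- The operators of order less than `n`. -/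
def filt (n : ℕ) : Submodule k (AD k R A) :=
  Submodule.span k {x | ∃ (a : A) (l : List κ), l.length < n ∧ x = AD.ofFun k R A a * F.word A l}

theorem ofFun_mul_word_mem (a : A) {l : List κ} {n : ℕ} (h : l.length < n) :
    AD.ofFun k R A a * F.word A l ∈ F.filt A n := Submodule.subset_span ⟨a, l, h, rfl⟩

theorem filt_mono {m n : ℕ} (h : m ≤ n) : F.filt A m ≤ F.filt A n :=
  Submodule.span_mono fun _ ⟨a, l, hl, hx⟩ => ⟨a, l, hl.trans_le h, hx⟩

theorem word_mem {l : List κ} {n : ℕ} (h : l.length < n) : F.word A l ∈ F.filt A n := by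
  have := F.ofFun_mul_word_mem (A := A) 1 h
  rwa [map_one, one_mul] at this

theorem smul_mem_closure {n : ℕ} (c : k) {x : AD k R A} (hx : x ∈ AddSubmonoid.closure
    {x | ∃ (a : A) (l : List κ), l.length < n ∧ x = AD.ofFun k R A a * F.word A l}) :
    c • x ∈ AddSubmonoid.closure
      {x | ∃ (a : A) (l : List κ), l.length < n ∧ x = AD.ofFun k R A a * F.word A l} := by
  induction hx using AddSubmonoid.closure_induction with
  | mem x hx =>
    obtain ⟨a, l, hl, rfl⟩ := hx
    refine AddSubmonoid.subset_closure ⟨c • a, l, hl, ?_⟩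
    rw [map_smul, smul_mul_assoc]
  | zero => rw [smul_zero]; exact zero_mem _
  | add x y _ _ hx hy => rw [smul_add]; exact add_mem hx hy

/-- Scalars can be absorbed into the function coefficient, so the `k`-span is already the additive
span and no scalar clause is needed. -/
theorem filt_induction {n : ℕ} {p : AD k R A → Prop} (h0 : p 0)
    (hadd : ∀ x y, p x → p y → p (x + y))
    (h : ∀ (a : A) (l : List κ), l.length < n → p (AD.ofFun k R A a * F.word A l))
    {x : AD k R A} (hx : x ∈ F.filt A n) : p x := by
  have hx' : x ∈ AddSubmonoid.closure
      {x | ∃ (a : A) (l : List κ), l.length < n ∧ x = AD.ofFun k R A a * F.word A l} := by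
    induction hx using Submodule.span_induction with
    | mem x hx => exact AddSubmonoid.subset_closure hx
    | zero => exact zero_mem _
    | add x y _ _ hx hy => exact add_mem hx hy
    | smul c x _ hx => exact F.smul_mem_closure c hx
  clear hx
  induction hx' using AddSubmonoid.closure_induction with
  | mem x hx =>
    obtain ⟨a, l, hl, rfl⟩ := hx
    exact h a l hl
  | zero => exact h0
  | add x y _ _ hx hy => exact hadd x y hx hy

theorem ofFun_mul_mem (a : A) {n : ℕ} {x : AD k R A} (hx : x ∈ F.filt A n) :
    AD.ofFun k R A a * x ∈ F.filt A n := by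
  refine F.filt_induction (p := fun x => AD.ofFun k R A a * x ∈ F.filt A n) ?_
    (fun x y hx hy => ?_) (fun b l hl => ?_) hx
  · rw [mul_zero]; exact zero_mem _
  · rw [mul_add]; exact add_mem hx hy
  · rw [← mul_assoc, ← map_mul]
    exact F.ofFun_mul_word_mem _ hl

theorem diff_mul_mem (t : κ) {n : ℕ} {x : AD k R A} (hx : x ∈ F.filt A n) :
    F.diff A t * x ∈ F.filt A (n + 1) := by
  refine F.filt_induction (p := fun x => F.diff A t * x ∈ F.filt A (n + 1)) ?_
    (fun x y hx hy => ?_) (fun b l hl => ?_) hx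
  · rw [mul_zero]; exact zero_mem _
  · rw [mul_add]; exact add_mem hx hy
  · rw [← mul_assoc, diff, AD.ofOp_derOp_mul, add_mul, mul_assoc]
    refine add_mem (F.ofFun_mul_word_mem _ (hl.trans (Nat.lt_succ_self n))) ?_
    have := F.ofFun_mul_word_mem (A := A) (twist k (F.par t) b)
      (show (t :: l).length < n + 1 from Nat.succ_lt_succ hl)
    rwa [word_cons] at this

/-- Membership in `filt (m + 1)` means order at most m; hence the bound n + m rather than n + m + 1.
-/
theorem mul_mem {m n : ℕ} {x y : AD k R A} (hx : x ∈ F.filt A (m + 1)) (hy : y ∈ F.filt A n) :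
    x * y ∈ F.filt A (n + m) := by
  refine F.filt_induction (p := fun x => x * y ∈ F.filt A (n + m)) ?_
    (fun x y hx hy => ?_) (fun a l hl => ?_) hx
  · rw [zero_mul]; exact zero_mem _
  · rw [add_mul]; exact add_mem hx hy
  · rw [mul_assoc]
    refine F.ofFun_mul_mem a (F.filt_mono (show n + l.length ≤ n + m by omega) ?_)
    clear hl
    induction l with
    | nil => rw [word_nil, one_mul]; exact hy
    | cons t l ih =>
      rw [word_cons, mul_assoc]
      exact F.diff_mul_mem t ih

theorem derOp_mem {i : ZMod 2} {δ : Module.End k R} (h : IsSuperDer k i δ) :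
    AD.ofOp k R A (derOp h) ∈ F.filt A 2 := by
  obtain ⟨f, hf⟩ := F.eq_sum h
  have : derOp h = ∑ t, mulOp k (f t) * derOp (F.isSuperDer t) := by
    refine Subtype.ext (LinearMap.ext fun a => (hf a).trans ?_)
    rw [AddSubmonoidClass.coe_finsetSum, LinearMap.sum_apply]
    rfl
  rw [this, map_sum]
  refine sum_mem fun t _ => ?_
  rw [map_mul, AD.ofOp_mulOp]
  refine F.ofFun_mul_mem _ ?_
  have := F.word_mem (A := A) (show [t].length < 2 by simp)
  rwa [word_cons, word_nil, mul_one] at this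

theorem exists_mem_filt (x : AD k R A) : ∃ n, x ∈ F.filt A (n + 1) := by
  induction x using AD.induction_on with
  | hfun a =>
    refine ⟨0, ?_⟩
    have := F.ofFun_mul_word_mem a (show ([] : List κ).length < 1 by simp)
    rwa [word_nil, mul_one] at this
  | hder h => exact ⟨1, F.derOp_mem h⟩
  | hadd x y hx hy =>
    obtain ⟨m, hx⟩ := hx
    obtain ⟨n, hy⟩ := hy
    exact ⟨m + n, add_mem (F.filt_mono (by omega) hx) (F.filt_mono (by omega) hy)⟩
  | hmul x y hx hy =>
    obtain ⟨m, hx⟩ := hx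
    obtain ⟨n, hy⟩ := hy
    exact ⟨n + m, F.filt_mono (by omega) (F.mul_mem hx hy)⟩

/-- The supercommutator is again a vector field, hence a function combination of the frame: order at
most one instead of two. -/
theorem diff_mul_diff (s t : κ) : F.diff A s * F.diff A t -
    koszul (F.par s) (F.par t) • (F.diff A t * F.diff A s) ∈ F.filt A 2 := by
  have h := F.derOp_mem (A := A) ((F.isSuperDer s).bracket (F.isSuperDer t))
  have e : derOp ((F.isSuperDer s).bracket (F.isSuperDer t)) =
      derOp (F.isSuperDer s) * derOp (F.isSuperDer t) -
        koszul (F.par s) (F.par t) • (derOp (F.isSuperDer t) * derOp (F.isSuperDer s)) :=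
    Subtype.ext (by
      exact congrArg (fun x => F.der s * F.der t - x) (map_zsmul (diffOps k R).val
        (koszul (F.par s) (F.par t)) (derOp (F.isSuperDer t) * derOp (F.isSuperDer s))).symm)
  rw [e] at h
  exact Eq.mp (congrArg (· ∈ F.filt A 2) ((map_sub (AD.ofOp k R A) _ _).trans
    (congrArg₂ (· - ·) (map_mul (AD.ofOp k R A) _ _)
      ((map_zsmul (AD.ofOp k R A).toAddMonoidHom _ _).trans
        (congrArg _ (map_mul (AD.ofOp k R A) _ _)))))) h

/-- Every transposition of neighbours contributes a Koszul sign and an error of lower order, so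
modulo lower order a word depends up to sign only on its multiset of letters. -/
theorem word_perm {l l' : List κ} (h : l.Perm l') :
    ∃ c : ℤ, F.word A l - c • F.word A l' ∈ F.filt A l.length := by
  induction h with
  | nil => exact ⟨1, by simp⟩
  | cons t _ ih =>
    obtain ⟨c, ih⟩ := ih
    refine ⟨c, ?_⟩
    rw [word_cons, word_cons, ← mul_smul_comm, ← mul_sub]
    exact F.diff_mul_mem t ih
  | swap s t l =>
    refine ⟨koszul (F.par t) (F.par s), ?_⟩
    have := F.mul_mem (F.diff_mul_diff (A := A) t s) (F.word_mem (Nat.lt_succ_self l.length))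
    rw [sub_mul, smul_mul_assoc, mul_assoc, mul_assoc] at this
    simp only [word_cons]
    exact this
  | trans h₁ _ ih₁ ih₂ =>
    obtain ⟨c₁, ih₁⟩ := ih₁
    obtain ⟨c₂, ih₂⟩ := ih₂
    refine ⟨c₁ * c₂, ?_⟩
    rw [← h₁.length_eq] at ih₂
    have := add_mem ih₁ (zsmul_mem ih₂ c₁)
    rwa [smul_sub, smul_smul, sub_add_sub_cancel] at this

end VectorFrame

/-- The frame given by a dual basis of the vector fields. -/
def DualBasis.frame {κ : Type u} [Fintype κ] (β : DualBasis (SuperHom.scalars k R) κ)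
    (hR : IsSuperComm k R) : VectorFrame k R κ where
  par := β.par
  der := β.der
  isSuperDer := β.isSuperDer_der hR
  eq_sum := β.eq_sum_der hR

theorem IsSmooth.exists_vectorFrame (hR : IsSuperComm k R)
    (hM : IsSmooth (SuperHom.scalars k R)) :
    ∃ (κ : Type u) (_ : Fintype κ), Nonempty (VectorFrame k R κ) := by
  obtain ⟨κ, i, h⟩ := IsSmooth.exists_dualBasis (φ := SuperHom.scalars k R) hR hM
  obtain ⟨β⟩ := h
  exact ⟨κ, i, ⟨β.frame hR⟩⟩

end Words

/-! ## The fibre of `A[𝒟]` at a point -/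

section Fiber

open TensorProduct

variable {k R A K : Type u} [Field k] [CharZero k] [Ring R] [Algebra k R] [Super k R]
variable [Ring A] [Algebra k A] [Super k A]

/-- The residue field of a point of an affine supervariety. -/
theorem IsSuperComm.exists_residueField (hA : IsSuperComm k A) {q : Ideal A} (hq : q.IsPrime) :
    ∃ (K : Type u) (_ : Field K) (χ : A →+* K), (∀ a, χ (parity k A a) = χ a) ∧
      ∀ a, χ a = 0 → a ∈ q := by
  -- The quotient by q is made into a ring first; it is commutative because odd elements lie in q,
  -- so that parity acts trivially modulo q.
  have : q.IsTwoSided := ⟨fun b ha => hA.mul_mem_right hq b ha⟩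
  have hpar (a : A) : Ideal.Quotient.mk q (parity k A a) = Ideal.Quotient.mk q a := by
    rw [Ideal.Quotient.eq, ← homPart_add_homPart (k := k) a, map_add, parity_homPart,
      parity_homPart]
    have h1 := hA.odd_mem k hq (isHom_homPart (k := k) 1 a)
    simpa [koszul_one_one] using sub_mem (q.neg_mem h1) h1
  let _ : CommRing (A ⧸ q) :=
    { Ideal.Quotient.ring q with
      mul_comm := by
        rintro ⟨a⟩ ⟨b⟩
        show Ideal.Quotient.mk q a * Ideal.Quotient.mk q b =
          Ideal.Quotient.mk q b * Ideal.Quotient.mk q a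
        rw [← map_mul, hA.mul_eq, map_add, map_mul, map_mul, hpar, ← add_mul, ← map_add,
          homPart_add_homPart] }
  have : IsDomain (A ⧸ q) := Ideal.Quotient.isDomain q
  refine ⟨FractionRing (A ⧸ q), inferInstance,
    (algebraMap (A ⧸ q) (FractionRing (A ⧸ q))).comp (Ideal.Quotient.mk q), fun a => ?_,
    fun a ha => ?_⟩
  · exact congrArg (algebraMap (A ⧸ q) (FractionRing (A ⧸ q))) (hpar a)
  · exact Ideal.Quotient.eq_zero_iff_mem.1 (IsFractionRing.injective (A ⧸ q) _
      ((show algebraMap (A ⧸ q) (FractionRing (A ⧸ q)) (Ideal.Quotient.mk q a) = 0 from ha).trans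
        (map_zero _).symm))

variable [DAlgebra k R A]

variable (k R A) in
/-- The tautological action of `A[𝒟]` on `A`. -/
def AD.toEnd : AD k R A →ₐ[k] Module.End k A :=
  RingQuot.liftAlgHom k ⟨FreeAlgebra.lift k
    (Sum.elim (fun a => LinearMap.mulLeft k a) fun P => DAlgebra.act P), by
    intro x y h
    induction h with
    | fun_add a b => ext; simp [add_mul]
    | fun_mul a b => ext; simp [mul_assoc]
    | fun_scalar c => ext; simp [Algebra.algebraMap_eq_smul_one]
    | op_add P Q => simp
    | op_mul P Q => simp
    | op_scalar c => simp only [FreeAlgebra.lift_ι_apply, Sum.elim_inr, AlgHom.commutes]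
    | unit f =>
      ext a
      simp only [FreeAlgebra.lift_ι_apply, Sum.elim_inr, Sum.elim_inl, LinearMap.mulLeft_apply]
      rw [← DAlgebra.act_mulOp, one_mul]
    | leibniz h a =>
      ext b
      simp [DAlgebra.act_derOp]⟩

theorem AD.toEnd_ofFun (a b : A) : AD.toEnd k R A (AD.ofFun k R A a) b = a * b := by
  have : AD.toEnd k R A (AD.ofFun k R A a) = LinearMap.mulLeft k a := by
    refine (RingQuot.liftAlgHom_mkAlgHom_apply k _ _ _).trans ?_
    simp
  rw [this, LinearMap.mulLeft_apply]

variable [Field K] (χ : A →+* K)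

variable (k R) in
/-- The fibre `K ⊗_A A[𝒟]` at a `K`-point `χ` of `A`. -/
abbrev Fiber : Type u :=
  (K ⊗[ℤ] AD k R A) ⧸ Submodule.span K
    {z | ∃ (a : A) (x : AD k R A), z = 1 ⊗ₜ[ℤ] (AD.ofFun k R A a * x) - χ a ⊗ₜ[ℤ] x}

namespace Fiber

variable (k R) in
/-- The restriction of an operator to the fibre. -/
def ι : AD k R A →+ Fiber k R χ where
  toFun x := Submodule.Quotient.mk (1 ⊗ₜ[ℤ] x)
  map_zero' := by rw [tmul_zero]; rfl
  map_add' x y := by rw [tmul_add]; rfl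

theorem mk_tmul (c : K) (x : AD k R A) :
    (Submodule.Quotient.mk (c ⊗ₜ[ℤ] x) : Fiber k R χ) = c • ι k R χ x := by
  show _ = Submodule.Quotient.mk (c • (1 : K) ⊗ₜ[ℤ] x)
  rw [smul_tmul', smul_eq_mul, mul_one]

theorem ι_ofFun_mul (a : A) (x : AD k R A) :
    ι k R χ (AD.ofFun k R A a * x) = χ a • ι k R χ x := by
  rw [← mk_tmul]
  exact (Submodule.Quotient.eq _).2 (Submodule.subset_span ⟨a, x, rfl⟩)

theorem induction_on {p : Fiber k R χ → Prop} (z : Fiber k R χ)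
    (h : ∀ (c : K) (x : AD k R A), p (c • ι k R χ x)) (hadd : ∀ y z, p y → p z → p (y + z)) : p z := by
  obtain ⟨z, rfl⟩ := Submodule.Quotient.mk_surjective _ z
  induction z with
  | zero => simpa using h 0 0
  | tmul c x => rw [mk_tmul]; exact h c x
  | add y z hy hz => exact hadd _ _ hy hz

/-- The functional c ⊗ x ↦ c χ(x(1)), built from the tautological action on `A`, respects the
relations of the fibre and takes the value 1. No basis of `A[𝒟]` is needed. -/
theorem ι_one_ne_zero : ι k R χ 1 ≠ 0 := by
  let f : K ⊗[ℤ] AD k R A →ₗ[K] K := LinearMap.liftBaseChange K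
    (((χ : A →+ K).comp
      ((LinearMap.applyₗ (R := k) (1 : A)).toAddMonoidHom.comp
        (AD.toEnd k R A).toRingHom.toAddMonoidHom)).toIntLinearMap)
  have hf (c : K) (x : AD k R A) : f (c ⊗ₜ x) = c * χ (AD.toEnd k R A x 1) :=
    LinearMap.liftBaseChange_tmul _ _ _ _
  have hker : Submodule.span K
      {z | ∃ (a : A) (x : AD k R A), z = 1 ⊗ₜ[ℤ] (AD.ofFun k R A a * x) - χ a ⊗ₜ[ℤ] x} ≤
      LinearMap.ker f := by
    rw [Submodule.span_le]
    rintro _ ⟨a, x, rfl⟩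
    rw [SetLike.mem_coe, LinearMap.mem_ker, map_sub, hf, hf, map_mul, Module.End.mul_apply,
      AD.toEnd_ofFun, map_mul, one_mul, sub_self]
  intro h
  have h1 : (1 : K) ⊗ₜ[ℤ] (1 : AD k R A) ∈ LinearMap.ker f :=
    hker ((Submodule.Quotient.mk_eq_zero _).1 h)
  rw [LinearMap.mem_ker, hf, map_one (AD.toEnd k R A), Module.End.one_apply, map_one, one_mul] at h1
  exact one_ne_zero h1

/-- Right multiplication by an operator. -/
def right (y : AD k R A) : Module.End K (Fiber k R χ) :=
  Submodule.mapQ _ _ (LinearMap.baseChange K (AddMonoidHom.mulRight y).toIntLinearMap) (by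
    rw [Submodule.span_le]
    rintro _ ⟨a, x, rfl⟩
    refine Submodule.subset_span ⟨a, x * y, ?_⟩
    rw [map_sub, LinearMap.baseChange_tmul, LinearMap.baseChange_tmul]
    show 1 ⊗ₜ (AD.ofFun k R A a * x * y) - χ a ⊗ₜ (x * y) = _
    rw [mul_assoc])

theorem right_ι (x y : AD k R A) : right χ y (ι k R χ x) = ι k R χ (x * y) := rfl

theorem end_ext {f g : Module.End K (Fiber k R χ)}
    (h : ∀ x, f (ι k R χ x) = g (ι k R χ x)) : f = g := by
  refine LinearMap.ext fun z => ?_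
  induction z using Fiber.induction_on with
  | h c x => rw [map_smul, map_smul, h]
  | hadd y z hy hz => rw [map_add, map_add, hy, hz]

variable (k R) in
/-- The right `A[𝒟]`-module structure of the fibre. -/
def ρ : (AD k R A)ᵐᵒᵖ →+* Module.End K (Fiber k R χ) where
  toFun y := right χ y.unop
  map_zero' := end_ext χ fun x => by simp [right_ι]
  map_one' := end_ext χ fun x => by simp [right_ι]
  map_add' y z := end_ext χ fun x => by simp [right_ι, mul_add]
  map_mul' y z := end_ext χ fun x => by simp [right_ι, mul_assoc]

theorem ρ_ι (x y : AD k R A) : ρ k R χ (op y) (ι k R χ x) = ι k R χ (x * y) := rfl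

/-- Even functions which do not vanish at the point act injectively on the fibre. -/
theorem ρ_ofFun_injective {g : A} (hg : IsHom k 0 g) (hχ : χ g ≠ 0) {z : Fiber k R χ}
    (hz : ρ k R χ (op (AD.ofFun k R A g)) z = 0) : z = 0 := by
  -- On classes of operators N is the commutator with g, so it is locally nilpotent; a vector killed
  -- by the action of g would be an eigenvector of N with eigenvalue -χ(g) ≠ 0.
  let N : Module.End K (Fiber k R χ) := ρ k R χ (op (AD.ofFun k R A g)) - χ g • 1
  have hN (x : AD k R A) : N (ι k R χ x) = ι k R χ (commutatorEnd k (AD.ofFun k R A g) x) := by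
    rw [commutatorEnd_apply, map_sub, ι_ofFun_mul]
    rfl
  have hN' (d : ℕ) : ∀ x : AD k R A,
      (N ^ d) (ι k R χ x) = ι k R χ ((commutatorEnd k (AD.ofFun k R A g) ^ d) x) := by
    induction d with
    | zero => exact fun x => rfl
    | succ d ih =>
      intro x
      rw [pow_succ, pow_succ, Module.End.mul_apply, Module.End.mul_apply, hN, ih]
  have hnil (y : Fiber k R χ) : ∃ d : ℕ, (N ^ d) y = 0 := by
    induction y using Fiber.induction_on with
    | h c x =>
      obtain ⟨d, hd⟩ := AD.adNilpotent (R := R) hg x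
      exact ⟨d, by rw [map_smul, hN', hd, map_zero, smul_zero]⟩
    | hadd y z hy hz =>
      obtain ⟨d, hy⟩ := hy
      obtain ⟨e, hz⟩ := hz
      refine ⟨d + e, ?_⟩
      rw [map_add, add_comm d e, pow_add, Module.End.mul_apply, hy, map_zero, zero_add,
        ← pow_add, add_comm e d, pow_add, Module.End.mul_apply, hz, map_zero]
  have hNz : N z = -χ g • z := by
    rw [LinearMap.sub_apply, hz, zero_sub, neg_smul]
    rfl
  have hNz' (d : ℕ) : (N ^ d) z = (-χ g) ^ d • z := by
    induction d with
    | zero => simp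
    | succ d ih => rw [pow_succ, Module.End.mul_apply, hNz, map_smul, ih, smul_smul, pow_succ']
  obtain ⟨d, hd⟩ := hnil z
  rw [hNz'] at hd
  exact (smul_eq_zero.1 hd).resolve_left (pow_ne_zero _ (neg_ne_zero.2 hχ))

theorem ρ_ofFun_pow_injective {g : A} (hg : IsHom k 0 g) (hχ : χ g ≠ 0) (l : ℕ) {z : Fiber k R χ}
    (hz : ρ k R χ (op (AD.ofFun k R A g ^ l)) z = 0) : z = 0 := by
  rw [← map_pow] at hz
  exact ρ_ofFun_injective χ (hg.pow l) (by rw [map_pow]; exact pow_ne_zero _ hχ) hz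

end Fiber

end Fiber

/-! ## Growth -/

section Growth

/-- The power of (b + 1)/b outgrows any polynomial in m; for b = 0 already m = 1 gives a
contradiction. -/
theorem not_forall_pow_le (r c b : ℕ) :
    ¬∀ m : ℕ, (b + 1) ^ m ≤ (1 + m * c) ^ r * b ^ m := by
  intro h
  rcases Nat.eq_zero_or_pos b with rfl | hb
  · simpa using h 1
  have hb' : (0 : ℝ) < b := Nat.cast_pos.2 hb
  have hr : (1 : ℝ) < (b + 1) / b := by
    rw [one_lt_div hb']
    exact lt_add_one _
  have ht := (tendsto_pow_const_div_const_pow_of_one_lt r hr).const_mul ((1 + c : ℝ) ^ r)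
  rw [mul_zero] at ht
  obtain ⟨m, hm, hm1⟩ := ((ht.eventually (gt_mem_nhds one_pos)).and
    (Filter.eventually_ge_atTop 1)).exists
  have h1 : ((b : ℝ) + 1) ^ m ≤ (1 + m * c) ^ r * b ^ m := mod_cast h m
  have h2 : (1 + m * c : ℝ) ^ r ≤ ((1 + c) * m) ^ r := by
    have : (1 : ℝ) ≤ m := mod_cast hm1
    gcongr
    linarith
  have h3 : (0 : ℝ) < ((b + 1) / b) ^ m := by positivity
  rw [← mul_div_assoc, div_lt_one h3, ← mul_pow, div_pow, lt_div_iff₀ (by positivity)] at hm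
  have h4 := mul_le_mul_of_nonneg_right h2 (pow_nonneg hb'.le m)
  linarith

variable {k R A K : Type u} [Field k] [CharZero k] [Ring R] [Algebra k R] [Super k R]
variable [Ring A] [Algebra k A] [Super k A] [DAlgebra k R A] [Field K] (χ : A →+* K)
variable {κ : Type u} [Fintype κ] (F : VectorFrame k R κ)

namespace VectorFrame

/-- The restrictions of the operators of order less than `n` to the fibre. -/
def fiberFilt (n : ℕ) : Submodule K (Fiber k R χ) :=
  Submodule.span K ((fun l => Fiber.ι k R χ (F.word A l)) '' {l | l.length < n})

theorem ι_mem_fiberFilt {n : ℕ} {x : AD k R A} (hx : x ∈ F.filt A n) :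
    Fiber.ι k R χ x ∈ F.fiberFilt χ n := by
  refine F.filt_induction (p := fun x => Fiber.ι k R χ x ∈ F.fiberFilt χ n) ?_
    (fun x y hx hy => ?_) (fun a l hl => ?_) hx
  · rw [map_zero]; exact zero_mem _
  · rw [map_add]; exact add_mem hx hy
  · rw [Fiber.ι_ofFun_mul]
    exact Submodule.smul_mem _ _ (Submodule.subset_span ⟨l, hl, rfl⟩)

theorem ρ_mem_fiberFilt {n c : ℕ} {y : AD k R A} (hy : y ∈ F.filt A (c + 1)) {z : Fiber k R χ}
    (hz : z ∈ F.fiberFilt χ n) : Fiber.ρ k R χ (op y) z ∈ F.fiberFilt χ (n + c) := by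
  suffices h : F.fiberFilt χ n ≤ (F.fiberFilt χ (n + c)).comap (Fiber.ρ k R χ (op y)) from h hz
  refine Submodule.span_le.2 ?_
  rintro _ ⟨l, hl, rfl⟩
  rw [SetLike.mem_coe, Submodule.mem_comap]
  rw [Fiber.ρ_ι]
  have hl' : l.length < n := hl
  exact F.ι_mem_fiberFilt χ (F.filt_mono (by omega)
    (F.mul_mem (F.word_mem (Nat.lt_succ_self l.length)) hy))

/-- The list containing every `t` exactly `g t` times. -/
def sortedList (g : κ → ℕ) : List κ := (∑ t, g t • ({t} : Multiset κ)).toList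

theorem perm_sortedList [DecidableEq κ] (l : List κ) :
    l.Perm (sortedList fun t => l.count t) := by
  rw [← Multiset.coe_eq_coe, sortedList, Multiset.coe_toList]
  ext t
  rw [Multiset.count_sum']
  simp [Multiset.count_singleton]

/-- Modulo shorter words any word may be sorted, and a sorted word of length less than n is
determined by multiplicities less than n. This leaves at most a power of n spanning vectors; squares
of odd letters need not be reduced. -/
theorem fiberFilt_le (n : ℕ) : F.fiberFilt χ n ≤ Submodule.span K
    (Set.range fun g : κ → Fin n => Fiber.ι k R χ (F.word A (sortedList fun t => g t))) := by
  classical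
  induction n with
  | zero =>
    refine Submodule.span_le.2 ?_
    rintro _ ⟨l, hl, rfl⟩
    exact absurd hl (Nat.not_lt_zero _)
  | succ n ih =>
    refine Submodule.span_le.2 ?_
    rintro _ ⟨l, hl, rfl⟩
    have hl' : l.length < n + 1 := hl
    obtain ⟨c, hc⟩ := F.word_perm (A := A) (perm_sortedList l)
    have h1 := ih (F.ι_mem_fiberFilt χ (F.filt_mono (Nat.lt_succ_iff.1 hl') hc))
    have h2 : Submodule.span K
        (Set.range fun g : κ → Fin n => Fiber.ι k R χ (F.word A (sortedList fun t => g t))) ≤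
        Submodule.span K (Set.range fun g : κ → Fin (n + 1) =>
          Fiber.ι k R χ (F.word A (sortedList fun t => g t))) := by
      refine Submodule.span_mono ?_
      rintro _ ⟨g, rfl⟩
      exact ⟨fun t => (g t).castSucc, rfl⟩
    have h3 : Fiber.ι k R χ (F.word A (sortedList fun t => l.count t)) ∈
        Submodule.span K (Set.range fun g : κ → Fin (n + 1) =>
          Fiber.ι k R χ (F.word A (sortedList fun t => g t))) :=
      Submodule.subset_span ⟨fun t => ⟨l.count t, (List.count_le_length).trans_lt hl'⟩, rfl⟩
    have h4 := add_mem (h2 h1) (zsmul_mem h3 c)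
    rwa [map_sub, map_zsmul, sub_add_cancel] at h4

instance finite_fiberFilt (n : ℕ) : FiniteDimensional K (F.fiberFilt χ n) :=
  FiniteDimensional.span_of_finite K (Set.Finite.image _ (List.finite_length_lt κ n))

theorem finrank_fiberFilt_le (n : ℕ) :
    Module.finrank K (F.fiberFilt χ n) ≤ n ^ Fintype.card κ := by
  classical
  have := FiniteDimensional.span_of_finite K (Set.finite_range fun g : κ → Fin n =>
    Fiber.ι k R χ (F.word A (sortedList fun t => g t)))
  refine ((Submodule.finrank_mono (F.fiberFilt_le χ n)).trans (finrank_range_le_card _)).trans ?_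
  rw [Fintype.card_fun, Fintype.card_fin]

theorem finrank_fiberFilt_one_pos : 0 < Module.finrank K (F.fiberFilt χ 1) := by
  rw [Module.finrank_pos_iff_exists_ne_zero]
  refine ⟨⟨Fiber.ι k R χ 1, F.ι_mem_fiberFilt χ (F.word_mem (l := []) (by simp))⟩, fun h => ?_⟩
  exact Fiber.ι_one_ne_zero χ (congrArg Subtype.val h)

/-- A matrix of operators which acts injectively on the fibre is not wider than high: the operators
of order less than `n` grow polynomially. -/
theorem card_le_of_injective (F : VectorFrame k R κ) {P Q : Type*} [Fintype P] [Fintype Q] (Y : P → Q → AD k R A)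
    (h : ∀ u : P → Fiber k R χ, (∀ t, ∑ r, Fiber.ρ k R χ (op (Y r t)) (u r) = 0) → u = 0) :
    Fintype.card P ≤ Fintype.card Q := by
  classical
  -- The entries of the matrix have a common bound c on their order.
  obtain ⟨c, hc⟩ : ∃ c, ∀ r t, Y r t ∈ F.filt A (c + 1) := by
    choose c₀ hc₀ using fun r t => F.exists_mem_filt (Y r t)
    refine ⟨∑ r, ∑ t, c₀ r t, fun r t => F.filt_mono ?_ (hc₀ r t)⟩
    have h1 : c₀ r t ≤ ∑ t, c₀ r t :=
      Finset.single_le_sum (f := c₀ r) (fun _ _ => Nat.zero_le _) (Finset.mem_univ t)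
    have h2 : ∑ t, c₀ r t ≤ ∑ r, ∑ t, c₀ r t :=
      Finset.single_le_sum (f := fun r => ∑ t, c₀ r t) (fun _ _ => Nat.zero_le _)
        (Finset.mem_univ r)
    omega
  -- The matrix restricts to an injective linear map between finite-dimensional filtration steps,
  -- with a shift by c.
  have hstep (n : ℕ) : Fintype.card P * Module.finrank K (F.fiberFilt χ n) ≤
      Fintype.card Q * Module.finrank K (F.fiberFilt χ (n + c)) := by
    let f : (P → F.fiberFilt χ n) →ₗ[K] (Q → F.fiberFilt χ (n + c)) :=
      LinearMap.pi fun t => ∑ r,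
        ((Fiber.ρ k R χ (op (Y r t))).restrict fun z hz => F.ρ_mem_fiberFilt χ (hc r t) hz) ∘ₗ
          LinearMap.proj r
    have hf : Function.Injective f := by
      rw [← LinearMap.ker_eq_bot, LinearMap.ker_eq_bot']
      intro u hu
      have := h (fun r => (u r : Fiber k R χ)) fun t => by
        have h1 := congrArg (fun w => ((w t : F.fiberFilt χ (n + c)) : Fiber k R χ)) hu
        simpa [f, LinearMap.sum_apply] using h1
      exact funext fun r => Subtype.ext (congrFun this r)
    have := LinearMap.finrank_le_finrank_of_injective hf
    simpa [Module.finrank_pi_fintype] using this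
  by_contra hlt
  rw [not_le] at hlt
  refine not_forall_pow_le (Fintype.card κ) c (Fintype.card Q) fun m => ?_
  -- If the matrix were too wide, each shift by c would multiply the dimension by at least (card Q +
  -- 1)/card Q. The start is order zero, where the dimension is positive.
  have hind : (Fintype.card Q + 1) ^ m * Module.finrank K (F.fiberFilt χ 1) ≤
      Fintype.card Q ^ m * Module.finrank K (F.fiberFilt χ (1 + m * c)) := by
    induction m with
    | zero => rw [zero_mul, add_zero, pow_zero, pow_zero]
    | succ m ih =>
      calc (Fintype.card Q + 1) ^ (m + 1) * Module.finrank K (F.fiberFilt χ 1)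
          = (Fintype.card Q + 1) *
            ((Fintype.card Q + 1) ^ m * Module.finrank K (F.fiberFilt χ 1)) := by ring
        _ ≤ (Fintype.card Q + 1) *
            (Fintype.card Q ^ m * Module.finrank K (F.fiberFilt χ (1 + m * c))) := by gcongr
        _ ≤ Fintype.card P *
            (Fintype.card Q ^ m * Module.finrank K (F.fiberFilt χ (1 + m * c))) := by
          gcongr; exact hlt
        _ = Fintype.card Q ^ m *
            (Fintype.card P * Module.finrank K (F.fiberFilt χ (1 + m * c))) := by ring
        _ ≤ Fintype.card Q ^ m *
            (Fintype.card Q * Module.finrank K (F.fiberFilt χ (1 + m * c + c))) := by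
          exact Nat.mul_le_mul_left _ (hstep _)
        _ = _ := by
          rw [pow_succ, mul_assoc, show 1 + m * c + c = 1 + (m + 1) * c by ring]
  calc (Fintype.card Q + 1) ^ m
      ≤ (Fintype.card Q + 1) ^ m * Module.finrank K (F.fiberFilt χ 1) :=
        Nat.le_mul_of_pos_right _ (F.finrank_fiberFilt_one_pos χ)
    _ ≤ Fintype.card Q ^ m * Module.finrank K (F.fiberFilt χ (1 + m * c)) := hind
    _ ≤ Fintype.card Q ^ m * (1 + m * c) ^ Fintype.card κ := by
        gcongr; exact F.finrank_fiberFilt_le χ _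
    _ = _ := mul_comm _ _

end VectorFrame

end Growth

/-! ## Uniqueness of the rank -/

section Parity

variable {k R A K : Type u} [Field k] [CharZero k] [Ring R] [Algebra k R] [Super k R]
variable [Ring A] [Algebra k A] [Super k A] [DAlgebra k R A] [Field K] (χ : A →+* K)
variable {κ : Type u} [Fintype κ]

theorem IsPurelyEven.parity_diffOps (hev : IsPurelyEven k R) (P : diffOps k R) :
    parity k (diffOps k R) P = P := by
  refine Subtype.ext (LinearMap.ext fun a => ?_)
  show parity k R (P.1 (parity k R a)) = P.1 a
  rw [hev, hev]

theorem VectorFrame.parity_word (F : VectorFrame k R κ) (hev : IsPurelyEven k R) (l : List κ) :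
    parity k (AD k R A) (F.word A l) = F.word A l := by
  induction l with
  | nil => rw [F.word_nil, map_one]
  | cons t l ih =>
    rw [F.word_cons, map_mul, ih, VectorFrame.diff, AD.parity_ofOp, hev.parity_diffOps]

/-- Over a purely even base, the right action of an operator on the fibre does not see its
parity. -/
theorem VectorFrame.ρ_parity (F : VectorFrame k R κ) (hev : IsPurelyEven k R)
    (hχ : ∀ a, χ (parity k A a) = χ a) (y : AD k R A) :
    Fiber.ρ k R χ (op (parity k _ y)) = Fiber.ρ k R χ (op y) := by
  have h (x y : AD k R A) :
      Fiber.ι k R χ (parity k _ x * y) = Fiber.ι k R χ (x * y) := by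
    obtain ⟨n, hx⟩ := F.exists_mem_filt x
    refine F.filt_induction
      (p := fun x => Fiber.ι k R χ (parity k _ x * y) = Fiber.ι k R χ (x * y)) ?_
      (fun x x' hx hx' => ?_) (fun a l _ => ?_) hx
    · rw [map_zero]
    · rw [map_add, add_mul, add_mul, map_add, map_add, hx, hx']
    · rw [map_mul (parity k (AD k R A)), AD.parity_ofFun, F.parity_word hev, mul_assoc, mul_assoc, Fiber.ι_ofFun_mul,
        Fiber.ι_ofFun_mul, hχ]
  refine Fiber.end_ext χ fun x => ?_
  -- Parity of a left factor is invisible in the fibre. It is inserted on x, so that the parity of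
  -- the whole product x y appears, and is then removed from that product.
  rw [Fiber.ρ_ι, Fiber.ρ_ι, ← h x, ← map_mul]
  have := h (x * y) 1
  rwa [mul_one, mul_one] at this

end Parity

/-! ### Common denominators and the Ore condition for finite families -/

section Uniform

variable {C N T T' : Type*} [Ring C] [AddCommGroup N] [Module Cᵐᵒᵖ N] [Fintype T]

/-- Common denominators for finitely many elements. -/
theorem exists_uniform_pow_smul_eq_sum [Fintype T'] {G : C} {W : T → N}
    (h : ∀ x : N, ∃ (l : ℕ) (c : T → C), op (G ^ l) • x = ∑ t, op (c t) • W t) (w : T' → N) :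
    ∃ (l : ℕ) (Y : T → T' → C), ∀ j, op (G ^ l) • w j = ∑ t, op (Y t j) • W t := by
  choose l₀ a₀ ha₀ using fun j => h (w j)
  refine ⟨∑ j, l₀ j, fun t j => a₀ j t * G ^ (∑ j, l₀ j - l₀ j), fun j => ?_⟩
  have : l₀ j ≤ ∑ j, l₀ j := Finset.single_le_sum (fun _ _ => Nat.zero_le _) (Finset.mem_univ j)
  conv_lhs => rw [← Nat.add_sub_cancel' this, pow_add, op_mul, mul_smul, ha₀, Finset.smul_sum]
  simp only [op_mul, mul_smul]

/-- The Ore condition for finitely many elements. -/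
theorem exists_uniform_mul_pow {k C : Type u} [Ring C] [Field k] [Algebra k C] [Fintype T'] {G : C}
    (hG : ∀ x, AdNilpotent k G x) (X : T' → T → C) (l : ℕ) :
    ∃ (L : ℕ) (X' : T' → T → C), ∀ s t, X s t * G ^ L = G ^ l * X' s t := by
  choose L₀ X₀ h₀ using fun s t => (hG (X s t)).exists_mul_pow l
  refine ⟨∑ s, ∑ t, L₀ s t, fun s t => X₀ s t * G ^ (∑ s, ∑ t, L₀ s t - L₀ s t), fun s t => ?_⟩
  have h1 : L₀ s t ≤ ∑ t, L₀ s t :=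
    Finset.single_le_sum (f := L₀ s) (fun _ _ => Nat.zero_le _) (Finset.mem_univ t)
  have h2 : ∑ t, L₀ s t ≤ ∑ s, ∑ t, L₀ s t :=
    Finset.single_le_sum (f := fun s => ∑ t, L₀ s t) (fun _ _ => Nat.zero_le _)
      (Finset.mem_univ s)
  rw [← mul_assoc, ← h₀, mul_assoc, ← pow_add, Nat.add_sub_cancel' (h1.trans h2)]

end Uniform

/-! ### Transition matrices acting on the fibre -/

section Uniqueness

variable {k R A K : Type u} [Field k] [CharZero k] [Ring R] [Algebra k R] [Super k R]
variable [Ring A] [Algebra k A] [Super k A] [DAlgebra k R A] [Field K] (χ : A →+* K)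
variable {N : Type u} [AddCommGroup N] [Module (AD k R A)ᵐᵒᵖ N]
variable {T T' : Type} [Fintype T] [Fintype T']

/-- The transition matrix between local bases acts injectively on the fibre. -/
theorem Fiber.ρ_transition_injective {g g' : A} (hg : IsHom k 0 g) (hg' : IsHom k 0 g')
    (hχ : χ g ≠ 0) (hχ' : χ g' ≠ 0) {v : T → N} {v' : T' → N}
    (hspan : ∀ x : N, ∃ (l : ℕ) (c : T → AD k R A),
      op (AD.ofFun k R A g ^ l) • x = ∑ t, op (c t) • v t)
    (hind' : ∀ c : T' → AD k R A, ∑ t, op (c t) • v' t = 0 →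
      ∃ l : ℕ, ∀ t, c t * AD.ofFun k R A g' ^ l = 0)
    {l' : ℕ} {Y : T' → T → AD k R A}
    (hY : ∀ t, op (AD.ofFun k R A g' ^ l') • v t = ∑ r, op (Y r t) • v' r)
    (u : T' → Fiber k R χ) (hu : ∀ t, ∑ r, ρ k R χ (op (Y r t)) (u r) = 0) : u = 0 := by
  classical
  set G := AD.ofFun k R A g with hG
  set G' := AD.ofFun k R A g' with hG'
  -- X is the transition matrix in the opposite direction; the Ore condition replaces it by X' so
  -- that it can be composed with Y despite the denominator of Y.
  obtain ⟨l, X, hX⟩ := exists_uniform_pow_smul_eq_sum hspan v'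
  obtain ⟨L, X', hX'⟩ := exists_uniform_mul_pow (AD.adNilpotent (R := R) hg') X l'
  refine funext fun s => ?_
  -- Substituting one expansion into the other shows that Y X' equals the diagonal matrix with entry
  -- G^l G'^L up to a relation among the v', hence up to torsion.
  have hrel : ∑ r, op (∑ t, Y r t * X' t s - if r = s then G ^ l * G' ^ L else 0) • v' r = 0 := by
    have h1 : op (G ^ l * G' ^ L) • v' s = ∑ r, op (∑ t, Y r t * X' t s) • v' r := by
      have h2 (t : T) : op (G' ^ L) • op (X t s) • v t = ∑ r, op (Y r t * X' t s) • v' r :=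
        op_pow_smul_op_smul (hY t) (hX' t s)
      rw [op_mul, mul_smul, hX, Finset.smul_sum, Finset.sum_congr rfl fun t _ => h2 t,
        Finset.sum_comm]
      refine Finset.sum_congr rfl fun r _ => ?_
      rw [← Finset.sum_smul]
      congr 1
      exact (map_sum (opAddEquiv (α := AD k R A)) _ _).symm
    have h2 (r : T') := op_sub_smul (∑ t, Y r t * X' t s) (if r = s then G ^ l * G' ^ L else 0)
      (v' r)
    rw [Finset.sum_congr rfl fun r _ => h2 r, Finset.sum_sub_distrib, ← h1,
      Finset.sum_eq_single s (fun r _ hr => by rw [if_neg hr, op_zero, zero_smul]) (by simp),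
      if_pos rfl, sub_self]
  obtain ⟨M, hM⟩ := hind' _ hrel
  -- Applied to u with u Y = 0, the identity leaves only u s times powers of G and G', each of which
  -- acts injectively.
  have hz : ∑ r, ρ k R χ (op ((∑ t, Y r t * X' t s - if r = s then G ^ l * G' ^ L else 0) *
      G' ^ M)) (u r) = 0 :=
    Finset.sum_eq_zero fun r _ => by rw [hM, op_zero, map_zero, LinearMap.zero_apply]
  have h3 (r : T') : ρ k R χ (op ((∑ t, Y r t * X' t s - if r = s then G ^ l * G' ^ L else 0) *
      G' ^ M)) (u r) = ρ k R χ (op (G' ^ M)) (∑ t, ρ k R χ (op (X' t s)) (ρ k R χ (op (Y r t)) (u r)))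
        - if r = s then ρ k R χ (op (G' ^ M)) (ρ k R χ (op (G' ^ L)) (ρ k R χ (op (G ^ l)) (u s)))
          else 0 := by
    have h4 : op (∑ t, Y r t * X' t s) = ∑ t, op (X' t s) * op (Y r t) :=
      map_sum (opAddEquiv (α := AD k R A)) _ _
    rw [op_mul, op_sub, map_mul, Module.End.mul_apply, map_sub, LinearMap.sub_apply, map_sub, h4,
      map_sum, LinearMap.sum_apply]
    congr 1
    · simp only [map_mul, Module.End.mul_apply]
    split_ifs with h
    · rw [h, op_mul, map_mul, Module.End.mul_apply]
    · rw [op_zero, map_zero, LinearMap.zero_apply, map_zero]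
  rw [Finset.sum_congr rfl fun r _ => h3 r, Finset.sum_sub_distrib, ← map_sum, Finset.sum_comm,
    Finset.sum_eq_zero fun t _ => by rw [← map_sum, hu, map_zero], map_zero, zero_sub,
    neg_eq_zero, Finset.sum_ite_eq' Finset.univ s, if_pos (Finset.mem_univ s)] at hz
  exact ρ_ofFun_pow_injective χ hg hχ l (ρ_ofFun_pow_injective χ hg' hχ' L
    (ρ_ofFun_pow_injective χ hg' hχ' M hz))

end Uniqueness

section ParityOfTransition

variable {k R A K : Type u} [Field k] [CharZero k] [Ring R] [Algebra k R] [Super k R]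
variable [Ring A] [Algebra k A] [Super k A] [DAlgebra k R A] [Field K] (χ : A →+* K)
variable {κ : Type u} [Fintype κ] {T : Type*} [Fintype T]

theorem LocalFields.conj_sum (θ : T → LocalFields k R A) :
    conj (∑ t, θ t) = ∑ t, conj (θ t) :=
  map_sum (AddMonoidHom.mk' (conj (k := k) (R := R) (A := A)) conj_add) _ _

/-- Over a purely even base, transition matrices between local bases act on the fibre by even
matrices. -/
theorem VectorFrame.smul_ρ_transition (F : VectorFrame k R κ) (hev : IsPurelyEven k R)
    (hχ : ∀ a, χ (parity k A a) = χ a) {g : A} (hg : IsHom k 0 g) (hχg : χ g ≠ 0)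
    {v : T → LocalFields k R A}
    (hind : ∀ c : T → AD k R A, ∑ t, op (c t) • v t = 0 →
      ∃ l : ℕ, ∀ t, c t * AD.ofFun k R A g ^ l = 0)
    {w : LocalFields k R A} {l : ℕ} {Y : T → AD k R A}
    (hY : op (AD.ofFun k R A g ^ l) • w = ∑ t, op (Y t) • v t) {ε : ℤ} {ε' : T → ℤ}
    (hw : w.conj = ε • w) (hv : ∀ t, (v t).conj = ε' t • v t) (t : T) :
    ε • Fiber.ρ k R χ (op (Y t)) = ε' t • Fiber.ρ k R χ (op (Y t)) := by
  have h1 := congrArg LocalFields.conj hY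
  rw [LocalFields.conj_smul, LocalFields.conj_sum, hw, map_pow, AD.parity_ofFun,
    isHom_zero_iff.1 hg, smul_comm, hY, Finset.smul_sum] at h1
  -- Conjugating the expansion of w gives a second expansion; since w and the v t are eigenvectors
  -- of the parity, independence compares Y t with its parity conjugate up to torsion.
  obtain ⟨M, hM⟩ := hind (fun t => ε • Y t - ε' t • parity k _ (Y t)) (by
    have h2 (t : T) : op (ε • Y t - ε' t • parity k _ (Y t)) • v t =
        ε • op (Y t) • v t - (op (Y t) • v t).conj := by
      rw [LocalFields.conj_smul, hv, op_sub_smul (ε • Y t) (ε' t • parity k _ (Y t)) (v t),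
        op_smul, op_smul, smul_assoc, smul_assoc, smul_comm (ε' t)]
    rw [Finset.sum_congr rfl fun t _ => h2 t, Finset.sum_sub_distrib, h1, sub_self])
  rw [← sub_eq_zero]
  refine LinearMap.ext fun z => Fiber.ρ_ofFun_pow_injective χ hg hχg M ?_
  -- In the fibre the torsion factor acts injectively and the parity conjugate of Y t acts as Y t.
  have h3 := congrArg (fun x => Fiber.ρ k R χ (op x) z) (hM t)
  simpa [F.ρ_parity χ hev hχ] using h3

end ParityOfTransition

/-! ### Comparison of two local ranks -/

section FreeNear

theorem eq_zero_of_eq_neg (K : Type*) {V : Type*} [Field K] [CharZero K] [AddCommGroup V]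
    [Module K V] {x : V} (h : x = -x) : x = 0 := by
  rw [eq_neg_iff_add_eq_zero, ← two_smul K] at h
  exact (smul_eq_zero.1 h).resolve_left two_ne_zero

variable {k R A : Type u} [Field k] [CharZero k] [Ring R] [Algebra k R] [Super k R]
variable [Ring A] [Algebra k A] [Super k A] [DAlgebra k R A]
variable {κ : Type u} [Fintype κ]

/-- Only one inequality is needed, since the hypotheses are symmetric. It follows from the
injectivity of the transition matrix on the fibre and the growth bound, applied to the whole matrix
or to its diagonal blocks. -/
theorem VectorFrame.rank_le (F : VectorFrame k R κ) {q : Ideal A} (hq : q.IsPrime) {m n m' n' : ℕ}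
    (h : FreeNear k (AD.ofFun k R A).toRingHom
      (LocalFields.IsHomog (k := k) (R := R) (A := A)) q m n)
    (h' : FreeNear k (AD.ofFun k R A).toRingHom
      (LocalFields.IsHomog (k := k) (R := R) (A := A)) q m' n') :
    m' + n' ≤ m + n ∧ (IsPurelyEven k R → m' ≤ m ∧ n' ≤ n) := by
  obtain ⟨g, hg, hgq, v, hv0, hv1, hspan, -⟩ := h
  obtain ⟨g', hg', hgq', v', hv0', hv1', hspan', hind'⟩ := h'
  have hA : IsSuperComm k A := DAlgebra.comm (R := R)
  obtain ⟨K, _, χ, hχ, hχq⟩ := hA.exists_residueField hq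
  have hne : χ g ≠ 0 := fun h => hgq (hχq g h)
  have hne' : χ g' ≠ 0 := fun h => hgq' (hχq g' h)
  obtain ⟨l', Y, hY⟩ := exists_uniform_pow_smul_eq_sum hspan' v
  have hinj := Fiber.ρ_transition_injective χ hg hg' hne hne' hspan hind' hY
  refine ⟨by simpa using F.card_le_of_injective χ Y hinj, fun hev => ?_⟩
  -- Needed below to conclude from x = -x that x = 0.
  have : CharZero K := charZero_of_injective_ringHom (χ.comp (algebraMap k A)).injective
  let ε (m n : ℕ) : Fin m ⊕ Fin n → ℤ := Sum.elim (fun _ => 1) fun _ => -1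
  have hc (t : Fin m ⊕ Fin n) : LocalFields.conj (v t) = ε m n t • v t := by
    rcases t with t | t
    · exact LocalFields.isHomog_iff.1 (hv0 t)
    · exact LocalFields.isHomog_iff.1 (hv1 t)
  have hc' (t : Fin m' ⊕ Fin n') : LocalFields.conj (v' t) = ε m' n' t • v' t := by
    rcases t with t | t
    · exact LocalFields.isHomog_iff.1 (hv0' t)
    · exact LocalFields.isHomog_iff.1 (hv1' t)
  have htrans (t) := F.smul_ρ_transition χ hev hχ hg' hne' hind' (hY t) (hc t) hc'
  -- An entry between an even and an odd member acts as its own negative.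
  have hzero₁ (r : Fin m') (t : Fin n) : Fiber.ρ k R χ (op (Y (.inl r) (.inr t))) = 0 := by
    have := htrans (.inr t) (.inl r)
    simp only [ε, Sum.elim_inl, Sum.elim_inr, neg_smul, one_smul] at this
    exact eq_zero_of_eq_neg K this.symm
  have hzero₂ (r : Fin n') (t : Fin m) : Fiber.ρ k R χ (op (Y (.inr r) (.inl t))) = 0 := by
    have := htrans (.inl t) (.inr r)
    simp only [ε, Sum.elim_inl, Sum.elim_inr, neg_smul, one_smul] at this
    exact eq_zero_of_eq_neg K this
  constructor
  -- A tuple killed by a diagonal block, padded by zeros, is killed by the full matrix because the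
  -- mixed blocks act by zero.
  · have := F.card_le_of_injective χ (fun (r : Fin m') (t : Fin m) => Y (.inl r) (.inl t))
      fun u hu => by
        have := hinj (Sum.elim u 0) fun t => by
          rw [Fintype.sum_sum_type]
          rcases t with t | t
          · simpa using hu t
          · simp [hzero₁]
        exact funext fun r => congrFun this (.inl r)
    simpa using this
  · have := F.card_le_of_injective χ (fun (r : Fin n') (t : Fin n) => Y (.inr r) (.inr t))
      fun u hu => by
        have := hinj (Sum.elim 0 u) fun t => by
          rw [Fintype.sum_sum_type]
          rcases t with t | t
          · simp [hzero₂]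
          · simpa using hu t
        exact funext fun r => congrFun this (.inr r)
    simpa using this

end FreeNear

end DGeom

end

theorem mainTheorem5 {k R S : Type u} [Field k] [CharZero k]
    [Ring R] [Algebra k R] [Super k R] [Ring S] [Algebra k S] [Super k S]
    (hR : IsSuperComm k R) (hS : IsSuperComm k S)
    (hM : IsSmooth (SuperHom.scalars k R))
    (φ : SuperHom k R S) (hφ : IsSmooth φ) :
    -- the natural map exists, is an isomorphism and preserves parity
    (Function.Injective (InducedFields.eval φ) ∧
      ∃ e : LocalFields k R (Jet φ) ≃ₗ[(JetD φ)ᵐᵒᵖ] InducedFields φ,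
        (∀ θ, InducedFields.eval φ (e θ) = LocalFields.restrict φ θ) ∧
        ∀ (i : ZMod 2) (θ : LocalFields k R (Jet φ)),
          θ.IsHomog i ↔ e θ ∈ InducedFields.homog φ i) ∧
    -- ranks, at every point of `Jet(C)`
    ∀ q : Ideal (Jet φ), q.IsPrime →
      (∃ m n : ℕ, FreeNear k (RingHom.id S) (RelFields.IsHomog (φ := φ))
        (q.comap (Jet.of φ).toAlgHom) m n) ∧
      ∀ m n : ℕ, FreeNear k (RingHom.id S) (RelFields.IsHomog (φ := φ))
          (q.comap (Jet.of φ).toAlgHom) m n →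
        FreeNear k (AD.ofFun k R (Jet φ)).toRingHom
          (LocalFields.IsHomog (k := k) (R := R) (A := Jet φ)) q m n ∧
        ∀ m' n' : ℕ, FreeNear k (AD.ofFun k R (Jet φ)).toRingHom
            (LocalFields.IsHomog (k := k) (R := R) (A := Jet φ)) q m' n' →
          m' + n' = m + n ∧ (IsPurelyEven k R → m' = m ∧ n' = n) := by
  obtain ⟨ι, _, ⟨β⟩⟩ := hφ.exists_dualBasis hS
  replace hM := hM.exists_vectorFrame hR
  obtain ⟨κ, _, ⟨F⟩⟩ := hM
  refine ⟨⟨β.eval_injective, β.equiv, β.eval_toInduced, β.isHomog_iff_toInduced_mem⟩,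
    fun q hq => ⟨?_, fun m n h => ?_⟩⟩
  -- The contraction of q to 𝒪_C is checked to be a prime ideal directly from the definition.
  · refine β.exists_freeNear hS ⟨fun h => hq.ne_top ((Ideal.eq_top_iff_one q).2 ?_),
      fun h => hq.mem_or_mem ?_⟩
    · have := (Ideal.eq_top_iff_one _).1 h
      rwa [Ideal.mem_comap, map_one] at this
    · simpa using h
  · have h₀ := β.freeNear_localFields hS h
    refine ⟨h₀, fun m' n' h' => ?_⟩
    -- The two bases are compared in both directions.
    have h₁ := F.rank_le hq h₀ h'
    have h₂ := F.rank_le hq h' h₀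
    exact ⟨h₁.1.antisymm h₂.1, fun hev =>
      ⟨(h₁.2 hev).1.antisymm (h₂.2 hev).1, (h₁.2 hev).2.antisymm (h₂.2 hev).2⟩⟩
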